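/- Let $a<0$, $c<0$, $d>0$ and $s\ge 3/2$. For $0<\epsilon\le 1$ consider on $\mathbb R^2$ the Schrödinger-type Boussinesq system for real-valued $\eta(x,t)$ and $\mathbf v(x,t)=(v_1,v_2)(x,t)$, $$ \begin{cases} \eta_t+\nabla\cdot\mathbf v+\epsilon\big[\nabla\cdot(\eta\mathbf v)+a\,\nabla\cdot\Delta\mathbf v\big]=0,\\ \mathbf v_t+\nabla\eta+\epsilon\big[\tfrac12\nabla|\mathbf v|^2+c\,\nabla\Delta\eta-d\,\Delta\mathbf v_t\big]=0, \end{cases} $$ understood in the sense of distributions, and write $\|u\|_{H^r}=\|(1-\Delta)^{r/2}u\|_{L^2(\mathbb R^2)}$. (i) Assume $a=c$. There are functions $T=T(\cdot,\cdot)>0$ and $C=C(\cdot,\cdot)$, which do not depend on $\epsilon$, such that for every $\epsilon\in(0,1]$ and every $(\eta_0,\mathbf v_0)\in H^s(\mathbb R^2)\times H^{s+1}(\mathbb R^2)^2$ the following holds. With $T=T(\|\eta_0\|_{H^s},\|\mathbf v_0\|_{H^{s+1}})$, $C=C(\|\eta_0\|_{H^s},\|\mathbf v_0\|_{H^{s+1}})$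 and $T_\epsilon=T\epsilon^{-1/2}$, the system has a unique solution $$(\eta,\mathbf v)\in C([0,T_\epsilon];H^s(\mathbb R^2))\times C([0,T_\epsilon];H^{s+1}(\mathbb R^2)^2)$$ with initial data $(\eta_0,\mathbf v_0)$, and it is bounded uniformly in $\epsilon$ in the sense that $$\|\eta(t)\|_{H^s}^2+\|\mathbf v(t)\|_{H^s}^2+\epsilon\|\mathbf v(t)\|_{H^{s+1}}^2\le C\qquad\text{for all }t\in[0,T_\epsilon].$$ (ii) Assume $a\ne c$. There are functions $T=T(\cdot,\cdot)>0$ and $C=C(\cdot,\cdot)$, which do not depend on $\epsilon$, such that for every $\epsilon\in(0,1]$ and every $(\eta_0,\mathbf v_0)\in H^{s+1}(\mathbb R^2)\times H^{s+2}(\mathbb R^2)^2$ the following holds. With $T=T(\|\eta_0\|_{H^{s+1}},\|\mathbf v_0\|_{H^{s+2}})$, $C=C(\|\eta_0\|_{H^{s+1}},\|\mathbf v_0\|_{H^{s+2}})$ and $T_\epsilon=T\epsilon^{-1/2}$, the system has a unique solution $$(\eta,\mathbf v)\in C([0,T_\epsilon];H^{s+1}(\mathbb R^2))\times C([0,T_\epsilon];H^{s+2}(\mathbb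 R^2)^2)$$ with initial data $(\eta_0,\mathbf v_0)$, and it is bounded uniformly in $\epsilon$ in the sense that $$\|\eta(t)\|_{H^{s+1}}^2+\|\mathbf v(t)\|_{H^{s+1}}^2+\epsilon\|\mathbf v(t)\|_{H^{s+2}}^2\le C\qquad\text{for all }t\in[0,T_\epsilon].$$ -/

import Mathlib

open MeasureTheory Set Filter Topology
open scoped SchwartzMap LineDeriv Laplacian FourierTransform

noncomputable section

namespace Boussinesq

/-- The plane `ℝ²` with its Euclidean norm. -/
abbrev Plane : Type := EuclideanSpace ℝ (Fin 2)

/-- Real-valued square integrable functions on the plane (modulo equality almost everywhere). -/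
abbrev L2 : Type := Lp ℝ 2 (volume : Measure Plane)

/-- A real square integrable function regarded as a complex-valued one. -/
def toComplex (u : L2) : Lp ℂ 2 (volume : Measure Plane) := Complex.ofRealCLM.compLp u

/-- Membership of a real square integrable function in the `L²`-based Sobolev space `H^s(ℝ²)`
(for `s ≥ 0` these are all the real-valued elements of `H^s(ℝ²)`). -/
def MemH (s : ℝ) (u : L2) : Prop :=
  TemperedDistribution.MemSobolev s 2 (Lp.toTemperedDistribution (toComplex u))

/-- The norm `‖(1 - Δ)^{s/2} u‖_{L²}` of `H^s(ℝ²)`, for `u` in `H^s(ℝ²)`. In the normalization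
`𝓕 u (ξ) = ∫ e^{-2πi x·ξ} u(x) dx` of the Fourier transform, the operator `(1 - Δ)^{s/2}` has the
symbol `(1 + |2πξ|²)^{s/2}`. -/
def normH (s : ℝ) (u : L2) : ℝ :=
  (eLpNorm (fun ξ : Plane => (((1 + (2 * Real.pi * ‖ξ‖) ^ 2) ^ (s / 2) : ℝ) : ℂ) *
    (𝓕 (toComplex u) : Lp ℂ 2 (volume : Measure Plane)) ξ) 2 volume).toReal

/-- The norm of a vector field in `H^s(ℝ²)²`. -/
def vnormH (s : ℝ) (v : Fin 2 → L2) : ℝ := √(∑ j, normH s (v j) ^ 2)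

/-- `u ∈ C([0, T]; H^s(ℝ²))`; the values of `u` outside `[0, T]` are irrelevant. -/
def ContinuousInH (s T : ℝ) (u : ℝ → L2) : Prop :=
  ∀ t ∈ Icc 0 T, MemH s (u t) ∧
    Tendsto (fun τ => normH s (u τ - u t)) (𝓝[Icc 0 T] t) (𝓝 0)

/-- The partial derivative `∂_j φ` of a Schwartz function. -/
def pd (j : Fin 2) (φ : 𝓢(Plane, ℝ)) : 𝓢(Plane, ℝ) :=
  ∂_{(EuclideanSpace.single j 1 : Plane)} φ

/-- On the time interval `[0, T]` the pair `(η, v)` satisfies, in the sense of (tempered)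
distributions in space at every time, the system

* `η_t + ∇·v + ε (∇·(η v) + a ∇·Δv) = 0`,
* `v_t + ∇η + ε (½ ∇|v|² + c ∇Δη - d Δv_t) = 0`.

All space derivatives are moved to the test function `φ`, an odd number of them giving a sign. -/
def SolvesSystem (a c d ε T : ℝ) (η : ℝ → L2) (v : ℝ → Fin 2 → L2) : Prop :=
  ∀ t ∈ Icc 0 T, ∀ φ : 𝓢(Plane, ℝ),
    HasDerivWithinAt (fun τ => ∫ x, η τ x * φ x)
      (∫ x, ∑ j, (v t j x * pd j φ x +
        ε * (η t x * v t j x * pd j φ x + a * v t j x * pd j (Δ φ) x)))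
      (Icc 0 T) t ∧
    ∀ i, HasDerivWithinAt (fun τ => ∫ x, v τ i x * (φ x - ε * d * (Δ φ) x))
      (∫ x, (η t x * pd i φ x +
        ε * ((1 / 2) * (∑ j, v t j x ^ 2) * pd i φ x + c * η t x * pd i (Δ φ) x)))
      (Icc 0 T) t

/-- `(η, v)` is a solution in `C([0, T]; H^r(ℝ²)) × C([0, T]; H^σ(ℝ²)²)` of the system
with initial data `(η₀, v₀)`. -/
structure IsSolution (a c d ε r σ T : ℝ) (η₀ : L2) (v₀ : Fin 2 → L2)
    (η : ℝ → L2) (v : ℝ → Fin 2 → L2) : Prop where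
  continuous_eta : ContinuousInH r T η
  continuous_v : ∀ j, ContinuousInH σ T (fun t => v t j)
  initial_eta : η 0 = η₀
  initial_v : v 0 = v₀
  solves : SolvesSystem a c d ε T η v

end Boussinesq

end

/-! Write k = 2πξ. On the Fourier side the system reads η' = -i Σ_j k_j (al v_j + ε η * v_j) and
v_i' = -i k_i (be η + (ε / 2) de⁻¹ Σ_j v_j * v_j), where al, ce, de are the symbols of 1 + εaΔ, 1 +
εcΔ, 1 - εdΔ and be = ce / de. The signs of a, c, d make all of these at least one or positive. The
energy weighs η with ω² and v with ω² em, where em = al de / ce. Since em be = al (`Par.em_mul_be`),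
the linear terms cancel exactly (`Par.dEn_linear`). Moreover em is comparable to 1 + ε|k|² with
constants independent of ε (`Par.lo_mul_le_em`, `Par.em_le`), so for ω = `wt s` the energy E is
equivalent to ‖η‖_s² + ‖v‖_s² + ε‖v‖_{s+1}².

Each nonlinear term has a prefactor ε and loses one derivative. In ∇·(ηv) the derivative is kept off
η by skew-symmetry up to a commutator, because v is real (`abs_integral_comm_le`,
`Dilates.commutator`); in ∇|v|² it falls on v, and em / de is bounded. Either way the loss is
‖v‖_{s+1} ≲ ε^(-1/2) √E, so E' ≤ C √ε E^(3/2) (`Par.dEn_le`). Hence E at most doubles on a time of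
order ε^(-1/2). Products are controlled through the embedding of H^s into the Wiener algebra, which
needs only s > 1.

Solutions are limits of frequency truncations, which are ordinary differential equations on a closed
subspace of L² (`Par.exists_truncated`). Two solutions truncated at different radii are compared in
the energy with ω = 1 by Gronwall's inequality, with an error that tends to zero with the truncation
(`Par.stability`); this yields both convergence and uniqueness. The constant there may depend on ε.

Continuity in time with values in H^s, rather than mere boundedness, comes from a choice of ω. Given
the data there is ω = `wt s` √h with h → ∞ at infinity for which the data still have finite norm
(`exists_weight`). The energy estimate sees only how ω grows under dilations, so it holds for this ω
with the same constant. Boundedness in the stronger norm and continuity in L² give continuity in H^s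
(`tendsto_hs_of_tendsto`).

The distributional formulation is linked to the Fourier side by multiplying the equation with `wt
(-4)`, which turns the right-hand side into a continuous map of L². A curve that satisfies the weak
equations is then differentiable in norm (`hasDerivWithinAt_of_weak`, `IsSolution.fSol`). Both parts
of the theorem are instances of `wellposed`, at regularity s and s + 1. -/

noncomputable section

namespace Boussinesq

/-! ### Sobolev weights on the frequency plane -/

/-- The weight `(1 + |2πξ|²)^{r/2}`. -/
def wt (r : ℝ) (ξ : Plane) : ℝ := (1 + (2 * Real.pi * ‖ξ‖) ^ 2) ^ (r / 2)

/-- The symbol of `-i ∂_j`. -/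
def freq (j : Fin 2) (ξ : Plane) : ℝ := 2 * Real.pi * ξ j

lemma wt_base_one_le (ξ : Plane) : 1 ≤ 1 + (2 * Real.pi * ‖ξ‖) ^ 2 := by
  have := sq_nonneg (2 * Real.pi * ‖ξ‖); linarith

lemma wt_pos (r : ℝ) (ξ : Plane) : 0 < wt r ξ :=
  Real.rpow_pos_of_pos (by linarith [wt_base_one_le ξ]) _

lemma wt_zero (ξ : Plane) : wt 0 ξ = 1 := by simp [wt]

lemma wt_add (r q : ℝ) (ξ : Plane) : wt (r + q) ξ = wt r ξ * wt q ξ := by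
  rw [wt, wt, wt, ← Real.rpow_add (by linarith [wt_base_one_le ξ])]; ring_nf

lemma wt_two (ξ : Plane) : wt 2 ξ = 1 + (2 * Real.pi * ‖ξ‖) ^ 2 := by
  rw [wt]; norm_num

lemma wt_one_sq (ξ : Plane) : wt 1 ξ ^ 2 = 1 + (2 * Real.pi * ‖ξ‖) ^ 2 := by
  rw [← wt_two, sq, ← wt_add]; norm_num

lemma wt_mono {r q : ℝ} (h : r ≤ q) (ξ : Plane) : wt r ξ ≤ wt q ξ :=
  Real.rpow_le_rpow_of_exponent_le (wt_base_one_le ξ) (by linarith)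

lemma one_le_wt {r : ℝ} (h : 0 ≤ r) (ξ : Plane) : 1 ≤ wt r ξ := by
  rw [← wt_zero ξ]; exact wt_mono h ξ

lemma wt_le_one {r : ℝ} (h : r ≤ 0) (ξ : Plane) : wt r ξ ≤ 1 := by
  rw [← wt_zero ξ]; exact wt_mono h ξ

lemma wt_neg_mul (r : ℝ) (ξ : Plane) : wt (-r) ξ * wt r ξ = 1 := by
  rw [← wt_add, neg_add_cancel, wt_zero]

lemma wt_norm_mono {r : ℝ} (hr : 0 ≤ r) {ξ ζ : Plane} (h : ‖ξ‖ ≤ ‖ζ‖) : wt r ξ ≤ wt r ζ := by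
  unfold wt
  have := Real.pi_pos
  gcongr

lemma wt_norm_anti {r : ℝ} (hr : r ≤ 0) {ξ ζ : Plane} (h : ‖ξ‖ ≤ ‖ζ‖) : wt r ζ ≤ wt r ξ := by
  have h1 := wt_norm_mono (r := -r) (by linarith) h
  have h2 := wt_neg_mul r ξ
  have h3 := wt_neg_mul r ζ
  have := wt_pos r ξ
  have := wt_pos r ζ
  have := wt_pos (-r) ξ
  have h4 : wt r ζ * (wt (-r) ξ * wt r ξ) ≤ wt r ξ * (wt (-r) ζ * wt r ζ) := by
    have : wt r ζ * wt r ξ * wt (-r) ξ ≤ wt r ζ * wt r ξ * wt (-r) ζ := by gcongr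
    nlinarith
  rwa [h2, h3, mul_one, mul_one] at h4

lemma continuous_wt (r : ℝ) : Continuous (wt r) := by
  unfold wt
  refine Continuous.rpow_const (by fun_prop) (fun ξ => Or.inl ?_)
  have := wt_base_one_le ξ; positivity

@[fun_prop]
lemma measurable_wt (r : ℝ) : Measurable (wt r) := (continuous_wt r).measurable

lemma continuous_freq (j : Fin 2) : Continuous (freq j) := by unfold freq; fun_prop

@[fun_prop]
lemma measurable_freq (j : Fin 2) : Measurable (freq j) := (continuous_freq j).measurable

lemma norm_le_wt_one (ξ : Plane) : 2 * Real.pi * ‖ξ‖ ≤ wt 1 ξ := by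
  have := Real.pi_pos
  refine (sq_le_sq₀ (by positivity) (wt_pos 1 ξ).le).1 ?_
  rw [wt_one_sq]; linarith

lemma abs_freq_le (j : Fin 2) (ξ : Plane) : |freq j ξ| ≤ 2 * Real.pi * ‖ξ‖ := by
  have := Real.pi_pos
  rw [freq, abs_mul, abs_of_pos (by positivity)]
  gcongr
  simpa using PiLp.norm_apply_le ξ j

lemma abs_freq_le_wt (j : Fin 2) (ξ : Plane) : |freq j ξ| ≤ wt 1 ξ :=
  (abs_freq_le j ξ).trans (norm_le_wt_one ξ)

lemma wt_neg_arg (r : ℝ) (ξ : Plane) : wt r (-ξ) = wt r ξ := by simp [wt]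

lemma freq_neg (j : Fin 2) (ξ : Plane) : freq j (-ξ) = -freq j ξ := by simp [freq]

/-- A positive power of the weight grows at most like that power under dilations. -/
lemma wt_dilate {r : ℝ} (hr : 0 ≤ r) {l : ℝ} (hl : 1 ≤ l) {ξ ζ : Plane} (h : ‖ξ‖ ≤ l * ‖ζ‖) :
    wt r ξ ≤ l ^ r * wt r ζ := by
  have hp := Real.pi_pos
  have h1 : 1 + (2 * Real.pi * ‖ξ‖) ^ 2 ≤ l ^ 2 * (1 + (2 * Real.pi * ‖ζ‖) ^ 2) := by
    have : (2 * Real.pi * ‖ξ‖) ^ 2 ≤ (2 * Real.pi * (l * ‖ζ‖)) ^ 2 := by gcongr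
    nlinarith
  have h0 := wt_base_one_le ζ
  unfold wt
  calc (1 + (2 * Real.pi * ‖ξ‖) ^ 2) ^ (r / 2)
      ≤ (l ^ 2 * (1 + (2 * Real.pi * ‖ζ‖) ^ 2)) ^ (r / 2) := by gcongr
    _ = l ^ r * _ := by
        rw [Real.mul_rpow (by positivity) (by positivity), ← Real.rpow_natCast,
          ← Real.rpow_mul (by positivity)]
        congr 2; push_cast; ring

/-- Of the two frequencies ζ and ξ - ζ that add up to ξ, one carries at least half of it.
Quasi-subadditivity of the weights rests on this dichotomy. -/
lemma norm_le_or_norm_le (ξ ζ : Plane) : ‖ξ‖ ≤ 2 * ‖ζ‖ ∨ ‖ξ‖ ≤ 2 * ‖ξ - ζ‖ := by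
  by_contra! h
  have : ‖ξ‖ ≤ ‖ξ - ζ‖ + ‖ζ‖ := by simpa using norm_add_le (ξ - ζ) ζ
  linarith

lemma wt_quasi_add {r : ℝ} (hr : 0 ≤ r) (ξ ζ : Plane) :
    wt r ξ ≤ 2 ^ r * wt r ζ + 2 ^ r * wt r (ξ - ζ) := by
  have h1 : 0 ≤ (2 : ℝ) ^ r := by positivity
  rcases norm_le_or_norm_le ξ ζ with h | h
  · have := wt_dilate hr one_le_two h
    have := mul_nonneg h1 (wt_pos r (ξ - ζ)).le
    linarith
  · have := wt_dilate hr one_le_two h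
    have := mul_nonneg h1 (wt_pos r ζ).le
    linarith

/-- The kernel inequality behind the product estimate `H^s × H^1 → H^1`. -/
lemma wt_one_kernel {s : ℝ} (hs : 1 ≤ s) (ξ ζ : Plane) :
    wt 1 ξ ≤ (2 * wt s ζ) * wt (1 - s) (ξ - ζ) + 2 * wt 1 (ξ - ζ) := by
  have h2 : (2 : ℝ) ^ (1 : ℝ) = 2 := by norm_num
  have hp := mul_pos (wt_pos s ζ) (wt_pos (1 - s) (ξ - ζ))
  have hq := wt_pos 1 (ξ - ζ)
  have hd : ∀ η : Plane, ‖ξ‖ ≤ 2 * ‖η‖ → wt 1 ξ ≤ 2 * wt 1 η := fun η h => by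
    simpa [h2] using wt_dilate (r := 1) zero_le_one one_le_two h
  rcases le_total ‖ζ‖ ‖ξ - ζ‖ with h | h
  · have : ‖ξ‖ ≤ 2 * ‖ξ - ζ‖ := by
      have : ‖ξ‖ ≤ ‖ξ - ζ‖ + ‖ζ‖ := by simpa using norm_add_le (ξ - ζ) ζ
      linarith
    linarith [hd _ this]
  · have : ‖ξ‖ ≤ 2 * ‖ζ‖ := by
      have : ‖ξ‖ ≤ ‖ξ - ζ‖ + ‖ζ‖ := by simpa using norm_add_le (ξ - ζ) ζ
      linarith
    have h3 := hd _ this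
    -- Here ζ is the larger frequency. The surplus 1 - s ≤ 0 of its exponent is moved to the smaller
    -- frequency ξ - ζ, where a negative power is larger.
    have h4 : wt 1 ζ = wt s ζ * wt (1 - s) ζ := by rw [← wt_add]; congr 1; ring
    have h5 := wt_norm_anti (r := 1 - s) (by linarith) h
    have := mul_le_mul_of_nonneg_left h5 (wt_pos s ζ).le
    linarith

/-! ### Weighted `L²` and `L¹` bounds in extended nonnegative reals -/

/-- The `L²` norm of a nonnegative function. -/
def N2 (F : Plane → ENNReal) : ENNReal := (∫⁻ ξ, F ξ ^ (2 : ℝ)) ^ (1 / 2 : ℝ)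

/-- The `L¹` norm of a nonnegative function. -/
def N1 (F : Plane → ENNReal) : ENNReal := ∫⁻ ξ, F ξ

/-- The convolution of nonnegative functions. -/
def cv (F G : Plane → ENNReal) (ξ : Plane) : ENNReal := ∫⁻ ζ, F ζ * G (ξ - ζ)

lemma N2_mono {F G : Plane → ENNReal} (h : ∀ᵐ ξ, F ξ ≤ G ξ) : N2 F ≤ N2 G := by
  unfold N2
  gcongr ?_ ^ _
  refine lintegral_mono_ae ?_
  filter_upwards [h] with ξ hξ
  gcongr

lemma N2_congr {F G : Plane → ENNReal} (h : ∀ᵐ ξ, F ξ = G ξ) : N2 F = N2 G :=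
  le_antisymm (N2_mono (h.mono fun _ e => e.le)) (N2_mono (h.mono fun _ e => e.ge))

lemma N2_add_le {F G : Plane → ENNReal} (hF : AEMeasurable F) (hG : AEMeasurable G) :
    N2 (fun ξ => F ξ + G ξ) ≤ N2 F + N2 G :=
  ENNReal.lintegral_Lp_add_le hF hG one_le_two

lemma N2_const_mul (c : ENNReal) (hc : c ≠ ⊤) (F : Plane → ENNReal) :
    N2 (fun ξ => c * F ξ) = c * N2 F := by
  unfold N2
  simp_rw [ENNReal.mul_rpow_of_nonneg _ _ (zero_le_two : (0 : ℝ) ≤ 2)]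
  rw [lintegral_const_mul' _ _ (by simp [hc]),
    ENNReal.mul_rpow_of_nonneg _ _ (by norm_num), ← ENNReal.rpow_mul]
  norm_num

lemma lintegral_mul_le_N2 {F G : Plane → ENNReal} (hF : AEMeasurable F) (hG : AEMeasurable G) :
    ∫⁻ ξ, F ξ * G ξ ≤ N2 F * N2 G :=
  ENNReal.lintegral_mul_le_Lp_mul_Lq volume Real.HolderConjugate.two_two hF hG

lemma measurable_cv {F G : Plane → ENNReal} (hF : Measurable F) (hG : Measurable G) :
    Measurable (cv F G) := by
  unfold cv
  exact Measurable.lintegral_prod_right' (f := fun p : Plane × Plane => F p.2 * G (p.1 - p.2))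
    (by fun_prop)

lemma cv_comm (F G : Plane → ENNReal) (ξ : Plane) : cv F G ξ = cv G F ξ := by
  unfold cv
  rw [← lintegral_sub_left_eq_self (fun ζ => F ζ * G (ξ - ζ)) ξ]
  simp [mul_comm]

lemma N2_sq (F : Plane → ENNReal) : N2 F ^ (2 : ℝ) = ∫⁻ ξ, F ξ ^ (2 : ℝ) := by
  rw [N2, ← ENNReal.rpow_mul]; norm_num

/-- Young's inequality `L² * L¹ ⊆ L²`. -/
lemma N2_cv_le {F G : Plane → ENNReal} (hF : Measurable F) (hG : Measurable G) :
    N2 (cv F G) ≤ N2 F * N1 G := by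
  have hpt : ∀ ξ, cv F G ξ ^ (2 : ℝ) ≤ N1 G * ∫⁻ ζ, F ζ ^ (2 : ℝ) * G (ξ - ζ) := by
    intro ξ
    -- Cauchy–Schwarz after writing G as G^(1/2) G^(1/2); Tonelli then integrates the surviving
    -- factor in ξ.
    have h1 : cv F G ξ ≤ (∫⁻ ζ, (F ζ * G (ξ - ζ) ^ (1 / 2 : ℝ)) ^ (2 : ℝ)) ^ (1 / 2 : ℝ) *
        (∫⁻ ζ, (G (ξ - ζ) ^ (1 / 2 : ℝ)) ^ (2 : ℝ)) ^ (1 / 2 : ℝ) := by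
      refine le_trans (le_of_eq ?_) (ENNReal.lintegral_mul_le_Lp_mul_Lq volume
        Real.HolderConjugate.two_two (f := fun ζ => F ζ * G (ξ - ζ) ^ (1 / 2 : ℝ))
        (g := fun ζ => G (ξ - ζ) ^ (1 / 2 : ℝ)) (by fun_prop) (by fun_prop))
      unfold cv
      refine lintegral_congr fun ζ => ?_
      simp only [Pi.mul_apply]
      rw [mul_assoc, ← ENNReal.rpow_add_of_nonneg _ _ (by norm_num) (by norm_num)]
      norm_num
    have h2 : ∀ ζ, (G (ξ - ζ) ^ (1 / 2 : ℝ)) ^ (2 : ℝ) = G (ξ - ζ) := fun ζ => by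
      rw [← ENNReal.rpow_mul]; norm_num
    simp_rw [ENNReal.mul_rpow_of_nonneg _ _ (zero_le_two : (0 : ℝ) ≤ 2), h2] at h1
    rw [lintegral_sub_left_eq_self G ξ] at h1
    calc cv F G ξ ^ (2 : ℝ) ≤ _ := ENNReal.rpow_le_rpow h1 zero_le_two
      _ = _ := by
        rw [ENNReal.mul_rpow_of_nonneg _ _ (zero_le_two : (0 : ℝ) ≤ 2), ← ENNReal.rpow_mul,
          ← ENNReal.rpow_mul, N1, mul_comm]
        norm_num
  have h3 : N2 (cv F G) ^ (2 : ℝ) ≤ (N2 F * N1 G) ^ (2 : ℝ) := by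
    rw [N2_sq]
    calc ∫⁻ ξ, cv F G ξ ^ (2 : ℝ) ≤ ∫⁻ ξ, N1 G * ∫⁻ ζ, F ζ ^ (2 : ℝ) * G (ξ - ζ) :=
          lintegral_mono hpt
      _ = N1 G * ∫⁻ ζ, ∫⁻ ξ, F ζ ^ (2 : ℝ) * G (ξ - ζ) := by
          rw [lintegral_const_mul, lintegral_lintegral_swap]
          · exact Measurable.aemeasurable (by fun_prop)
          · exact Measurable.lintegral_prod_right'
              (f := fun p : Plane × Plane => F p.2 ^ (2 : ℝ) * G (p.1 - p.2)) (by fun_prop)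
      _ = N1 G * (N2 F ^ (2 : ℝ) * N1 G) := by
          congr 1
          have : ∀ ζ, ∫⁻ ξ, F ζ ^ (2 : ℝ) * G (ξ - ζ) = F ζ ^ (2 : ℝ) * N1 G := fun ζ => by
            rw [lintegral_const_mul _ (by fun_prop), lintegral_sub_right_eq_self G ζ, N1]
          simp_rw [this]
          rw [lintegral_mul_const _ (by fun_prop), N2_sq]
      _ = _ := by
          rw [ENNReal.mul_rpow_of_nonneg _ _ (zero_le_two : (0 : ℝ) ≤ 2)]
          simp only [ENNReal.rpow_ofNat]; ring
  exact (ENNReal.rpow_le_rpow_iff (by norm_num : (0 : ℝ) < 2)).1 h3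

lemma N2_cv_le' {F G : Plane → ENNReal} (hF : Measurable F) (hG : Measurable G) :
    N2 (cv F G) ≤ N1 F * N2 G := by
  rw [show cv F G = cv G F from funext (cv_comm F G), mul_comm]
  exact N2_cv_le hG hF

/-- Weighted convolution estimate from a kernel inequality for the weight. -/
lemma N2_mul_cv_le {w p₁ q₁ p₂ q₂ F G : Plane → ENNReal} (hF : Measurable F) (hG : Measurable G)
    (hp₁ : Measurable p₁) (hq₁ : Measurable q₁) (hp₂ : Measurable p₂) (hq₂ : Measurable q₂)
    (h : ∀ ξ ζ, w ξ ≤ p₁ ζ * q₁ (ξ - ζ) + p₂ ζ * q₂ (ξ - ζ)) :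
    N2 (fun ξ => w ξ * cv F G ξ) ≤
      N2 (fun ξ => p₁ ξ * F ξ) * N1 (fun ξ => q₁ ξ * G ξ) +
      N1 (fun ξ => p₂ ξ * F ξ) * N2 (fun ξ => q₂ ξ * G ξ) := by
  have hpt : ∀ ξ, w ξ * cv F G ξ ≤ cv (fun ξ => p₁ ξ * F ξ) (fun ξ => q₁ ξ * G ξ) ξ +
      cv (fun ξ => p₂ ξ * F ξ) (fun ξ => q₂ ξ * G ξ) ξ := by
    intro ξ
    unfold cv
    rw [← lintegral_const_mul _ (by fun_prop), ← lintegral_add_left (by fun_prop)]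
    refine lintegral_mono fun ζ => ?_
    calc w ξ * (F ζ * G (ξ - ζ))
        ≤ (p₁ ζ * q₁ (ξ - ζ) + p₂ ζ * q₂ (ξ - ζ)) * (F ζ * G (ξ - ζ)) := by gcongr; exact h ξ ζ
      _ = _ := by ring
  refine (N2_mono (Eventually.of_forall hpt)).trans ((N2_add_le
    (measurable_cv (by fun_prop) (by fun_prop)).aemeasurable
    (measurable_cv (by fun_prop) (by fun_prop)).aemeasurable).trans ?_)
  gcongr
  · exact N2_cv_le (by fun_prop) (by fun_prop)
  · exact N2_cv_le' (by fun_prop) (by fun_prop)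

/-- The weight `wt r` with values in the extended nonnegative reals. -/
def ewt (r : ℝ) (ξ : Plane) : ENNReal := ENNReal.ofReal (wt r ξ)

@[fun_prop]
lemma measurable_ewt (r : ℝ) : Measurable (ewt r) := (measurable_wt r).ennreal_ofReal

lemma ewt_add (r q : ℝ) (ξ : Plane) : ewt (r + q) ξ = ewt r ξ * ewt q ξ := by
  rw [ewt, ewt, ewt, wt_add, ENNReal.ofReal_mul (wt_pos r ξ).le]

lemma ewt_zero (ξ : Plane) : ewt 0 ξ = 1 := by simp [ewt, wt_zero]

lemma ewt_mono {r q : ℝ} (h : r ≤ q) (ξ : Plane) : ewt r ξ ≤ ewt q ξ :=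
  ENNReal.ofReal_le_ofReal (wt_mono h ξ)

/-- `‖(1+|k|²)^{-s/2}‖_{L²}`, the constant of the embedding of `H^s` into the Wiener algebra. -/
def wienerC (s : ℝ) : ENNReal := N2 (ewt (-s))

/-- On the plane (1 + |k|²)^(-s) is integrable as soon as 2s exceeds the dimension 2. This is what
asks for s > 1. -/
lemma wienerC_lt_top {s : ℝ} (hs : 1 < s) : wienerC s < ⊤ := by
  unfold wienerC N2
  refine ENNReal.rpow_lt_top_of_nonneg (by norm_num) (ne_of_lt ?_)
  have hi : Integrable (fun ξ : Plane => ((1 : ℝ) + ‖ξ‖ ^ 2) ^ (-(2 * s) / 2)) := by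
    refine integrable_rpow_neg_one_add_norm_sq (r := 2 * s) ?_
    simp; linarith
  have h2 := hi.lintegral_lt_top
  refine lt_of_le_of_lt (lintegral_mono fun ξ => ?_) h2
  rw [ewt, ENNReal.ofReal_rpow_of_pos (wt_pos _ _)]
  refine ENNReal.ofReal_le_ofReal ?_
  have h0 := wt_base_one_le ξ
  rw [wt, ← Real.rpow_mul (by linarith)]
  rw [show -s / 2 * 2 = -(2 * s) / 2 by ring]
  refine Real.rpow_le_rpow_of_nonpos (by positivity) ?_ (by linarith)
  have : (1 : ℝ) ≤ 2 * Real.pi := by linarith [Real.pi_gt_three]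
  have : 1 * ‖ξ‖ ≤ 2 * Real.pi * ‖ξ‖ := by gcongr
  have : ‖ξ‖ ^ 2 ≤ (2 * Real.pi * ‖ξ‖) ^ 2 := by
    apply pow_le_pow_left₀ (norm_nonneg _); linarith
  linarith

/-- Cauchy–Schwarz against `ewt (-s)`: s derivatives in L² buy absolute integrability of the Fourier
transform. -/
lemma N1_le (s r : ℝ) {F : Plane → ENNReal} (hF : Measurable F) :
    N1 (fun ξ => ewt r ξ * F ξ) ≤ wienerC s * N2 (fun ξ => ewt (s + r) ξ * F ξ) := by
  refine le_trans (le_of_eq ?_) (lintegral_mul_le_N2 (F := ewt (-s))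
    (G := fun ξ => ewt (s + r) ξ * F ξ) (by fun_prop) (by fun_prop))
  unfold N1
  refine lintegral_congr fun ξ => ?_
  rw [← mul_assoc, ← ewt_add]; ring_nf

lemma N1_le' (s : ℝ) {F : Plane → ENNReal} (hF : Measurable F) :
    N1 F ≤ wienerC s * N2 (fun ξ => ewt s ξ * F ξ) := by
  simpa [ewt_zero] using N1_le s 0 hF

/-- The product estimate `H^s × H^1 → H^1`, `s > 1`, on the Fourier side. -/
lemma N2_cv_wt_one_le {s : ℝ} (hs : 1 ≤ s) {F G : Plane → ENNReal} (hF : Measurable F)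
    (hG : Measurable G) :
    N2 (fun ξ => ewt 1 ξ * cv F G ξ) ≤
      4 * wienerC s * N2 (fun ξ => ewt s ξ * F ξ) * N2 (fun ξ => ewt 1 ξ * G ξ) := by
  have hk : ∀ ξ ζ, ewt 1 ξ ≤ (2 * ewt s ζ) * ewt (1 - s) (ξ - ζ) + 2 * ewt 1 (ξ - ζ) := by
    intro ξ ζ
    have h := ENNReal.ofReal_le_ofReal (wt_one_kernel hs ξ ζ)
    have h1 := (wt_pos s ζ).le
    have h2 := (wt_pos (1 - s) (ξ - ζ)).le
    have h3 := (wt_pos 1 (ξ - ζ)).le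
    rwa [ENNReal.ofReal_add (by positivity) (by positivity), ENNReal.ofReal_mul (by positivity),
      ENNReal.ofReal_mul zero_le_two, ENNReal.ofReal_mul zero_le_two, ENNReal.ofReal_ofNat] at h
  refine (N2_mul_cv_le hF hG (p₁ := fun ζ => 2 * ewt s ζ) (q₁ := ewt (1 - s)) (p₂ := fun _ => 2)
    (q₂ := ewt 1) (by fun_prop) (by fun_prop) (by fun_prop) (by fun_prop) hk).trans ?_
  have e1 : N2 (fun ξ => 2 * ewt s ξ * F ξ) = 2 * N2 (fun ξ => ewt s ξ * F ξ) := by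
    simp_rw [mul_assoc]; exact N2_const_mul 2 (by norm_num) _
  have e2 : N1 (fun ξ => 2 * F ξ) = 2 * N1 F := lintegral_const_mul _ hF
  rw [e1, e2]
  have h4 := N1_le s (1 - s) hG
  rw [show s + (1 - s) = 1 by ring] at h4
  calc _ ≤ 2 * N2 (fun ξ => ewt s ξ * F ξ) * (wienerC s * N2 (fun ξ => ewt 1 ξ * G ξ)) +
        2 * (wienerC s * N2 (fun ξ => ewt s ξ * F ξ)) * N2 (fun ξ => ewt 1 ξ * G ξ) := by
        gcongr
        exact N1_le' s hF
    _ = _ := by ring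

/-- The product estimate for a quasi-subadditive weight. -/
lemma N2_cv_weight_le {C : ENNReal} (hC : C ≠ ⊤) {Θ : Plane → ENNReal} (hΘ : Measurable Θ)
    (h : ∀ ξ ζ, Θ ξ ≤ C * Θ ζ + C * Θ (ξ - ζ))
    {F G : Plane → ENNReal} (hF : Measurable F) (hG : Measurable G) :
    N2 (fun ξ => Θ ξ * cv F G ξ) ≤
      C * (N2 (fun ξ => Θ ξ * F ξ) * N1 G + N1 F * N2 (fun ξ => Θ ξ * G ξ)) := by
  refine (N2_mul_cv_le hF hG (p₁ := fun ζ => C * Θ ζ) (q₁ := fun _ => 1) (p₂ := fun _ => C)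
    (q₂ := Θ) (by fun_prop) (by fun_prop) (by fun_prop) (by fun_prop)
    (fun ξ ζ => by simpa using h ξ ζ)).trans (le_of_eq ?_)
  have e1 : N2 (fun ξ => C * Θ ξ * F ξ) = C * N2 (fun ξ => Θ ξ * F ξ) := by
    simp_rw [mul_assoc]; exact N2_const_mul C hC _
  have e2 : N1 (fun ξ => C * F ξ) = C * N1 F := lintegral_const_mul _ hF
  simp only [one_mul]
  rw [e1, e2]; ring

/-! ### Trilinear bounds -/

/-- The three bounds of this part differ in the factor that is measured in L¹. For B or D it enters
through Young's inequality; for A, Cauchy–Schwarz in ζ alone leaves the integral of A. -/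
lemma trilinear_N2_N1_N2 {A B D : Plane → ENNReal} (hA : Measurable A) (hB : Measurable B)
    (hD : Measurable D) :
    ∫⁻ ξ, ∫⁻ ζ, A ξ * B (ξ - ζ) * D ζ ≤ N2 A * N1 B * N2 D := by
  have : ∀ ξ, ∫⁻ ζ, A ξ * B (ξ - ζ) * D ζ = A ξ * cv D B ξ := fun ξ => by
    unfold cv
    rw [← lintegral_const_mul _ (by fun_prop)]
    exact lintegral_congr fun ζ => by ring
  simp_rw [this]
  refine (lintegral_mul_le_N2 hA.aemeasurable (measurable_cv hD hB).aemeasurable).trans ?_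
  rw [mul_assoc, mul_comm (N1 B)]
  gcongr
  exact N2_cv_le hD hB

lemma trilinear_N2_N2_N1 {A B D : Plane → ENNReal} (hA : Measurable A) (hB : Measurable B)
    (hD : Measurable D) :
    ∫⁻ ξ, ∫⁻ ζ, A ξ * B (ξ - ζ) * D ζ ≤ N2 A * N2 B * N1 D := by
  have : ∀ ξ, ∫⁻ ζ, A ξ * B (ξ - ζ) * D ζ = A ξ * cv D B ξ := fun ξ => by
    unfold cv
    rw [← lintegral_const_mul _ (by fun_prop)]
    exact lintegral_congr fun ζ => by ring
  simp_rw [this]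
  refine (lintegral_mul_le_N2 hA.aemeasurable (measurable_cv hD hB).aemeasurable).trans ?_
  rw [mul_assoc, mul_comm (N2 B)]
  gcongr
  exact N2_cv_le' hD hB

lemma trilinear_N1_N2_N2 {A B D : Plane → ENNReal} (hA : Measurable A) (hB : Measurable B)
    (hD : Measurable D) :
    ∫⁻ ξ, ∫⁻ ζ, A ξ * B (ξ - ζ) * D ζ ≤ N1 A * N2 B * N2 D := by
  have : ∀ ξ, ∫⁻ ζ, A ξ * B (ξ - ζ) * D ζ ≤ A ξ * (N2 B * N2 D) := fun ξ => by
    simp_rw [mul_assoc]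
    rw [lintegral_const_mul _ (by fun_prop)]
    gcongr
    refine (lintegral_mul_le_N2 (by fun_prop) hD.aemeasurable).trans (le_of_eq ?_)
    congr 1
    unfold N2
    rw [lintegral_sub_left_eq_self (fun ζ => B ζ ^ (2 : ℝ)) ξ]
  refine (lintegral_mono this).trans (le_of_eq ?_)
  rw [lintegral_mul_const _ hA, N1, mul_assoc]

/-! ### Slowly growing radial weights -/

/-- `ω` is radially nondecreasing and grows at most like the `q`-th power under dilations. -/
def Dilates (q : ℕ) (ω : Plane → ℝ) : Prop :=
  ∀ l : ℝ, 1 ≤ l → ∀ ξ ζ : Plane, ‖ξ‖ ≤ l * ‖ζ‖ → ω ξ ≤ l ^ q * ω ζ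

/-- The weights used in the energy estimates at the level of `H^s`. -/
structure IsWeight (s : ℝ) (q : ℕ) (ω : Plane → ℝ) : Prop where
  measurable : Measurable ω
  le : ∀ ξ, wt s ξ ≤ ω ξ
  dilates : Dilates q ω

lemma IsWeight.pos {s : ℝ} {q : ℕ} {ω : Plane → ℝ} (h : IsWeight s q ω) (ξ : Plane) : 0 < ω ξ :=
  (wt_pos s ξ).trans_le (h.le ξ)

lemma Dilates.quasi_add {q : ℕ} {ω : Plane → ℝ} (h : Dilates q ω) (h0 : ∀ ξ, 0 ≤ ω ξ)
    (ξ ζ : Plane) : ω ξ ≤ 2 ^ q * ω ζ + 2 ^ q * ω (ξ - ζ) := by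
  have h1 : (0 : ℝ) ≤ 2 ^ q := by positivity
  have := mul_nonneg h1 (h0 ζ)
  have := mul_nonneg h1 (h0 (ξ - ζ))
  rcases norm_le_or_norm_le ξ ζ with h' | h'
  · have := h 2 one_le_two _ _ h'; linarith
  · have := h 2 one_le_two _ _ h'; linarith

lemma Dilates.mono {q : ℕ} {ω : Plane → ℝ} (h : Dilates q ω) {ξ ζ : Plane} (hn : ‖ξ‖ ≤ ‖ζ‖) :
    ω ξ ≤ ω ζ := by
  simpa using h 1 le_rfl ξ ζ (by simpa using hn)

lemma Dilates.bounded {q : ℕ} {ω : Plane → ℝ} (h : Dilates q ω) (ρ : ℝ) :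
    ∃ C, ∀ ξ, ‖ξ‖ ≤ ρ → ω ξ ≤ C := by
  refine ⟨ω (EuclideanSpace.single 0 ρ), fun ξ hξ => h.mono (hξ.trans ?_)⟩
  simpa using le_abs_self ρ

lemma dilates_wt_one : Dilates 1 (wt 1) := fun l hl ξ ζ h => by
  simpa using wt_dilate zero_le_one hl h

lemma Dilates.mul {q p : ℕ} {ω θ : Plane → ℝ} (h : Dilates q ω) (h' : Dilates p θ)
    (h1 : ∀ ξ, 0 ≤ ω ξ) (h2 : ∀ ξ, 0 ≤ θ ξ) : Dilates (q + p) (fun ξ => ω ξ * θ ξ) := by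
  intro l hl ξ ζ hn
  calc ω ξ * θ ξ ≤ (l ^ q * ω ζ) * (l ^ p * θ ζ) := by
        have := h1 ζ
        gcongr
        · exact h2 ξ
        · exact h l hl ξ ζ hn
        · exact h' l hl ξ ζ hn
    _ = _ := by rw [pow_add]; ring

/-- Stands in for the mean value theorem: it makes the growth of a weight under dilations by l
linear in l - 1 when l is near one. The weights themselves need not be differentiable. -/
lemma pow_sub_one_le (n : ℕ) {l : ℝ} (h1 : 1 ≤ l) (h2 : l ≤ 2) :
    l ^ n - 1 ≤ n * 2 ^ n * (l - 1) := by
  induction n with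
  | zero => simp
  | succ n ih =>
    have h3 : l ^ n ≤ 2 ^ n := by gcongr
    have h4 : (0 : ℝ) ≤ 2 ^ n := by positivity
    have h5 : l ^ (n + 1) - 1 = l * (l ^ n - 1) + (l - 1) := by ring
    have h6 : (0 : ℝ) ≤ n * 2 ^ n * (l - 1) := by
      have : 0 ≤ l - 1 := by linarith
      positivity
    have h7 : (1 : ℝ) ≤ 2 ^ n := one_le_pow₀ one_le_two
    rw [h5]
    push_cast
    rw [pow_succ]
    have h8 : l * (l ^ n - 1) ≤ 2 * (n * 2 ^ n * (l - 1)) := by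
      have : 0 ≤ l ^ n - 1 := by linarith [one_le_pow₀ h1 (n := n)]
      nlinarith
    nlinarith

/-! ### The commutator kernel for weights without derivatives -/

/-- The constant in the commutator kernel estimate. -/
def commC (q : ℕ) : ℝ := 1 + 2 * (↑(2 * q) * 2 ^ (2 * q)) + 2 * 2 ^ q

lemma commC_pos (q : ℕ) : 0 < commC q := by unfold commC; positivity

/-- For |ζ| ≤ |ξ| ≤ 2|ζ| the dilation bound with l = |ξ| / |ζ| gives ω(ξ)² - ω(ζ)² ≲ (l - 1) ω(ζ)²,
and (l - 1)|ξ| = l (|ξ| - |ζ|) ≤ 2|ξ - ζ| pays for the factor k_j(ξ). For |ξ| > 2|ζ| the frequency ξ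
- ζ is comparable to ξ and takes the derivative. -/
lemma Dilates.commutator_aux {q : ℕ} {ω : Plane → ℝ} (h : Dilates q ω) (h0 : ∀ ξ, 0 ≤ ω ξ)
    (j : Fin 2) {ξ ζ : Plane} (hle : ‖ζ‖ ≤ ‖ξ‖) :
    |ω ξ ^ 2 * freq j ξ - ω ζ ^ 2 * freq j ζ| ≤
      commC q * (wt 1 (ξ - ζ) * (ω ξ * ω ζ + ω ξ * ω (ξ - ζ))) := by
  have hp := Real.pi_pos
  have hm := h.mono hle
  have hk : |freq j ξ - freq j ζ| ≤ wt 1 (ξ - ζ) := by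
    have : freq j ξ - freq j ζ = freq j (ξ - ζ) := by simp [freq]; ring
    rw [this]; exact abs_freq_le_wt j _
  have hw := (wt_pos 1 (ξ - ζ)).le
  have hx := h0 ξ
  have hz := h0 ζ
  have hd := h0 (ξ - ζ)
  have hkx := abs_freq_le j ξ
  have ht := norm_le_wt_one (ξ - ζ)
  have htri : ‖ξ‖ ≤ ‖ξ - ζ‖ + ‖ζ‖ := by simpa using norm_add_le (ξ - ζ) ζ
  have hsq : ω ζ ^ 2 ≤ ω ξ * ω ζ := by nlinarith
  have hsq' : ω ζ ^ 2 ≤ ω ξ ^ 2 := by gcongr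
  have h1 : |ω ξ ^ 2 * freq j ξ - ω ζ ^ 2 * freq j ζ| ≤
      ω ζ ^ 2 * wt 1 (ξ - ζ) + (ω ξ ^ 2 - ω ζ ^ 2) * (2 * Real.pi * ‖ξ‖) := by
    have : ω ξ ^ 2 * freq j ξ - ω ζ ^ 2 * freq j ζ =
      ω ζ ^ 2 * (freq j ξ - freq j ζ) + (ω ξ ^ 2 - ω ζ ^ 2) * freq j ξ := by ring
    rw [this]
    refine (abs_add_le _ _).trans ?_
    rw [abs_mul, abs_mul, abs_of_nonneg (sq_nonneg (ω ζ)), abs_of_nonneg (sub_nonneg.2 hsq')]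
    have : 0 ≤ ω ξ ^ 2 - ω ζ ^ 2 := by linarith
    gcongr
  have hA : ω ζ ^ 2 * wt 1 (ξ - ζ) ≤ wt 1 (ξ - ζ) * (ω ξ * ω ζ + ω ξ * ω (ξ - ζ)) := by
    rw [mul_comm]
    have := mul_nonneg hx hd
    gcongr; linarith
  set Q := wt 1 (ξ - ζ) * (ω ξ * ω ζ + ω ξ * ω (ξ - ζ)) with hQ
  have hQ0 : 0 ≤ Q := by positivity
  have hB : (ω ξ ^ 2 - ω ζ ^ 2) * (2 * Real.pi * ‖ξ‖) ≤
      (2 * (↑(2 * q) * 2 ^ (2 * q)) + 2 * 2 ^ q) * Q := by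
    by_cases hc : ‖ξ‖ ≤ 2 * ‖ζ‖
    · rcases (norm_nonneg ζ).eq_or_lt with h00 | h00
      · have : ‖ξ‖ = 0 := le_antisymm (by linarith) (norm_nonneg _)
        rw [this]; simp; positivity
      set l := ‖ξ‖ / ‖ζ‖ with hl
      have hlx : ‖ξ‖ = l * ‖ζ‖ := by rw [hl]; field_simp
      have hl1 : 1 ≤ l := by rw [hl, le_div_iff₀ h00]; simpa
      have hl2 : l ≤ 2 := by rw [hl, div_le_iff₀ h00]; exact hc
      have h2 : ω ξ ^ 2 - ω ζ ^ 2 ≤ (↑(2 * q) * 2 ^ (2 * q) * (l - 1)) * ω ζ ^ 2 := by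
        have h3 : ω ξ ^ 2 ≤ (l ^ q * ω ζ) ^ 2 := by
          gcongr; exact h l hl1 ξ ζ hlx.le
        have h4 := pow_sub_one_le (2 * q) hl1 hl2
        have h5 : (l ^ q * ω ζ) ^ 2 = l ^ (2 * q) * ω ζ ^ 2 := by rw [mul_pow, ← pow_mul, mul_comm q]
        have h6 := mul_le_mul_of_nonneg_right h4 (sq_nonneg (ω ζ))
        rw [h5] at h3
        linarith
      have h7 : (l - 1) * ‖ξ‖ ≤ 2 * ‖ξ - ζ‖ := by
        have : (l - 1) * ‖ξ‖ = l * (‖ξ‖ - ‖ζ‖) := by rw [hlx]; ring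
        rw [this]
        have h8 : 0 ≤ ‖ξ‖ - ‖ζ‖ := by linarith
        nlinarith
      calc (ω ξ ^ 2 - ω ζ ^ 2) * (2 * Real.pi * ‖ξ‖)
          ≤ ((↑(2 * q) * 2 ^ (2 * q) * (l - 1)) * ω ζ ^ 2) * (2 * Real.pi * ‖ξ‖) := by gcongr
        _ = (↑(2 * q) * 2 ^ (2 * q)) * ω ζ ^ 2 * (2 * Real.pi * ((l - 1) * ‖ξ‖)) := by ring
        _ ≤ (↑(2 * q) * 2 ^ (2 * q)) * ω ζ ^ 2 * (2 * Real.pi * (2 * ‖ξ - ζ‖)) := by gcongr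
        _ = 2 * (↑(2 * q) * 2 ^ (2 * q)) * (ω ζ ^ 2 * (2 * Real.pi * ‖ξ - ζ‖)) := by ring
        _ ≤ 2 * (↑(2 * q) * 2 ^ (2 * q)) * Q := by
          gcongr
          refine le_trans ?_ hA
          gcongr
        _ ≤ _ := by
          have : (0 : ℝ) ≤ 2 * 2 ^ q * Q := by positivity
          linarith
    · push Not at hc
      have h3 : ‖ξ‖ ≤ 2 * ‖ξ - ζ‖ := by linarith
      have h4 := h 2 one_le_two _ _ h3
      calc (ω ξ ^ 2 - ω ζ ^ 2) * (2 * Real.pi * ‖ξ‖)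
          ≤ (ω ξ * (2 ^ q * ω (ξ - ζ))) * (2 * Real.pi * (2 * ‖ξ - ζ‖)) := by
            gcongr
            nlinarith [sq_nonneg (ω ζ)]
        _ = 2 * 2 ^ q * ((2 * Real.pi * ‖ξ - ζ‖) * (ω ξ * ω (ξ - ζ))) := by ring
        _ ≤ 2 * 2 ^ q * Q := by
          rw [hQ]
          have := mul_nonneg hx hz
          gcongr
          linarith
        _ ≤ _ := by
          have : (0 : ℝ) ≤ 2 * (↑(2 * q) * 2 ^ (2 * q)) * Q := by positivity
          linarith
  calc _ ≤ _ := h1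
    _ ≤ Q + (2 * (↑(2 * q) * 2 ^ (2 * q)) + 2 * 2 ^ q) * Q := add_le_add hA hB
    _ = _ := by unfold commC; ring

/-- The kernel inequality behind the commutator estimate. -/
lemma Dilates.commutator {q : ℕ} {ω : Plane → ℝ} (h : Dilates q ω) (h0 : ∀ ξ, 0 ≤ ω ξ)
    (j : Fin 2) (ξ ζ : Plane) :
    |ω ξ ^ 2 * freq j ξ - ω ζ ^ 2 * freq j ζ| ≤
      commC q * (wt 1 (ξ - ζ) * (ω ξ * ω ζ + ω ξ * ω (ξ - ζ) + ω ζ * ω (ξ - ζ))) := by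
  have hc := (commC_pos q).le
  have hw := (wt_pos 1 (ξ - ζ)).le
  have := mul_nonneg (h0 ξ) (h0 (ξ - ζ))
  have := mul_nonneg (h0 ζ) (h0 (ξ - ζ))
  rcases le_total ‖ζ‖ ‖ξ‖ with hle | hle
  · refine (h.commutator_aux h0 j hle).trans
      (mul_le_mul_of_nonneg_left (mul_le_mul_of_nonneg_left ?_ hw) hc)
    linarith
  · have h1 := h.commutator_aux h0 j hle
    -- Radial monotonicity in both directions makes ω even.
    have h2 : ω (ζ - ξ) = ω (ξ - ζ) :=
      le_antisymm (h.mono (norm_sub_rev _ _).le) (h.mono (norm_sub_rev _ _).le)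
    have h3 : wt 1 (ζ - ξ) = wt 1 (ξ - ζ) := by rw [← wt_neg_arg, neg_sub]
    rw [abs_sub_comm, h2, h3] at h1
    refine h1.trans (mul_le_mul_of_nonneg_left (mul_le_mul_of_nonneg_left ?_ hw) hc)
    linarith [mul_comm (ω ζ) (ω ξ)]

/-! ### Weights adapted to given data -/

/-- A finite measure density on the plane still has finite mass after multiplication with a suitable
unbounded, sublinearly growing, radial function. -/
lemma exists_slow_growth {g : Plane → ENNReal} (hg : Measurable g) (hfin : ∫⁻ ξ, g ξ ≠ ⊤) :
    ∃ h : Plane → ℝ, Measurable h ∧ (∀ ξ, 1 ≤ h ξ) ∧ Dilates 1 h ∧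
      (∀ K : ℝ, ∃ ρ : ℝ, ∀ ξ, ρ ≤ ‖ξ‖ → K ≤ h ξ) ∧
      ∫⁻ ξ, g ξ * ENNReal.ofReal (h ξ) ≤ (∫⁻ ξ, g ξ) + 1 := by
  have hlim : Tendsto (fun R : ℝ => ∫⁻ ξ : Plane, g ξ * ENNReal.ofReal (min 1 (‖ξ‖ / R))) atTop
      (𝓝 (∫⁻ _ : Plane, 0)) := by
    refine tendsto_lintegral_filter_of_dominated_convergence g
      (Eventually.of_forall fun R => by fun_prop)
      (Eventually.of_forall fun R => Eventually.of_forall fun ξ => ?_) hfin ?_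
    · calc g ξ * ENNReal.ofReal (min 1 (‖ξ‖ / R)) ≤ g ξ * 1 := by
            gcongr
            exact ENNReal.ofReal_le_one.2 (min_le_left _ _)
        _ = g ξ := mul_one _
    · filter_upwards [ae_lt_top hg hfin] with ξ hξ
      have h1 : Tendsto (fun R : ℝ => min 1 (‖ξ‖ / R)) atTop (𝓝 0) := by
        have h2 : Tendsto (fun R : ℝ => ‖ξ‖ / R) atTop (𝓝 0) := tendsto_const_nhds.div_atTop tendsto_id
        simpa using (tendsto_const_nhds (x := (1 : ℝ))).min h2
      have h3 := ENNReal.tendsto_ofReal h1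
      rw [ENNReal.ofReal_zero] at h3
      simpa using ENNReal.Tendsto.const_mul h3 (Or.inr hξ.ne)
  rw [lintegral_zero] at hlim
  -- The bound 2^k ≤ R makes Σ min(1, |ξ| / R_k) converge; the bound 2^(-k-1) makes the total mass
  -- it adds at most one.
  have hR : ∀ k : ℕ, ∃ R : ℝ, 2 ^ k ≤ R ∧
      ∫⁻ ξ : Plane, g ξ * ENNReal.ofReal (min 1 (‖ξ‖ / R)) ≤ (2⁻¹ : ENNReal) ^ (k + 1) := by
    intro k
    have h1 : ∀ᶠ R : ℝ in atTop, ∫⁻ ξ : Plane, g ξ * ENNReal.ofReal (min 1 (‖ξ‖ / R)) ≤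
        (2⁻¹ : ENNReal) ^ (k + 1) :=
      hlim.eventually_le_const (ENNReal.pow_pos (by simp) _)
    obtain ⟨R, h2, h3⟩ := (h1.and (eventually_ge_atTop (2 ^ k))).exists
    exact ⟨R, h3, h2⟩
  choose R hR1 hR2 using hR
  have hRpos : ∀ k, 0 < R k := fun k => lt_of_lt_of_le (by positivity) (hR1 k)
  have hsum : ∀ ξ : Plane, Summable (fun k => min 1 (‖ξ‖ / R k)) := by
    intro ξ
    refine Summable.of_nonneg_of_le (fun k => le_min zero_le_one (by have := hRpos k; positivity))
      (fun k => ?_) (summable_geometric_two.mul_left ‖ξ‖)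
    refine (min_le_right _ _).trans ?_
    rw [div_eq_mul_inv, one_div, inv_pow]
    gcongr
    exact hR1 k
  have hnn : ∀ ξ : Plane, ∀ k, 0 ≤ min 1 (‖ξ‖ / R k) := fun ξ k =>
    le_min zero_le_one (by have := hRpos k; positivity)
  -- Each summand grows at most linearly under dilations and equals one for |ξ| ≥ R_k. So the sum
  -- dilates linearly, and it exceeds any n once |ξ| ≥ R_0 + ... + R_(n-1).
  refine ⟨fun ξ => 1 + ∑' k, min 1 (‖ξ‖ / R k), ?_, ?_, ?_, ?_, ?_⟩
  · have : Measurable fun ξ : Plane => (∑' k, ENNReal.ofReal (min 1 (‖ξ‖ / R k))).toReal :=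
      (Measurable.tsum fun k => by fun_prop).ennreal_toReal
    refine measurable_const.add ?_
    convert this using 2 with ξ
    rw [← ENNReal.ofReal_tsum_of_nonneg (hnn ξ) (hsum ξ), ENNReal.toReal_ofReal]
    exact tsum_nonneg (hnn ξ)
  · intro ξ
    have : 0 ≤ ∑' k, min 1 (‖ξ‖ / R k) := tsum_nonneg (hnn ξ)
    linarith
  · intro l hl ξ ζ hn
    have : ∑' k, min 1 (‖ξ‖ / R k) ≤ ∑' k, l * min 1 (‖ζ‖ / R k) := by
      refine (hsum ξ).tsum_le_tsum (fun k => ?_) ((hsum ζ).mul_left l)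
      rw [mul_min_of_nonneg _ _ (by linarith), mul_one]
      refine min_le_min hl ?_
      rw [← mul_div_assoc]
      have := hRpos k
      gcongr
    rw [tsum_mul_left] at this
    simp only [pow_one]
    linarith
  · intro K
    obtain ⟨n, hn⟩ := exists_nat_ge K
    refine ⟨∑ k ∈ Finset.range n, R k, fun ξ hξ => ?_⟩
    have h1 := (hsum ξ).sum_le_tsum (Finset.range n) (fun k _ => hnn ξ k)
    have h2 : ∑ k ∈ Finset.range n, (1 : ℝ) ≤ ∑ k ∈ Finset.range n, min 1 (‖ξ‖ / R k) := by
      refine Finset.sum_le_sum fun k hk => le_min le_rfl ?_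
      rw [le_div_iff₀ (hRpos k), one_mul]
      exact (Finset.single_le_sum (fun i _ => (hRpos i).le) hk).trans hξ
    simp at h2
    linarith
  · have h1 : ∀ ξ, g ξ * ENNReal.ofReal (1 + ∑' k, min 1 (‖ξ‖ / R k)) =
        g ξ + ∑' k, g ξ * ENNReal.ofReal (min 1 (‖ξ‖ / R k)) := by
      intro ξ
      rw [ENNReal.ofReal_add zero_le_one (tsum_nonneg (hnn ξ)),
        ENNReal.ofReal_tsum_of_nonneg (hnn ξ) (hsum ξ), ENNReal.ofReal_one, mul_add, mul_one,
        ENNReal.tsum_mul_left]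
    simp_rw [h1]
    rw [lintegral_add_left hg, lintegral_tsum (fun k => by fun_prop)]
    refine add_le_add le_rfl ?_
    calc _ ≤ ∑' k : ℕ, (2⁻¹ : ENNReal) ^ (k + 1) := ENNReal.tsum_le_tsum hR2
      _ = 1 := by
        simp_rw [pow_succ]
        rw [ENNReal.tsum_mul_right, ENNReal.tsum_geometric]
        rw [ENNReal.one_sub_inv_two, inv_inv, ENNReal.mul_inv_cancel] <;> simp

/-- A weight slightly stronger than `wt s` for which given data still have finite norm. -/
lemma exists_weight {s : ℝ} (hs : 0 ≤ s) {g : Plane → ENNReal} (hg : Measurable g)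
    (hfin : ∫⁻ ξ, g ξ ≠ ⊤) :
    ∃ ω h : Plane → ℝ, IsWeight s (⌈s⌉₊ + 1) ω ∧
      (∀ ξ, ω ξ ^ 2 = wt s ξ ^ 2 * h ξ) ∧
      (∀ δ : ℝ, 0 < δ → ∃ ρ : ℝ, ∀ ξ, ρ ≤ ‖ξ‖ → wt s ξ ≤ δ * ω ξ) ∧
      ∫⁻ ξ, g ξ * ENNReal.ofReal (h ξ) ≤ (∫⁻ ξ, g ξ) + 1 := by
  obtain ⟨h, hm, h1, hd, hK, hi⟩ := exists_slow_growth hg hfin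
  -- The exponent ⌈s⌉₊ + 1 is ⌈s⌉₊ for l^s, plus one for √h, whose growth √l is bounded by l. The
  -- square root is there because the energy is quadratic in the weight.
  refine ⟨fun ξ => wt s ξ * √(h ξ), h, ⟨by fun_prop, ?_, ?_⟩, ?_, ?_, hi⟩
  · intro ξ
    have := Real.one_le_sqrt.2 (h1 ξ)
    nlinarith [wt_pos s ξ]
  · intro l hl ξ ζ hn
    have h2 := wt_dilate hs hl hn
    have h3 : √(h ξ) ≤ l * √(h ζ) := by
      have h4 := hd l hl ξ ζ hn
      rw [pow_one] at h4
      calc √(h ξ) ≤ √(l ^ 2 * h ζ) := by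
            refine Real.sqrt_le_sqrt (h4.trans ?_)
            have := h1 ζ
            gcongr
            nlinarith
        _ = l * √(h ζ) := by
            rw [Real.sqrt_mul (by positivity), Real.sqrt_sq (by linarith)]
    have h5 : l ^ s ≤ l ^ ⌈s⌉₊ := by
      rw [← Real.rpow_natCast]
      exact Real.rpow_le_rpow_of_exponent_le hl (Nat.le_ceil s)
    have := (wt_pos s ζ).le
    calc wt s ξ * √(h ξ) ≤ (l ^ s * wt s ζ) * (l * √(h ζ)) := by gcongr
      _ ≤ (l ^ ⌈s⌉₊ * wt s ζ) * (l * √(h ζ)) := by gcongr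
      _ = _ := by rw [pow_succ]; ring
  · intro ξ
    simp only
    rw [mul_pow, Real.sq_sqrt (by linarith [h1 ξ])]
  · intro δ hδ
    obtain ⟨ρ, hρ⟩ := hK ((1 / δ) ^ 2)
    refine ⟨ρ, fun ξ hξ => ?_⟩
    have h2 : 1 / δ ≤ √(h ξ) := Real.le_sqrt_of_sq_le (hρ ξ hξ)
    have h3 : 1 ≤ δ * √(h ξ) := by
      rw [div_le_iff₀ hδ] at h2; linarith
    have := wt_pos s ξ
    nlinarith

/-! ### Multipliers and truncated convolutions on `L²` -/

/-- Complex square integrable functions on the (frequency) plane. -/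
abbrev HC : Type := Lp ℂ 2 (volume : Measure Plane)

lemma HC.measurable (f : HC) : Measurable f := (Lp.stronglyMeasurable f).measurable

lemma HC.enorm_eq (f : HC) : ‖f‖ₑ = N2 (fun ξ => ‖f ξ‖ₑ) := by
  rw [Lp.enorm_def, eLpNorm_eq_lintegral_rpow_enorm_toReal two_ne_zero ENNReal.ofNat_ne_top, N2]
  simp

lemma HC.N2_lt_top (f : HC) : N2 (fun ξ => ‖f ξ‖ₑ) < ⊤ := by
  rw [← HC.enorm_eq]; exact enorm_lt_top

lemma memLp_two_of_N2 {f : Plane → ℂ} (hm : Measurable f) (h : N2 (fun ξ => ‖f ξ‖ₑ) < ⊤) :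
    MemLp f 2 volume := by
  refine ⟨hm.aestronglyMeasurable, ?_⟩
  rw [eLpNorm_eq_lintegral_rpow_enorm_toReal two_ne_zero ENNReal.ofNat_ne_top]
  simpa [N2] using h

/-- Bounded measurable symbols. -/
def Bdd (m : Plane → ℂ) : Prop := Measurable m ∧ ∃ C : ℝ, ∀ ξ, ‖m ξ‖ ≤ C

lemma Bdd.memLp {m : Plane → ℂ} (h : Bdd m) (f : HC) :
    MemLp (fun ξ => m ξ * f ξ) 2 volume := by
  obtain ⟨hm, C, hC⟩ := h
  exact MemLp.of_le_mul (Lp.memLp f) (hm.mul f.measurable).aestronglyMeasurable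
    (c := C) (Eventually.of_forall fun ξ => by rw [norm_mul]; gcongr; exact hC ξ)

/-- Multiplication by a bounded symbol. -/
def mulL (m : Plane → ℂ) : HC →L[ℝ] HC := by
  classical
  -- The value 0 for unbounded symbols keeps `Par.F` defined for every cut-off, and `Par.lipB_F`
  -- true for every cut-off.
  exact if h : Bdd m then
    LinearMap.mkContinuousOfExistsBound
      { toFun := fun f => (h.memLp f).toLp
        map_add' := fun f g => by
          apply Lp.ext
          filter_upwards [(h.memLp (f + g)).coeFn_toLp, (h.memLp f).coeFn_toLp,
            (h.memLp g).coeFn_toLp, Lp.coeFn_add f g,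
            Lp.coeFn_add ((h.memLp f).toLp) ((h.memLp g).toLp)] with ξ h1 h2 h3 h4 h5
          rw [h1, h5, Pi.add_apply, h2, h3, h4, Pi.add_apply, mul_add]
        map_smul' := fun r f => by
          apply Lp.ext
          filter_upwards [(h.memLp (r • f)).coeFn_toLp, (h.memLp f).coeFn_toLp,
            Lp.coeFn_smul r f, Lp.coeFn_smul r ((h.memLp f).toLp)] with ξ h1 h2 h3 h4
          simp only [RingHom.id_apply]
          rw [h1, h4, Pi.smul_apply, h2, h3, Pi.smul_apply, mul_smul_comm] }
      (by
        obtain ⟨C, hC⟩ := h.2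
        refine ⟨C, fun f => ?_⟩
        refine Lp.norm_le_mul_norm_of_ae_le_mul ?_
        filter_upwards [(h.memLp f).coeFn_toLp] with ξ h1
        change ‖((h.memLp f).toLp) ξ‖ ≤ _
        rw [h1, norm_mul]
        gcongr
        exact hC ξ)
  else 0

lemma mulL_coe {m : Plane → ℂ} (h : Bdd m) (f : HC) : mulL m f =ᵐ[volume] fun ξ => m ξ * f ξ := by
  rw [mulL, dif_pos h]
  exact (h.memLp f).coeFn_toLp

lemma enorm_mulL {m : Plane → ℂ} (h : Bdd m) (f : HC) :
    ‖mulL m f‖ₑ = N2 (fun ξ => ‖m ξ‖ₑ * ‖f ξ‖ₑ) := by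
  rw [HC.enorm_eq]
  refine N2_congr ?_
  filter_upwards [mulL_coe h f] with ξ hξ
  rw [hξ, enorm_mul]

lemma mulL_mulL {m p : Plane → ℂ} (hm : Bdd m) (hp : Bdd p) {q : Plane → ℂ} (hq : Bdd q)
    (h : ∀ ξ, m ξ * p ξ = q ξ) (f : HC) : mulL m (mulL p f) = mulL q f := by
  apply Lp.ext
  filter_upwards [mulL_coe hm (mulL p f), mulL_coe hp f, mulL_coe hq f] with ξ h1 h2 h3
  rw [h1, h2, h3, ← mul_assoc, h]

/-- The convolution of complex functions. -/
def conv (f g : Plane → ℂ) (ξ : Plane) : ℂ := ∫ ζ, f ζ * g (ξ - ζ)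

lemma enorm_conv_le (f g : Plane → ℂ) (ξ : Plane) :
    ‖conv f g ξ‖ₑ ≤ cv (fun ζ => ‖f ζ‖ₑ) (fun ζ => ‖g ζ‖ₑ) ξ := by
  refine (enorm_integral_le_lintegral_enorm _).trans (le_of_eq ?_)
  simp [cv, enorm_mul]

lemma cv_le_N2 {F G : Plane → ENNReal} (hF : Measurable F) (hG : Measurable G) (ξ : Plane) :
    cv F G ξ ≤ N2 F * N2 G := by
  refine (lintegral_mul_le_N2 hF.aemeasurable (by fun_prop)).trans (le_of_eq ?_)
  congr 1
  unfold N2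
  rw [lintegral_sub_left_eq_self (fun ζ => G ζ ^ (2 : ℝ)) ξ]

lemma measurable_conv {f g : Plane → ℂ} (hf : Measurable f) (hg : Measurable g) :
    Measurable (conv f g) := by
  have : StronglyMeasurable fun p : Plane × Plane => f p.2 * g (p.1 - p.2) :=
    Measurable.stronglyMeasurable (by fun_prop)
  exact this.integral_prod_right'.measurable

lemma quasiMeasurePreserving_sub_left' (ξ : Plane) :
    Measure.QuasiMeasurePreserving (fun ζ : Plane => ξ - ζ) volume volume :=
  (Measure.measurePreserving_sub_left volume ξ).quasiMeasurePreserving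

lemma conv_congr {f f' g g' : Plane → ℂ} (hf : f =ᵐ[volume] f') (hg : g =ᵐ[volume] g')
    (ξ : Plane) : conv f g ξ = conv f' g' ξ := by
  refine integral_congr_ae ?_
  filter_upwards [hf, (quasiMeasurePreserving_sub_left' ξ).ae_eq_comp hg] with ζ h1 h2
  rw [h1]; simp only [Function.comp] at h2; rw [h2]

lemma conv_comm (f g : Plane → ℂ) (ξ : Plane) : conv f g ξ = conv g f ξ := by
  unfold conv
  rw [← integral_sub_left_eq_self (fun ζ => f ζ * g (ξ - ζ)) volume ξ]
  simp [mul_comm]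

lemma integrable_conv (f g : HC) (ξ : Plane) : Integrable (fun ζ => f ζ * g (ξ - ζ)) := by
  have hf := f.measurable
  have hg := g.measurable
  refine ⟨Measurable.aestronglyMeasurable (by fun_prop), ?_⟩
  simp only [HasFiniteIntegral, enorm_mul]
  exact (cv_le_N2 (F := fun ζ => ‖f ζ‖ₑ) (G := fun ζ => ‖g ζ‖ₑ) (by fun_prop) (by fun_prop)
    ξ).trans_lt (ENNReal.mul_lt_top f.N2_lt_top g.N2_lt_top)

lemma conv_add_left (f f' g : HC) (ξ : Plane) :
    conv (f + f' : HC) g ξ = conv f g ξ + conv f' g ξ := by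
  rw [conv_congr (Lp.coeFn_add f f') (ae_eq_refl g)]
  unfold conv
  rw [← integral_add (integrable_conv f g ξ) (integrable_conv f' g ξ)]
  simp [add_mul]

lemma conv_smul_left (r : ℝ) (f g : HC) (ξ : Plane) :
    conv (r • f : HC) g ξ = r * conv f g ξ := by
  rw [conv_congr (Lp.coeFn_smul r f) (ae_eq_refl g)]
  unfold conv
  rw [← integral_const_mul]
  simp [mul_assoc]

lemma conv_add_right (f g g' : HC) (ξ : Plane) :
    conv f (g + g' : HC) ξ = conv f g ξ + conv f g' ξ := by
  rw [conv_comm, conv_add_left, conv_comm g, conv_comm g']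

lemma conv_smul_right (r : ℝ) (f g : HC) (ξ : Plane) :
    conv f (r • g : HC) ξ = r * conv f g ξ := by
  rw [conv_comm, conv_smul_left, conv_comm g]

/-- Square integrable symbols. -/
def SqInt (m : Plane → ℂ) : Prop := Measurable m ∧ N2 (fun ξ => ‖m ξ‖ₑ) < ⊤

/-- The convolution of two L² functions is bounded pointwise by the product of their norms, so the
symbol alone has to be square integrable. -/
lemma N2_mul_conv_le (m : Plane → ℂ) (f g : HC) :
    N2 (fun ξ => ‖m ξ * conv f g ξ‖ₑ) ≤ N2 (fun ξ => ‖m ξ‖ₑ) * (‖f‖ₑ * ‖g‖ₑ) := by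
  have hf := f.measurable
  have hg := g.measurable
  rw [mul_comm, ← N2_const_mul _ (by simp [ENNReal.mul_eq_top])]
  refine N2_mono (Eventually.of_forall fun ξ => ?_)
  rw [enorm_mul, mul_comm, f.enorm_eq, g.enorm_eq]
  gcongr
  exact (enorm_conv_le f g ξ).trans (cv_le_N2 (by fun_prop) (by fun_prop) ξ)

lemma SqInt.memLp {m : Plane → ℂ} (h : SqInt m) (f g : HC) :
    MemLp (fun ξ => m ξ * conv f g ξ) 2 volume := by
  refine memLp_two_of_N2 (h.1.mul (measurable_conv f.measurable g.measurable)) ?_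
  exact (N2_mul_conv_le m f g).trans_lt (ENNReal.mul_lt_top h.2
    (ENNReal.mul_lt_top enorm_lt_top enorm_lt_top))

/-- The bounded bilinear map `(f, g) ↦ m · (f * g)` on `L²`, for a square integrable symbol. -/
def convT (m : Plane → ℂ) : HC →L[ℝ] HC →L[ℝ] HC := by
  classical
  exact if h : SqInt m then
    LinearMap.mkContinuous₂
      (LinearMap.mk₂ ℝ (fun f g => (h.memLp f g).toLp)
        (fun f f' g => by
          apply Lp.ext
          filter_upwards [(h.memLp (f + f') g).coeFn_toLp, (h.memLp f g).coeFn_toLp,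
            (h.memLp f' g).coeFn_toLp,
            Lp.coeFn_add ((h.memLp f g).toLp) ((h.memLp f' g).toLp)] with ξ h1 h2 h3 h5
          rw [h1, h5, Pi.add_apply, h2, h3, conv_add_left, mul_add])
        (fun r f g => by
          apply Lp.ext
          filter_upwards [(h.memLp (r • f) g).coeFn_toLp, (h.memLp f g).coeFn_toLp,
            Lp.coeFn_smul r ((h.memLp f g).toLp)] with ξ h1 h2 h4
          rw [h1, h4, Pi.smul_apply, h2, conv_smul_left, Complex.real_smul]; ring)
        (fun f g g' => by
          apply Lp.ext
          filter_upwards [(h.memLp f (g + g')).coeFn_toLp, (h.memLp f g).coeFn_toLp,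
            (h.memLp f g').coeFn_toLp,
            Lp.coeFn_add ((h.memLp f g).toLp) ((h.memLp f g').toLp)] with ξ h1 h2 h3 h5
          rw [h1, h5, Pi.add_apply, h2, h3, conv_add_right, mul_add])
        (fun r f g => by
          apply Lp.ext
          filter_upwards [(h.memLp f (r • g)).coeFn_toLp, (h.memLp f g).coeFn_toLp,
            Lp.coeFn_smul r ((h.memLp f g).toLp)] with ξ h1 h2 h4
          rw [h1, h4, Pi.smul_apply, h2, conv_smul_right, Complex.real_smul]; ring))
      (N2 (fun ξ => ‖m ξ‖ₑ)).toReal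
      (fun f g => by
        rw [LinearMap.mk₂_apply]
        have h1 := N2_mul_conv_le m f g
        have h2 : ‖(h.memLp f g).toLp‖ₑ = N2 (fun ξ => ‖m ξ * conv f g ξ‖ₑ) := by
          rw [HC.enorm_eq]
          exact N2_congr ((h.memLp f g).coeFn_toLp.mono fun ξ hξ => by rw [hξ])
        rw [← h2] at h1
        have h3 := ENNReal.toReal_mono (ENNReal.mul_ne_top h.2.ne
          (ENNReal.mul_ne_top enorm_ne_top enorm_ne_top)) h1
        simpa [ENNReal.toReal_mul, mul_assoc] using h3)
  else 0

lemma convT_coe {m : Plane → ℂ} (h : SqInt m) (f g : HC) :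
    convT m f g =ᵐ[volume] fun ξ => m ξ * conv f g ξ := by
  rw [convT, dif_pos h]
  exact (h.memLp f g).coeFn_toLp

lemma mulL_convT {m p q : Plane → ℂ} (hm : Bdd m) (hp : SqInt p) (hq : SqInt q)
    (h : ∀ ξ, m ξ * p ξ = q ξ) (f g : HC) : mulL m (convT p f g) = convT q f g := by
  apply Lp.ext
  filter_upwards [mulL_coe hm (convT p f g), convT_coe hp f g, convT_coe hq f g] with ξ h1 h2 h3
  rw [h1, h2, h3, ← mul_assoc, h]

/-! ### The reflection `f ↦ conj f(-·)` -/

/-- The conjugate linear isometric involution whose fixed points are the Fourier transforms of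
real functions. -/
def refl : HC →L[ℝ] HC :=
  (Complex.conjCLE.toContinuousLinearMap.compLpL 2 volume).comp
    (Lp.compMeasurePreservingₗᵢ ℝ (Neg.neg : Plane → Plane)
      (Measure.measurePreserving_neg volume)).toContinuousLinearMap

lemma refl_coe (f : HC) : refl f =ᵐ[volume] fun ξ => (starRingEnd ℂ) (f (-ξ)) := by
  have h1 := ContinuousLinearMap.coeFn_compLpL (p := 2) (μ := (volume : Measure Plane))
    Complex.conjCLE.toContinuousLinearMap (Lp.compMeasurePreservingₗᵢ ℝ (Neg.neg : Plane → Plane)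
      (Measure.measurePreserving_neg volume) f)
  have h2 := Lp.coeFn_compMeasurePreserving f (Measure.measurePreserving_neg (volume : Measure Plane))
  filter_upwards [h1, h2] with ξ h3 h4
  refine h3.trans ?_
  change (starRingEnd ℂ) ((Lp.compMeasurePreserving (Neg.neg : Plane → Plane)
      (Measure.measurePreserving_neg volume) f) ξ) = _
  rw [h4]; rfl

lemma ae_neg {p : Plane → Prop} (h : ∀ᵐ ξ, p ξ) : ∀ᵐ ξ : Plane, p (-ξ) :=
  (Measure.measurePreserving_neg (volume : Measure Plane)).quasiMeasurePreserving.ae h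

/-- Symbols with this symmetry belong to operators that map real functions to real functions. -/
lemma refl_mulL {m : Plane → ℂ} (h : Bdd m) (he : ∀ ξ, (starRingEnd ℂ) (m (-ξ)) = m ξ) (f : HC) :
    refl (mulL m f) = mulL m (refl f) := by
  apply Lp.ext
  filter_upwards [refl_coe (mulL m f), mulL_coe h (refl f), ae_neg (mulL_coe h f), refl_coe f]
    with ξ h1 h2 h3 h4
  rw [h1, h2, h3, h4, map_mul, he]

lemma conv_refl (f g : HC) (ξ : Plane) :
    conv (refl f) (refl g) ξ = (starRingEnd ℂ) (conv f g (-ξ)) := by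
  rw [conv_congr (refl_coe f) (refl_coe g)]
  unfold conv
  rw [← integral_conj, ← integral_neg_eq_self]
  refine integral_congr_ae (Eventually.of_forall fun ζ => ?_)
  simp only [map_mul, neg_neg]
  rw [show -(ξ - -ζ) = -ξ - ζ by abel]

lemma refl_convT {m : Plane → ℂ} (h : SqInt m) (he : ∀ ξ, (starRingEnd ℂ) (m (-ξ)) = m ξ)
    (f g : HC) : refl (convT m f g) = convT m (refl f) (refl g) := by
  apply Lp.ext
  filter_upwards [refl_coe (convT m f g), convT_coe h (refl f) (refl g), ae_neg (convT_coe h f g)]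
    with ξ h1 h2 h3
  rw [h1, h2, h3, map_mul, he, conv_refl]

/-! ### Symbols -/

/-- A real symbol as a complex one. -/
def rs (w : Plane → ℝ) (ξ : Plane) : ℂ := (w ξ : ℂ)

/-- The symbol of `-∂_j w(D)`. -/
def sym (j : Fin 2) (w : Plane → ℝ) (ξ : Plane) : ℂ := -Complex.I * ((freq j ξ * w ξ : ℝ) : ℂ)

/-- The characteristic function of the ball of radius `N`. -/
def ch (N : ℝ) (ξ : Plane) : ℝ := (Metric.closedBall (0 : Plane) N).indicator (fun _ => 1) ξ

lemma ch_of_le {N : ℝ} {ξ : Plane} (h : ‖ξ‖ ≤ N) : ch N ξ = 1 := by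
  simp [ch, h]

lemma ch_of_lt {N : ℝ} {ξ : Plane} (h : N < ‖ξ‖) : ch N ξ = 0 := by
  simp [ch, h]

lemma ch_mul_ch {N M : ℝ} (h : N ≤ M) (ξ : Plane) : ch M ξ * ch N ξ = ch N ξ := by
  rcases le_or_gt ‖ξ‖ N with h1 | h1
  · rw [ch_of_le h1, ch_of_le (h1.trans h), one_mul]
  · rw [ch_of_lt h1, mul_zero]

lemma ch_nonneg (N : ℝ) (ξ : Plane) : 0 ≤ ch N ξ := by
  rcases le_or_gt ‖ξ‖ N with h1 | h1
  · rw [ch_of_le h1]; exact zero_le_one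
  · rw [ch_of_lt h1]

lemma ch_le_one (N : ℝ) (ξ : Plane) : ch N ξ ≤ 1 := by
  rcases le_or_gt ‖ξ‖ N with h1 | h1
  · rw [ch_of_le h1]
  · rw [ch_of_lt h1]; exact zero_le_one

lemma ch_neg (N : ℝ) (ξ : Plane) : ch N (-ξ) = ch N ξ := by simp [ch, indicator]

@[fun_prop]
lemma measurable_ch (N : ℝ) : Measurable (ch N) :=
  measurable_const.indicator Metric.isClosed_closedBall.measurableSet

@[fun_prop]
lemma measurable_rs {w : Plane → ℝ} (h : Measurable w) : Measurable (rs w) := by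
  unfold rs; fun_prop

@[fun_prop]
lemma measurable_sym (j : Fin 2) {w : Plane → ℝ} (h : Measurable w) : Measurable (sym j w) := by
  unfold sym; fun_prop

lemma norm_rs (w : Plane → ℝ) (ξ : Plane) : ‖rs w ξ‖ = |w ξ| := by simp [rs]

lemma norm_sym (j : Fin 2) (w : Plane → ℝ) (ξ : Plane) :
    ‖sym j w ξ‖ = |freq j ξ| * |w ξ| := by simp [sym]

lemma rs_mul_sym (j : Fin 2) (w v : Plane → ℝ) (ξ : Plane) :
    rs w ξ * sym j v ξ = sym j (fun ξ => w ξ * v ξ) ξ := by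
  simp only [rs, sym]; push_cast; ring

lemma rs_mul_rs (w v : Plane → ℝ) (ξ : Plane) :
    rs w ξ * rs v ξ = rs (fun ξ => w ξ * v ξ) ξ := by
  simp only [rs]; push_cast; ring

/-- Measurable functions bounded on bounded sets. -/
def LocBdd (w : Plane → ℝ) : Prop :=
  Measurable w ∧ ∀ N : ℝ, ∃ C, ∀ ξ, ‖ξ‖ ≤ N → |w ξ| ≤ C

lemma _root_.Continuous.locBdd {w : Plane → ℝ} (h : Continuous w) : LocBdd w := by
  refine ⟨h.measurable, fun N => ?_⟩
  obtain ⟨C, hC⟩ := (isCompact_closedBall (0 : Plane) N).exists_bound_of_continuousOn h.continuousOn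
  exact ⟨C, fun ξ hξ => hC ξ (by simpa using hξ)⟩

lemma IsWeight.locBdd {s : ℝ} {q : ℕ} {ω : Plane → ℝ} (h : IsWeight s q ω) : LocBdd ω := by
  refine ⟨h.measurable, fun N => ?_⟩
  obtain ⟨C, hC⟩ := h.dilates.bounded N
  exact ⟨C, fun ξ hξ => by rw [abs_of_pos (h.pos ξ)]; exact hC ξ hξ⟩

lemma LocBdd.mul {w v : Plane → ℝ} (h : LocBdd w) (h' : LocBdd v) :
    LocBdd (fun ξ => w ξ * v ξ) := by
  refine ⟨h.1.mul h'.1, fun N => ?_⟩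
  obtain ⟨C, hC⟩ := h.2 N
  obtain ⟨D, hD⟩ := h'.2 N
  refine ⟨C * D, fun ξ hξ => ?_⟩
  rw [abs_mul]
  have := (abs_nonneg _).trans (hC ξ hξ)
  gcongr
  exacts [hC ξ hξ, hD ξ hξ]

lemma LocBdd.ch_bdd {w : Plane → ℝ} (h : LocBdd w) (N : ℝ) :
    ∃ C, 0 ≤ C ∧ ∀ ξ, |ch N ξ * w ξ| ≤ C := by
  obtain ⟨C, hC⟩ := h.2 N
  refine ⟨max C 0, le_max_right _ _, fun ξ => ?_⟩
  rcases le_or_gt ‖ξ‖ N with h1 | h1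
  · rw [ch_of_le h1, one_mul]; exact (hC ξ h1).trans (le_max_left _ _)
  · rw [ch_of_lt h1, zero_mul, abs_zero]; exact le_max_right _ _

lemma LocBdd.bdd_ch {w : Plane → ℝ} (h : LocBdd w) (N : ℝ) : Bdd (rs fun ξ => ch N ξ * w ξ) := by
  obtain ⟨C, -, hC⟩ := h.ch_bdd N
  have := h.1
  exact ⟨by fun_prop, C, fun ξ => by rw [norm_rs]; exact hC ξ⟩

lemma bdd_ch (N : ℝ) : Bdd (rs (ch N)) :=
  ⟨by fun_prop, 1, fun ξ => by
    rw [norm_rs, abs_of_nonneg (ch_nonneg N ξ)]; exact ch_le_one N ξ⟩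

/-- Cut-off symbols for which the truncated vector field is defined on `L²`. -/
def Adm (κ : Plane → ℝ) : Prop := Measurable κ ∧ ∃ C : ℝ, ∀ ξ, |κ ξ| ≤ C * wt (-4) ξ

lemma adm_wt : Adm (wt (-4)) :=
  ⟨by fun_prop, 1, fun ξ => by rw [one_mul, abs_of_pos (wt_pos _ _)]⟩

lemma LocBdd.adm {w : Plane → ℝ} (h : LocBdd w) (N : ℝ) : Adm (fun ξ => ch N ξ * w ξ) := by
  have h1 := h.1
  refine ⟨by fun_prop, ?_⟩
  obtain ⟨C, -, hC⟩ := (h.mul (continuous_wt 4).locBdd).ch_bdd N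
  refine ⟨C, fun ξ => ?_⟩
  have h2 := hC ξ
  have h3 := wt_neg_mul 4 ξ
  have h4 := wt_pos (-4) ξ
  have h5 : |ch N ξ * w ξ| = |ch N ξ * (w ξ * wt 4 ξ)| * wt (-4) ξ := by
    rw [← mul_assoc, abs_mul _ (wt 4 ξ), abs_of_pos (wt_pos 4 ξ), mul_assoc, mul_comm (wt 4 ξ), h3,
      mul_one]
  rw [h5]
  gcongr

lemma adm_ch (N : ℝ) : Adm (ch N) := by
  simpa using (continuous_const (y := (1 : ℝ))).locBdd.adm N

/-- The exponent -4 covers one power for k_j and two for w, with one to spare. -/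
lemma Adm.bdd_sym {κ w : Plane → ℝ} (h : Adm κ) (hw : Measurable w) {C : ℝ}
    (hC : ∀ ξ, |w ξ| ≤ C * wt 2 ξ) (j : Fin 2) : Bdd (sym j fun ξ => κ ξ * w ξ) := by
  obtain ⟨hm, D, hD⟩ := h
  refine ⟨by fun_prop, |D| * |C|, fun ξ => ?_⟩
  rw [norm_sym, abs_mul]
  have h1 := abs_freq_le_wt j ξ
  have h2 : |κ ξ| ≤ |D| * wt (-4) ξ := (hD ξ).trans (by
    have := wt_pos (-4) ξ; gcongr; exact le_abs_self D)
  have h3 : |w ξ| ≤ |C| * wt 2 ξ := (hC ξ).trans (by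
    have := wt_pos 2 ξ; gcongr; exact le_abs_self C)
  have p1 := wt_pos 1 ξ
  have p4 := wt_pos (-4) ξ
  calc |freq j ξ| * (|κ ξ| * |w ξ|) ≤ wt 1 ξ * ((|D| * wt (-4) ξ) * (|C| * wt 2 ξ)) := by gcongr
    _ = |D| * |C| * wt (-1) ξ := by
      have : wt (-1) ξ = wt 1 ξ * wt (-4) ξ * wt 2 ξ := by rw [← wt_add, ← wt_add]; norm_num
      rw [this]; ring
    _ ≤ |D| * |C| * 1 := by gcongr; exact wt_le_one (by norm_num) ξ
    _ = _ := mul_one _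

/-- With w bounded the symbol decays like `wt (-3)`, and `wt (-2)` is already square integrable on
the plane. -/
lemma Adm.sqInt_sym {κ w : Plane → ℝ} (h : Adm κ) (hw : Measurable w) {C : ℝ}
    (hC : ∀ ξ, |w ξ| ≤ C) (j : Fin 2) : SqInt (sym j fun ξ => κ ξ * w ξ) := by
  obtain ⟨hm, D, hD⟩ := h
  refine ⟨by fun_prop, ?_⟩
  have hC0 : 0 ≤ C := (abs_nonneg _).trans (hC 0)
  have hle : N2 (fun ξ => ‖sym j (fun ξ => κ ξ * w ξ) ξ‖ₑ) ≤
      N2 (fun ξ => ENNReal.ofReal (|D| * C) * ewt (-2) ξ) := by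
    refine N2_mono (Eventually.of_forall fun ξ => ?_)
    rw [← ofReal_norm, ewt, ← ENNReal.ofReal_mul (by positivity)]
    refine ENNReal.ofReal_le_ofReal ?_
    rw [norm_sym, abs_mul]
    have h1 := abs_freq_le_wt j ξ
    have h2 : |κ ξ| ≤ |D| * wt (-4) ξ := (hD ξ).trans (by
      have := wt_pos (-4) ξ; gcongr; exact le_abs_self D)
    have p1 := wt_pos 1 ξ
    have p4 := wt_pos (-4) ξ
    calc |freq j ξ| * (|κ ξ| * |w ξ|) ≤ wt 1 ξ * ((|D| * wt (-4) ξ) * C) := by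
          gcongr; exact hC ξ
      _ = |D| * C * wt (-3) ξ := by
        have : wt (-3) ξ = wt 1 ξ * wt (-4) ξ := by rw [← wt_add]; norm_num
        rw [this]; ring
      _ ≤ _ := by gcongr; exact wt_mono (by norm_num) ξ
  refine hle.trans_lt ?_
  rw [N2_const_mul _ ENNReal.ofReal_ne_top]
  exact ENNReal.mul_lt_top ENNReal.ofReal_lt_top (wienerC_lt_top one_lt_two)

/-! ### The vector field on the Fourier side -/

/-- The parameters of the system. -/
structure Par where
  a : ℝ
  c : ℝ
  d : ℝ
  ε : ℝ
  ha : a < 0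
  hc : c < 0
  hd : 0 < d
  hε : 0 < ε
  hε1 : ε ≤ 1

/-- The state space: Fourier transforms of `(η, v)`. -/
abbrev X : Type := HC × (Fin 2 → HC)

namespace Par

variable (p : Par)

/-- The symbol of `1 + ε a Δ`. -/
def al (ξ : Plane) : ℝ := 1 - p.ε * p.a * (2 * Real.pi * ‖ξ‖) ^ 2

/-- The symbol of `1 + ε c Δ`. -/
def ce (ξ : Plane) : ℝ := 1 - p.ε * p.c * (2 * Real.pi * ‖ξ‖) ^ 2

/-- The symbol of `1 - ε d Δ`. -/
def de (ξ : Plane) : ℝ := 1 + p.ε * p.d * (2 * Real.pi * ‖ξ‖) ^ 2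

/-- The symbol of the symmetrizer acting on `v`. -/
def em (ξ : Plane) : ℝ := p.al ξ * p.de ξ / p.ce ξ

/-- The symbol of `(1 + ε c Δ) / (1 - ε d Δ)`. -/
def be (ξ : Plane) : ℝ := p.ce ξ / p.de ξ

lemma one_le_al (ξ : Plane) : 1 ≤ p.al ξ := by
  have := mul_pos p.hε (neg_pos.2 p.ha)
  have := mul_nonneg this.le (sq_nonneg (2 * Real.pi * ‖ξ‖))
  unfold al; linarith

lemma one_le_ce (ξ : Plane) : 1 ≤ p.ce ξ := by
  have := mul_pos p.hε (neg_pos.2 p.hc)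
  have := mul_nonneg this.le (sq_nonneg (2 * Real.pi * ‖ξ‖))
  unfold ce; linarith

lemma one_le_de (ξ : Plane) : 1 ≤ p.de ξ := by
  have := mul_pos p.hε p.hd
  have := mul_nonneg this.le (sq_nonneg (2 * Real.pi * ‖ξ‖))
  unfold de; linarith

lemma continuous_al : Continuous p.al := by unfold al; fun_prop
lemma continuous_ce : Continuous p.ce := by unfold ce; fun_prop
lemma continuous_de : Continuous p.de := by unfold de; fun_prop

lemma continuous_em : Continuous p.em :=
  (p.continuous_al.mul p.continuous_de).div p.continuous_ce
    fun ξ => (zero_lt_one.trans_le (p.one_le_ce ξ)).ne'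

lemma continuous_be : Continuous p.be :=
  p.continuous_ce.div p.continuous_de fun ξ => (zero_lt_one.trans_le (p.one_le_de ξ)).ne'

@[fun_prop] lemma measurable_al : Measurable p.al := p.continuous_al.measurable
@[fun_prop] lemma measurable_de : Measurable p.de := p.continuous_de.measurable
@[fun_prop] lemma measurable_be : Measurable p.be := p.continuous_be.measurable

/-- The reason for the choice of `em`: with this weight on v the two off-diagonal linear couplings
become adjoint to each other up to sign. -/
lemma em_mul_be (ξ : Plane) : p.em ξ * p.be ξ = p.al ξ := by
  have h1 := (zero_lt_one.trans_le (p.one_le_ce ξ)).ne'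
  have h2 := (zero_lt_one.trans_le (p.one_le_de ξ)).ne'
  unfold em be; field_simp

lemma em_pos (ξ : Plane) : 0 < p.em ξ := by
  have h1 := zero_lt_one.trans_le (p.one_le_ce ξ)
  have h2 := zero_lt_one.trans_le (p.one_le_de ξ)
  have h3 := zero_lt_one.trans_le (p.one_le_al ξ)
  unfold em; positivity

lemma al_le (ξ : Plane) : |p.al ξ| ≤ (1 - p.a) * wt 2 ξ := by
  rw [abs_of_pos (zero_lt_one.trans_le (p.one_le_al ξ)), wt_two, al]
  have h1 := p.ha
  have h2 := sq_nonneg (2 * Real.pi * ‖ξ‖)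
  have h3 : p.ε * (-p.a) ≤ 1 * (-p.a) := by have := p.hε1; gcongr; linarith
  nlinarith

/-- `(1 + εa Δ)/(1 + ε c Δ)` is bounded, uniformly in `ε`. -/
lemma em_div_de_le (ξ : Plane) : p.em ξ / p.de ξ ≤ 1 + p.a / p.c := by
  have h1 := zero_lt_one.trans_le (p.one_le_ce ξ)
  have h2 := (zero_lt_one.trans_le (p.one_le_de ξ)).ne'
  have h3 : 0 < p.a / p.c := div_pos_of_neg_of_neg p.ha p.hc
  have : p.em ξ / p.de ξ = p.al ξ / p.ce ξ := by unfold em; field_simp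
  rw [this, div_le_iff₀ h1]
  -- Both al - 1 and ce - 1 are multiples of ε|k|², so their ratio is a / c and ε disappears.
  have h4 : p.a = (p.a / p.c) * p.c := by have := p.hc.ne; field_simp
  have h5 : p.al ξ - 1 = (p.a / p.c) * (p.ce ξ - 1) := by
    rw [al, ce]
    conv_lhs => rw [h4]
    ring
  have := p.one_le_ce ξ
  nlinarith

lemma be_le (ξ : Plane) : |p.be ξ| ≤ 1 - p.c / p.d := by
  have h1 := zero_lt_one.trans_le (p.one_le_ce ξ)
  have h2 := zero_lt_one.trans_le (p.one_le_de ξ)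
  have h3 : 0 < -p.c / p.d := div_pos (neg_pos.2 p.hc) p.hd
  rw [be, abs_of_pos (by positivity), div_le_iff₀ h2]
  have h5 : p.ce ξ - 1 = (-p.c / p.d) * (p.de ξ - 1) := by
    have := p.hd.ne'
    rw [ce, de]; field_simp; ring
  have := p.one_le_de ξ
  have h6 : 1 - p.c / p.d = 1 + -p.c / p.d := by ring
  rw [h6]
  nlinarith

/-- The lower bound of the symmetrizer, uniform in `ε`. -/
def lo : ℝ := ((1 + p.c / p.a) * (1 + 1 / p.d))⁻¹

/-- The upper bound of the symmetrizer, uniform in `ε`. -/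
def hi : ℝ := (1 + p.a / p.c) * (1 + p.d)

lemma lo_pos : 0 < p.lo := by
  have h3 : 0 < p.c / p.a := div_pos_of_neg_of_neg p.hc p.ha
  have := p.hd
  unfold lo; positivity

lemma hi_pos : 0 < p.hi := by
  have h3 : 0 < p.a / p.c := div_pos_of_neg_of_neg p.ha p.hc
  have := p.hd
  unfold hi; positivity

/-- Together with `em_le` this compares `em` with 1 + ε|k|² uniformly in ε. It makes the energy
control ε‖v‖²_{s+1}, which is what pays for the derivative lost in the nonlinear terms. The factors
of `lo` come from ce ≤ (1 + c/a) al and 1 + ε|k|² ≤ (1 + 1/d) de. -/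
lemma lo_mul_le_em (ξ : Plane) : p.lo * (1 + p.ε * (2 * Real.pi * ‖ξ‖) ^ 2) ≤ p.em ξ := by
  have h1 := zero_lt_one.trans_le (p.one_le_ce ξ)
  have h3 : 0 < p.c / p.a := div_pos_of_neg_of_neg p.hc p.ha
  have h0 := p.hd
  have hp : 0 < (1 + p.c / p.a) * (1 + 1 / p.d) := by positivity
  rw [lo, inv_mul_le_iff₀ hp, em]
  have hA : p.ce ξ ≤ (1 + p.c / p.a) * p.al ξ := by
    have h5 : p.ce ξ - 1 = (p.c / p.a) * (p.al ξ - 1) := by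
      have := p.ha.ne
      rw [ce, al]; field_simp; ring
    have := p.one_le_al ξ
    nlinarith
  have hB : 1 + p.ε * (2 * Real.pi * ‖ξ‖) ^ 2 ≤ (1 + 1 / p.d) * p.de ξ := by
    have h5 : p.ε * (2 * Real.pi * ‖ξ‖) ^ 2 = (1 / p.d) * (p.de ξ - 1) := by
      rw [de]; field_simp; ring
    have := p.one_le_de ξ
    have : 0 < 1 / p.d := by positivity
    nlinarith
  have h2 := zero_lt_one.trans_le (p.one_le_de ξ)
  have h4 := zero_lt_one.trans_le (p.one_le_al ξ)
  rw [← mul_div_assoc, le_div_iff₀ h1]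
  calc (1 + p.ε * (2 * Real.pi * ‖ξ‖) ^ 2) * p.ce ξ
      ≤ ((1 + 1 / p.d) * p.de ξ) * ((1 + p.c / p.a) * p.al ξ) := by gcongr
    _ = _ := by ring

lemma em_le (ξ : Plane) : p.em ξ ≤ p.hi * (1 + p.ε * (2 * Real.pi * ‖ξ‖) ^ 2) := by
  have h2 := zero_lt_one.trans_le (p.one_le_de ξ)
  have h := p.em_div_de_le ξ
  rw [div_le_iff₀ h2] at h
  refine h.trans ?_
  have h3 : 0 < p.a / p.c := div_pos_of_neg_of_neg p.ha p.hc
  rw [hi, mul_assoc]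
  have hd := p.hd
  have hε := p.hε
  have : p.de ξ ≤ (1 + p.d) * (1 + p.ε * (2 * Real.pi * ‖ξ‖) ^ 2) := by
    rw [de]
    have := sq_nonneg (2 * Real.pi * ‖ξ‖)
    have := mul_nonneg hε.le this
    nlinarith
  gcongr

lemma eps_wt_le (ξ : Plane) : p.ε * wt 2 ξ ≤ 1 + p.ε * (2 * Real.pi * ‖ξ‖) ^ 2 := by
  rw [wt_two]
  linarith [p.hε1]

lemma one_add_eps_le (ξ : Plane) : 1 + p.ε * (2 * Real.pi * ‖ξ‖) ^ 2 ≤ wt 2 ξ := by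
  rw [wt_two]
  have := mul_le_mul_of_nonneg_right p.hε1 (sq_nonneg (2 * Real.pi * ‖ξ‖))
  linarith

lemma al_neg (ξ : Plane) : p.al (-ξ) = p.al ξ := by simp [al]
lemma ce_neg (ξ : Plane) : p.ce (-ξ) = p.ce ξ := by simp [ce]
lemma de_neg (ξ : Plane) : p.de (-ξ) = p.de ξ := by simp [de]
lemma be_neg (ξ : Plane) : p.be (-ξ) = p.be ξ := by simp [be, ce_neg, de_neg]

lemma half_div_de_le (ξ : Plane) : |p.ε / 2 / p.de ξ| ≤ 1 := by
  have h := p.one_le_de ξ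
  have h1 := p.hε
  have h2 := p.hε1
  rw [abs_of_pos (by positivity), div_le_one (by linarith)]
  linarith

/-- The system on the Fourier side, multiplied with a cut-off symbol `κ`. -/
def F (κ : Plane → ℝ) (U : X) : X :=
  (∑ j, (mulL (sym j fun ξ => κ ξ * p.al ξ) (U.2 j) +
      convT (sym j fun ξ => κ ξ * p.ε) U.1 (U.2 j)),
    fun i => mulL (sym i fun ξ => κ ξ * p.be ξ) U.1 +
      ∑ j, convT (sym i fun ξ => κ ξ * (p.ε / 2 / p.de ξ)) (U.2 j) (U.2 j))

lemma bdd_al {κ : Plane → ℝ} (h : Adm κ) (j : Fin 2) : Bdd (sym j fun ξ => κ ξ * p.al ξ) :=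
  h.bdd_sym p.measurable_al p.al_le j

lemma bdd_be {κ : Plane → ℝ} (h : Adm κ) (j : Fin 2) : Bdd (sym j fun ξ => κ ξ * p.be ξ) :=
  h.bdd_sym p.measurable_be (C := 1 - p.c / p.d) (fun ξ => (p.be_le ξ).trans (by
    have := one_le_wt (r := 2) zero_le_two ξ
    have h3 : 0 < -p.c / p.d := div_pos (neg_pos.2 p.hc) p.hd
    have h6 : 1 - p.c / p.d = 1 + -p.c / p.d := by ring
    nlinarith)) j

lemma sqInt_eps {κ : Plane → ℝ} (h : Adm κ) (j : Fin 2) : SqInt (sym j fun ξ => κ ξ * p.ε) :=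
  h.sqInt_sym measurable_const (fun _ => le_rfl) j

lemma sqInt_de {κ : Plane → ℝ} (h : Adm κ) (j : Fin 2) : SqInt (sym j fun ξ => κ ξ * (p.ε / 2 / p.de ξ)) :=
  h.sqInt_sym (by fun_prop) p.half_div_de_le j

end Par

/-! ### Inner products of multipliers -/

lemma HC.inner_eq (f g : HC) : inner ℝ f g = ∫ ξ, ((starRingEnd ℂ) (f ξ) * g ξ).re := by
  rw [L2.inner_def]
  refine integral_congr_ae (Eventually.of_forall fun ξ => ?_)
  simp only [Complex.inner, mul_comm]

lemma HC.integrable_inner (f g : HC) :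
    Integrable fun ξ => ((starRingEnd ℂ) (f ξ) * g ξ).re := by
  have := L2.integrable_inner (𝕜 := ℝ) f g
  simpa only [Complex.inner, mul_comm] using this

/-- Only the product of the two symbols matters, so a factor may be moved from one side of the inner
product to the other. -/
lemma inner_mulL_convT_congr {m n m' n' : Plane → ℂ} (hm : Bdd m) (hn : SqInt n) (hm' : Bdd m')
    (hn' : SqInt n') (h : ∀ ξ, (starRingEnd ℂ) (m ξ) * n ξ = (starRingEnd ℂ) (m' ξ) * n' ξ)
    (f g g' : HC) : inner ℝ (mulL m f) (convT n g g') = inner ℝ (mulL m' f) (convT n' g g') := by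
  rw [HC.inner_eq, HC.inner_eq]
  refine integral_congr_ae ?_
  filter_upwards [mulL_coe hm f, convT_coe hn g g', mulL_coe hm' f, convT_coe hn' g g']
    with ξ h1 h2 h3 h4
  rw [h1, h2, h3, h4, map_mul, map_mul]
  congr 1
  linear_combination ((starRingEnd ℂ) (f ξ) * conv g g' ξ) * h ξ

/-- The cancellation of the linear terms in the energy identity. -/
lemma inner_mulL_add_eq_zero {m n m' n' : Plane → ℂ} (hm : Bdd m) (hn : Bdd n) (hm' : Bdd m')
    (hn' : Bdd n') (h : ∀ ξ, (starRingEnd ℂ) (m ξ) * n ξ + m' ξ * (starRingEnd ℂ) (n' ξ) = 0)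
    (f g : HC) : inner ℝ (mulL m f) (mulL n g) + inner ℝ (mulL m' g) (mulL n' f) = 0 := by
  rw [HC.inner_eq, HC.inner_eq, ← integral_add (HC.integrable_inner _ _) (HC.integrable_inner _ _)]
  rw [← integral_zero Plane ℝ]
  refine integral_congr_ae ?_
  filter_upwards [mulL_coe hm f, mulL_coe hn g, mulL_coe hm' g, mulL_coe hn' f] with ξ h1 h2 h3 h4
  rw [h1, h2, h3, h4, ← Complex.conj_re ((starRingEnd ℂ) (m' ξ * g ξ) * (n' ξ * f ξ)),
    ← Complex.add_re]
  simp only [map_mul, Complex.conj_conj]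
  rw [show (0 : ℝ) = (0 : ℂ).re from rfl]
  congr 1
  linear_combination ((starRingEnd ℂ) (f ξ) * g ξ) * h ξ

lemma enorm_convT_le {m : Plane → ℂ} (hm : SqInt m) {W : Plane → ENNReal}
    (hW : ∀ ξ, ‖m ξ‖ₑ ≤ W ξ) (f g : HC) :
    ‖convT m f g‖ₑ ≤ N2 (fun ξ => W ξ * cv (fun ζ => ‖f ζ‖ₑ) (fun ζ => ‖g ζ‖ₑ) ξ) := by
  rw [HC.enorm_eq]
  refine N2_mono ?_
  filter_upwards [convT_coe hm f g] with ξ hξ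
  rw [hξ, enorm_mul]
  gcongr
  exacts [hW ξ, enorm_conv_le f g ξ]

/-! ### The commutator identity -/

lemma ae_sub_prod {P : Plane → Prop} (h : ∀ᵐ ξ, P ξ) :
    ∀ᵐ z : Plane × Plane ∂(volume.prod volume), P (z.1 - z.2) := by
  have h1 : Measure.QuasiMeasurePreserving (fun z : Plane × Plane => z.1 - z.2)
      (volume.prod volume) volume :=
    Measure.quasiMeasurePreserving_fst.comp
      (measurePreserving_sub_prod (volume : Measure Plane) volume).quasiMeasurePreserving
  exact h1.ae h

/-- For Hermitian `a`, the operator `f ↦ ∂_j (f a)` is skew-symmetric up to a commutator. -/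
lemma abs_integral_comm_le {f a : Plane → ℂ} (hf : Measurable f) (ha : Measurable a)
    (hh : ∀ᵐ ξ, a (-ξ) = (starRingEnd ℂ) (a ξ)) {Φ : Plane → ℝ} (hΦ : Measurable Φ)
    (hfin : ∫⁻ ξ, ∫⁻ ζ, ‖Φ ξ‖ₑ * (‖f ξ‖ₑ * ‖f ζ‖ₑ * ‖a (ξ - ζ)‖ₑ) < ⊤) :
    ENNReal.ofReal (2 * |∫ ξ, ((starRingEnd ℂ) (f ξ) * ((-Complex.I * Φ ξ) * conv f a ξ)).re|) ≤
      ∫⁻ ξ, ∫⁻ ζ, ‖Φ ξ - Φ ζ‖ₑ * (‖f ξ‖ₑ * ‖f ζ‖ₑ * ‖a (ξ - ζ)‖ₑ) := by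
  set G : Plane × Plane → ℂ := fun z => (starRingEnd ℂ) (f z.1) * f z.2 * a (z.1 - z.2) with hG
  have hGm : Measurable G := by
    rw [hG]
    have : Measurable fun z : Plane × Plane => (starRingEnd ℂ) (f z.1) :=
      Complex.continuous_conj.measurable.comp (by fun_prop)
    fun_prop
  have hGe : ∀ z, ‖G z‖ₑ = ‖f z.1‖ₑ * ‖f z.2‖ₑ * ‖a (z.1 - z.2)‖ₑ := fun z => by
    simp only [hG, enorm_mul]
    congr 2
    exact RCLike.enorm_conj (f z.1)
  set H : Plane × Plane → ℂ := fun z => (Φ z.1 : ℂ) * G z with hH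
  have hHi : Integrable H (volume.prod volume) := by
    refine ⟨Measurable.aestronglyMeasurable (by fun_prop), ?_⟩
    rw [HasFiniteIntegral, lintegral_prod _ (by fun_prop)]
    refine lt_of_le_of_lt (le_of_eq ?_) hfin
    refine lintegral_congr fun ξ => lintegral_congr fun ζ => ?_
    rw [hH]; simp only [enorm_mul, hGe]
    congr 1
    simp [enorm_eq_nnnorm]
  set I₀ := ∫ z, H z ∂(volume.prod volume) with hI
  have e1 : ∫ ξ, ((starRingEnd ℂ) (f ξ) * ((-Complex.I * Φ ξ) * conv f a ξ)).re = I₀.im := by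
    have h1 : ∀ ξ, (starRingEnd ℂ) (f ξ) * ((-Complex.I * Φ ξ) * conv f a ξ) =
        -Complex.I * ∫ ζ, H (ξ, ζ) := fun ξ => by
      have : ∀ ζ, H (ξ, ζ) = ((Φ ξ : ℂ) * (starRingEnd ℂ) (f ξ)) * (f ζ * a (ξ - ζ)) := fun ζ => by
        simp only [hH, hG]; ring
      simp_rw [this]
      rw [integral_const_mul, conv]; ring
    have h2 : ∀ z : ℂ, (-Complex.I * z).re = z.im := fun z => by simp
    simp_rw [h1, h2]
    rw [hI, integral_prod _ hHi]
    exact integral_im hHi.integral_prod_left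
  have hH' : Integrable (fun z : Plane × Plane => (Φ z.2 : ℂ) * G z) (volume.prod volume) := by
    have := hHi.swap
    refine (this.norm).mono' (Measurable.aestronglyMeasurable (by fun_prop)) ?_
    filter_upwards [ae_sub_prod hh] with z hz
    simp only [Function.comp, hH, norm_mul, hG, Prod.fst_swap, Prod.snd_swap, RCLike.norm_conj]
    rw [← neg_sub z.1 z.2, hz, RCLike.norm_conj, mul_comm ‖f z.1‖]
  -- Exchanging ξ and ζ and using that a is Hermitian, the conjugate of I₀ is the same integral with
  -- Φ(ζ) in place of Φ(ξ). Thus 2i Im I₀ contains only the difference Φ(ξ) - Φ(ζ).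
  have e2 : (starRingEnd ℂ) I₀ = ∫ z : Plane × Plane, (Φ z.2 : ℂ) * G z ∂(volume.prod volume) := by
    rw [hI, ← integral_prod_swap, ← integral_conj]
    refine integral_congr_ae ?_
    filter_upwards [ae_sub_prod hh] with z hz
    simp only [hH, hG, Prod.fst_swap, Prod.snd_swap, map_mul, Complex.conj_conj, Complex.conj_ofReal]
    rw [← neg_sub z.1 z.2, hz, Complex.conj_conj]; ring
  have e3 : ‖I₀ - (starRingEnd ℂ) I₀‖ = 2 * |I₀.im| := by
    rw [Complex.sub_conj]
    simp
  rw [e1, ← e3, ofReal_norm, e2, hI, ← integral_sub hHi hH']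
  refine (enorm_integral_le_lintegral_enorm _).trans (le_of_eq ?_)
  rw [lintegral_prod _ (by fun_prop)]
  refine lintegral_congr fun ξ => lintegral_congr fun ζ => ?_
  rw [← sub_mul, enorm_mul, hGe, ← Complex.ofReal_sub]
  congr 1
  rw [← ofReal_norm, ← ofReal_norm, Complex.norm_real]

/-! ### Lipschitz bounds and symmetries of the vector field -/

/-- Maps that are Lipschitz on bounded sets. -/
def LipB {E E' : Type*} [NormedAddCommGroup E] [NormedAddCommGroup E'] (G : E → E') : Prop :=
  ∀ R : ℝ, ∃ K : ℝ, 0 ≤ K ∧ ∀ x y : E, ‖x‖ ≤ R → ‖y‖ ≤ R → ‖G x - G y‖ ≤ K * ‖x - y‖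

section LipB

variable {E E' E'' : Type*} [NormedAddCommGroup E] [NormedAddCommGroup E'] [NormedAddCommGroup E'']

lemma LipB.add {G G' : E → E'} (h : LipB G) (h' : LipB G') : LipB fun x => G x + G' x := by
  intro R
  obtain ⟨K, hK, h1⟩ := h R
  obtain ⟨L, hL, h2⟩ := h' R
  refine ⟨K + L, by positivity, fun x y hx hy => ?_⟩
  rw [add_sub_add_comm, add_mul]
  exact norm_add_le_of_le (h1 x y hx hy) (h2 x y hx hy)

lemma LipB.sum {ι : Type*} (s : Finset ι) {G : ι → E → E'} (h : ∀ i, LipB (G i)) :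
    LipB fun x => ∑ i ∈ s, G i x := by
  classical
  induction s using Finset.induction_on with
  | empty => exact fun R => ⟨0, le_rfl, fun x y _ _ => by simp⟩
  | insert i s hi ih => simp_rw [Finset.sum_insert hi]; exact (h i).add ih

lemma LipB.prodMk {G : E → E'} {G' : E → E''} (h : LipB G) (h' : LipB G') :
    LipB fun x => (G x, G' x) := by
  intro R
  obtain ⟨K, hK, h1⟩ := h R
  obtain ⟨L, hL, h2⟩ := h' R
  refine ⟨max K L, le_max_of_le_left hK, fun x y hx hy => ?_⟩
  rw [Prod.mk_sub_mk, norm_prod_le_iff]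
  exact ⟨(h1 x y hx hy).trans (by gcongr; exact le_max_left _ _),
    (h2 x y hx hy).trans (by gcongr; exact le_max_right _ _)⟩

lemma LipB.pi {G : Fin 2 → E → E'} (h : ∀ i, LipB (G i)) : LipB fun x i => G i x := by
  intro R
  choose K hK h1 using fun i => h i R
  refine ⟨∑ i, K i, Finset.sum_nonneg fun i _ => hK i, fun x y hx hy => ?_⟩
  rw [pi_norm_le_iff_of_nonneg (mul_nonneg (Finset.sum_nonneg fun i _ => hK i) (norm_nonneg _))]
  intro i
  refine (h1 i x y hx hy).trans ?_
  gcongr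
  exact Finset.single_le_sum (fun i _ => hK i) (Finset.mem_univ i)

lemma LipB.of_clm [NormedSpace ℝ E] [NormedSpace ℝ E'] (A : E →L[ℝ] E') : LipB A := fun _ =>
  ⟨‖A‖, norm_nonneg _, fun x y _ _ => by rw [← map_sub]; exact A.le_opNorm _⟩

lemma LipB.bilin [NormedSpace ℝ E] [NormedSpace ℝ E'] [NormedSpace ℝ E'']
    (B : E' →L[ℝ] E' →L[ℝ] E'') (A A' : E →L[ℝ] E') : LipB fun x => B (A x) (A' x) := by
  intro R
  refine ⟨‖B‖ * (‖A‖ * ‖A'‖ * |R| + ‖A‖ * |R| * ‖A'‖), by positivity, fun x y hx hy => ?_⟩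
  have e : B (A x) (A' x) - B (A y) (A' y) = B (A (x - y)) (A' x) + B (A y) (A' (x - y)) := by
    simp only [map_sub, sub_apply]; abel
  have hx' := hx.trans (le_abs_self R)
  have hy' := hy.trans (le_abs_self R)
  rw [e]
  calc _ ≤ ‖B‖ * (‖A‖ * ‖x - y‖) * (‖A'‖ * |R|) + ‖B‖ * (‖A‖ * |R|) * (‖A'‖ * ‖x - y‖) := by
        refine norm_add_le_of_le ((B.le_opNorm₂ _ _).trans ?_) ((B.le_opNorm₂ _ _).trans ?_)
        · gcongr
          · exact A.le_opNorm _
          · exact (A'.le_opNorm _).trans (by gcongr)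
        · gcongr
          · exact (A.le_opNorm _).trans (by gcongr)
          · exact A'.le_opNorm _
    _ = _ := by ring

lemma LipB.continuous {G : E → E'} (h : LipB G) : Continuous G := by
  rw [continuous_iff_continuousAt]
  intro x
  obtain ⟨K, hK, h1⟩ := h (‖x‖ + 1)
  rw [ContinuousAt, tendsto_iff_norm_sub_tendsto_zero]
  have h2 : Tendsto (fun y => K * ‖y - x‖) (𝓝 x) (𝓝 0) := by
    have : Continuous fun y => K * ‖y - x‖ := by fun_prop
    simpa using this.tendsto x
  refine squeeze_zero' (Eventually.of_forall fun y => norm_nonneg _) ?_ h2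
  filter_upwards [Metric.ball_mem_nhds x one_pos] with y hy
  refine h1 y x ?_ (by linarith)
  have := norm_le_norm_add_norm_sub x y
  rw [mem_ball_iff_norm, norm_sub_rev] at hy
  linarith

end LipB

/-- The action of an operator on all components. -/
def liftX (A : HC →L[ℝ] HC) : X →L[ℝ] X :=
  (A.comp (ContinuousLinearMap.fst ℝ HC (Fin 2 → HC))).prod
    (ContinuousLinearMap.pi fun i => (A.comp (ContinuousLinearMap.proj i)).comp
      (ContinuousLinearMap.snd ℝ HC (Fin 2 → HC)))

lemma liftX_fst (A : HC →L[ℝ] HC) (U : X) : (liftX A U).1 = A U.1 := rfl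

lemma liftX_snd (A : HC →L[ℝ] HC) (U : X) (i : Fin 2) : (liftX A U).2 i = A (U.2 i) := rfl

lemma X.ext {U V : X} (h : U.1 = V.1) (h' : ∀ i, U.2 i = V.2 i) : U = V :=
  Prod.ext h (funext h')

/-- Multiplication of all components by a real symbol. -/
def mulX (w : Plane → ℝ) : X →L[ℝ] X := liftX (mulL (rs w))

namespace Par

variable (p : Par)

/-- After the cut-off the vector field is a sum of bounded linear and bounded bilinear maps. -/
lemma lipB_F (κ : Plane → ℝ) : LipB (p.F κ) := by
  set π : Fin 2 → X →L[ℝ] HC := fun j => (ContinuousLinearMap.proj j).comp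
    (ContinuousLinearMap.snd ℝ HC (Fin 2 → HC))
  refine LipB.prodMk (LipB.sum _ fun j => LipB.add ?_ ?_) (LipB.pi fun i => LipB.add ?_ ?_)
  · exact LipB.of_clm ((mulL _).comp (π j))
  · exact LipB.bilin _ (ContinuousLinearMap.fst ℝ HC (Fin 2 → HC)) (π j)
  · exact LipB.of_clm ((mulL _).comp (ContinuousLinearMap.fst ℝ HC (Fin 2 → HC)))
  · exact LipB.sum _ fun j => LipB.bilin _ (π j) (π j)

lemma conj_sym (j : Fin 2) {w : Plane → ℝ} (h : ∀ ξ, w (-ξ) = w ξ) (ξ : Plane) :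
    (starRingEnd ℂ) (sym j w (-ξ)) = sym j w ξ := by
  simp [sym, freq_neg, h]

lemma F_refl {κ : Plane → ℝ} (hκ : Adm κ) (he : ∀ ξ, κ (-ξ) = κ ξ) (U : X) :
    p.F κ (liftX refl U) = liftX refl (p.F κ U) := by
  refine X.ext ?_ fun i => ?_
  · simp only [F, liftX_fst, liftX_snd, map_sum, map_add]
    refine Finset.sum_congr rfl fun j _ => ?_
    rw [refl_mulL (p.bdd_al hκ j) (conj_sym j (fun ξ => by rw [he, al_neg])),
      refl_convT (p.sqInt_eps hκ j) (conj_sym j (fun ξ => by rw [he]))]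
  · simp only [F, liftX_fst, liftX_snd, map_sum, map_add]
    rw [refl_mulL (p.bdd_be hκ i) (conj_sym i (fun ξ => by rw [he, be_neg]))]
    congr 1
    refine Finset.sum_congr rfl fun j _ => ?_
    rw [refl_convT (p.sqInt_de hκ i) (conj_sym i (fun ξ => by rw [he, de_neg]))]

/-- Allows passage between the two regularizations of the vector field, the sharp cut-off `ch N` and
the decaying factor `wt (-4)`. -/
lemma mulX_F {κ w : Plane → ℝ} (hκ : Adm κ) (hw : Bdd (rs w)) (hκ' : Adm fun ξ => w ξ * κ ξ)
    (U : X) : mulX w (p.F κ U) = p.F (fun ξ => w ξ * κ ξ) U := by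
  have e : ∀ (j : Fin 2) (v : Plane → ℝ) (ξ : Plane),
      rs w ξ * sym j (fun ξ => κ ξ * v ξ) ξ = sym j (fun ξ => (w ξ * κ ξ) * v ξ) ξ := fun j v ξ => by
    rw [rs_mul_sym]; simp only [sym, mul_assoc]
  refine X.ext ?_ fun i => ?_
  · simp only [F, mulX, liftX_fst, map_sum, map_add]
    refine Finset.sum_congr rfl fun j _ => ?_
    rw [mulL_mulL hw (p.bdd_al hκ j) (p.bdd_al hκ' j) (e j _),
      mulL_convT hw (p.sqInt_eps hκ j) (p.sqInt_eps hκ' j) (e j _)]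
  · simp only [F, mulX, liftX_snd, map_sum, map_add]
    rw [mulL_mulL hw (p.bdd_be hκ i) (p.bdd_be hκ' i) (e i _)]
    congr 1
    refine Finset.sum_congr rfl fun j _ => ?_
    rw [mulL_convT hw (p.sqInt_de hκ i) (p.sqInt_de hκ' i) (e i _)]

end Par

/-! ### Weighted norms of square integrable functions -/

/-- The norm of `f` with weight `wt r`, the `H^r` norm on the Fourier side. -/
def hs (r : ℝ) (f : HC) : ENNReal := N2 (fun ξ => ewt r ξ * ‖f ξ‖ₑ)

lemma HC.measurable_enorm (f : HC) : Measurable fun ξ => ‖f ξ‖ₑ := f.measurable.enorm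

lemma hs_zero (f : HC) : hs 0 f = ‖f‖ₑ := by simp [hs, ewt_zero, f.enorm_eq]

lemma hs_mono {r q : ℝ} (h : r ≤ q) (f : HC) : hs r f ≤ hs q f :=
  N2_mono (Eventually.of_forall fun ξ => by gcongr; exact ewt_mono h ξ)

lemma hs_add_le (r : ℝ) (f g : HC) : hs r (f + g) ≤ hs r f + hs r g := by
  have hf := f.measurable_enorm
  have hg := g.measurable_enorm
  refine le_trans (N2_mono ?_) (N2_add_le (by fun_prop) (by fun_prop))
  filter_upwards [Lp.coeFn_add f g] with ξ hξ
  rw [hξ, Pi.add_apply, ← mul_add]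
  gcongr
  exact enorm_add_le _ _

lemma hs_neg (r : ℝ) (f : HC) : hs r (-f) = hs r f := by
  refine N2_congr ?_
  filter_upwards [Lp.coeFn_neg f] with ξ hξ
  rw [hξ, Pi.neg_apply, enorm_neg]

lemma hs_sub_le (r : ℝ) (f g : HC) : hs r (f - g) ≤ hs r f + hs r g := by
  rw [sub_eq_add_neg, ← hs_neg r g]; exact hs_add_le r f (-g)

lemma norm_le_hs {r : ℝ} (hr : 0 ≤ r) (f : HC) : ‖f‖ₑ ≤ hs r f := by
  rw [← hs_zero]; exact hs_mono hr f

lemma N1_le_hs (s r : ℝ) (f : HC) :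
    N1 (fun ξ => ewt r ξ * ‖f ξ‖ₑ) ≤ wienerC s * hs (s + r) f :=
  N1_le s r f.measurable_enorm

lemma N1_le_hs' (s : ℝ) (f : HC) : N1 (fun ξ => ‖f ξ‖ₑ) ≤ wienerC s * hs s f :=
  N1_le' s f.measurable_enorm

lemma norm_mulL_le {m n : Plane → ℂ} (hm : Bdd m) (hn : Bdd n) {C : ℝ}
    (h : ∀ ξ, ‖m ξ‖ ≤ C * ‖n ξ‖) (f : HC) : ‖mulL m f‖ ≤ C * ‖mulL n f‖ := by
  refine Lp.norm_le_mul_norm_of_ae_le_mul ?_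
  filter_upwards [mulL_coe hm f, mulL_coe hn f] with ξ h1 h2
  rw [h1, h2, norm_mul, norm_mul, ← mul_assoc]
  gcongr
  exact h ξ

/-- A function supported in the ball of radius `N`. -/
def Supp (N : ℝ) (f : HC) : Prop := mulL (rs (ch N)) f = f

lemma Supp.ae {N : ℝ} {f : HC} (h : Supp N f) :
    (f : Plane → ℂ) =ᵐ[volume] fun ξ => rs (ch N) ξ * f ξ := by
  have := mulL_coe (bdd_ch N) f
  rwa [h] at this

lemma Supp.mono {N M : ℝ} (hNM : N ≤ M) {f : HC} (h : Supp N f) : Supp M f := by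
  rw [Supp, ← h, mulL_mulL (bdd_ch M) (bdd_ch N) (bdd_ch N)]
  intro ξ
  rw [rs_mul_rs]; simp only [rs, ch_mul_ch hNM]

lemma supp_mulL (N : ℝ) (f : HC) : Supp N (mulL (rs (ch N)) f) := by
  rw [Supp, mulL_mulL (bdd_ch N) (bdd_ch N) (bdd_ch N)]
  intro ξ
  rw [rs_mul_rs]; simp only [rs, ch_mul_ch le_rfl]

/-- On functions supported in the ball the cut-off of the operator is invisible, and the full
weighted norm appears. -/
lemma enorm_mulL_ch {w : Plane → ℝ} (hw : LocBdd w) (h0 : ∀ ξ, 0 ≤ w ξ) {N : ℝ} {f : HC}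
    (hf : Supp N f) :
    ‖mulL (rs fun ξ => ch N ξ * w ξ) f‖ₑ = N2 (fun ξ => ENNReal.ofReal (w ξ) * ‖f ξ‖ₑ) := by
  rw [enorm_mulL (hw.bdd_ch N)]
  refine N2_congr ?_
  filter_upwards [hf.ae] with ξ hξ
  rw [hξ, enorm_mul, ← mul_assoc, ← mul_assoc]
  congr 1
  rw [← enorm_mul, rs_mul_rs, ← ofReal_norm, ← ofReal_norm, ← ENNReal.ofReal_mul (h0 ξ), norm_rs,
    norm_rs]
  congr 1
  rw [abs_mul, abs_mul, abs_of_nonneg (h0 ξ), abs_of_nonneg (ch_nonneg N ξ), mul_right_comm,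
    ch_mul_ch le_rfl, mul_comm]

lemma Supp.hs_lt_top {N : ℝ} {f : HC} (hf : Supp N f) (r : ℝ) : hs r f < ⊤ := by
  have := enorm_mulL_ch (continuous_wt r).locBdd (fun ξ => (wt_pos r ξ).le) hf
  unfold hs ewt
  rw [← this]
  exact enorm_lt_top

lemma Supp.N1_lt_top {N : ℝ} {f : HC} (hf : Supp N f) : N1 (fun ξ => ‖f ξ‖ₑ) < ⊤ :=
  (N1_le_hs' 2 f).trans_lt (ENNReal.mul_lt_top (wienerC_lt_top one_lt_two) (hf.hs_lt_top 2))

/-- The commutator identity for truncated functions. -/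
lemma comm_bound {ω : Plane → ℝ} (hω : LocBdd ω) {N : ℝ} {f a : HC} (hf : Supp N f)
    (ha : refl a = a) (j : Fin 2) {ε : ℝ} (hε : 0 ≤ ε) :
    ENNReal.ofReal (2 * |inner ℝ (mulL (rs fun ξ => ch N ξ * ω ξ) f)
      (mulL (rs fun ξ => ch N ξ * ω ξ) (convT (sym j fun ξ => ch N ξ * ε) f a))|) ≤
    ENNReal.ofReal ε * ∫⁻ ξ, ∫⁻ ζ, ‖ω ξ ^ 2 * freq j ξ - ω ζ ^ 2 * freq j ζ‖ₑ *
      (‖f ξ‖ₑ * ‖f ζ‖ₑ * ‖a (ξ - ζ)‖ₑ) := by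
  have hωm := hω.1
  have hfm := f.measurable
  have ham := a.measurable
  set fN : Plane → ℂ := fun ξ => rs (ch N) ξ * f ξ with hfN
  have hfNm : Measurable fN := by fun_prop
  have hff : (f : Plane → ℂ) =ᵐ[volume] fN := hf.ae
  set Φ : Plane → ℝ := fun ξ => ch N ξ * (ω ξ ^ 2 * freq j ξ) with hΦ
  have hΦm : Measurable Φ := by fun_prop
  have hL : LocBdd fun ξ => ω ξ ^ 2 * freq j ξ := by
    simp_rw [sq]; exact (hω.mul hω).mul (continuous_freq j).locBdd
  obtain ⟨C, hC0, hC⟩ := hL.ch_bdd N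
  have hh : ∀ᵐ ξ, a (-ξ) = (starRingEnd ℂ) (a ξ) := by
    have := refl_coe a
    rw [ha] at this
    filter_upwards [this] with ξ hξ
    rw [hξ, Complex.conj_conj]
  have hfin : ∫⁻ ξ, ∫⁻ ζ, ‖Φ ξ‖ₑ * (‖fN ξ‖ₑ * ‖fN ζ‖ₑ * ‖a (ξ - ζ)‖ₑ) < ⊤ := by
    have h1 : ∀ ξ ζ, ‖Φ ξ‖ₑ * (‖fN ξ‖ₑ * ‖fN ζ‖ₑ * ‖a (ξ - ζ)‖ₑ) =
        (‖Φ ξ‖ₑ * ‖fN ξ‖ₑ) * ‖a (ξ - ζ)‖ₑ * ‖fN ζ‖ₑ := fun ξ ζ => by ring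
    simp_rw [h1]
    refine (trilinear_N2_N2_N1 (A := fun ξ => ‖Φ ξ‖ₑ * ‖fN ξ‖ₑ) (B := fun ξ => ‖a ξ‖ₑ)
      (D := fun ξ => ‖fN ξ‖ₑ) (by fun_prop) (by fun_prop) (by fun_prop)).trans_lt ?_
    refine ENNReal.mul_lt_top (ENNReal.mul_lt_top ?_ a.N2_lt_top) ?_
    · refine lt_of_le_of_lt (N2_mono (G := fun ξ => ENNReal.ofReal C * ‖f ξ‖ₑ) ?_) ?_
      · filter_upwards [hff] with ξ hξ
        rw [← hξ]
        gcongr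
        rw [← ofReal_norm]
        exact ENNReal.ofReal_le_ofReal (hC ξ)
      · rw [N2_const_mul _ ENNReal.ofReal_ne_top]
        exact ENNReal.mul_lt_top ENNReal.ofReal_lt_top f.N2_lt_top
    · refine lt_of_eq_of_lt (lintegral_congr_ae ?_) hf.N1_lt_top
      filter_upwards [hff] with ξ hξ
      rw [hξ]
  have key := abs_integral_comm_le hfNm ham hh hΦm hfin
  have e1 : inner ℝ (mulL (rs fun ξ => ch N ξ * ω ξ) f)
      (mulL (rs fun ξ => ch N ξ * ω ξ) (convT (sym j fun ξ => ch N ξ * ε) f a)) =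
      ε * ∫ ξ, ((starRingEnd ℂ) (fN ξ) * ((-Complex.I * Φ ξ) * conv fN a ξ)).re := by
    rw [HC.inner_eq, ← integral_const_mul]
    refine integral_congr_ae ?_
    filter_upwards [mulL_coe (hω.bdd_ch N) f, mulL_coe (hω.bdd_ch N)
      (convT (sym j fun ξ => ch N ξ * ε) f a),
      convT_coe ((adm_ch N).sqInt_sym measurable_const (fun _ => le_rfl) j) f a] with ξ h1 h2 h3
    rw [h1, h2, h3, conv_congr hff (ae_eq_refl a), ← Complex.re_ofReal_mul]
    congr 1
    have h4 : (ch N ξ : ℂ) * ch N ξ = ch N ξ := by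
      rw [← Complex.ofReal_mul, ch_mul_ch le_rfl]
    simp only [rs, sym, hfN, hΦ, map_mul, Complex.conj_ofReal]
    push_cast
    linear_combination (-Complex.I * (starRingEnd ℂ) (f ξ) * ω ξ ^ 2 * freq j ξ * ε *
      conv (fun ξ => (ch N ξ : ℂ) * f ξ) a ξ * (ch N ξ : ℂ)) * h4
  rw [e1, abs_mul, abs_of_nonneg hε, mul_left_comm, ENNReal.ofReal_mul hε]
  gcongr
  refine key.trans (le_of_eq ?_)
  refine lintegral_congr_ae ?_
  filter_upwards [hff] with ξ hξ
  refine lintegral_congr_ae ?_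
  filter_upwards [hff] with ζ hζ
  rw [← hξ, ← hζ]
  -- The sharp cut-off inside Φ does no harm to the commutator: f vanishes outside the ball in both
  -- variables.
  have hz : ∀ η : Plane, f η = fN η → N < ‖η‖ → f η = 0 := fun η h1 h2 => by
    rw [h1, hfN]; simp [rs, ch_of_lt h2]
  rcases le_or_gt ‖ξ‖ N with h1 | h1
  · rcases le_or_gt ‖ζ‖ N with h2 | h2
    · simp only [hΦ, ch_of_le h1, ch_of_le h2, one_mul]
    · simp [hz ζ hζ h2]
  · simp [hz ξ hξ h1]

lemma lintegral_lintegral_add_add {A B D : Plane × Plane → ENNReal} (hA : Measurable A)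
    (hB : Measurable B) :
    ∫⁻ ξ, ∫⁻ ζ, (A (ξ, ζ) + B (ξ, ζ) + D (ξ, ζ)) =
      (∫⁻ ξ, ∫⁻ ζ, A (ξ, ζ)) + (∫⁻ ξ, ∫⁻ ζ, B (ξ, ζ)) + ∫⁻ ξ, ∫⁻ ζ, D (ξ, ζ) := by
  have h1 : ∀ ξ, ∫⁻ ζ, (A (ξ, ζ) + B (ξ, ζ) + D (ξ, ζ)) =
      (∫⁻ ζ, A (ξ, ζ)) + (∫⁻ ζ, B (ξ, ζ)) + ∫⁻ ζ, D (ξ, ζ) := fun ξ => by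
    have : Measurable fun ζ => A (ξ, ζ) + B (ξ, ζ) := by fun_prop
    rw [lintegral_add_left this, lintegral_add_left (by fun_prop)]
  have hM : Measurable fun ξ => ∫⁻ ζ, A (ξ, ζ) := hA.lintegral_prod_right'
  have hM' : Measurable fun ξ => (∫⁻ ζ, A (ξ, ζ)) + ∫⁻ ζ, B (ξ, ζ) :=
    hM.add hB.lintegral_prod_right'
  simp_rw [h1]
  rw [lintegral_add_left hM', lintegral_add_left hM]

/-- The commutator estimate with a weight at least as strong as `wt s`, `s > 1`. -/
lemma comm_bound_weight {s : ℝ} {q : ℕ} {ω : Plane → ℝ} (hω : IsWeight s q ω)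
    {N : ℝ} {f a : HC}
    (hf : Supp N f) (hA : Supp N a) (ha : refl a = a) (j : Fin 2) {ε : ℝ} (hε : 0 ≤ ε) :
    ENNReal.ofReal (2 * |inner ℝ (mulL (rs fun ξ => ch N ξ * ω ξ) f)
      (mulL (rs fun ξ => ch N ξ * ω ξ) (convT (sym j fun ξ => ch N ξ * ε) f a))|) ≤
    ENNReal.ofReal ε * (ENNReal.ofReal (commC q) * (3 * wienerC s *
      (‖mulL (rs fun ξ => ch N ξ * ω ξ) f‖ₑ ^ 2 *
        ‖mulL (rs fun ξ => ch N ξ * (ω ξ * wt 1 ξ)) a‖ₑ))) := by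
  refine (comm_bound hω.locBdd hf ha j hε).trans ?_
  gcongr
  have hωm := hω.measurable
  have hfm := f.measurable_enorm
  have ham := a.measurable_enorm
  set W : Plane → ENNReal := fun ξ => ENNReal.ofReal (ω ξ) with hW
  have hWm : Measurable W := by fun_prop
  have hsW : ∀ ξ, ewt s ξ ≤ W ξ := fun ξ => ENNReal.ofReal_le_ofReal (hω.le ξ)
  have hpt : ∀ ξ ζ, ‖ω ξ ^ 2 * freq j ξ - ω ζ ^ 2 * freq j ζ‖ₑ *
      (‖f ξ‖ₑ * ‖f ζ‖ₑ * ‖a (ξ - ζ)‖ₑ) ≤ ENNReal.ofReal (commC q) *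
      ((W ξ * ‖f ξ‖ₑ) * (ewt 1 (ξ - ζ) * ‖a (ξ - ζ)‖ₑ) * (W ζ * ‖f ζ‖ₑ) +
       (W ξ * ‖f ξ‖ₑ) * (W (ξ - ζ) * ewt 1 (ξ - ζ) * ‖a (ξ - ζ)‖ₑ) * ‖f ζ‖ₑ +
       ‖f ξ‖ₑ * (W (ξ - ζ) * ewt 1 (ξ - ζ) * ‖a (ξ - ζ)‖ₑ) * (W ζ * ‖f ζ‖ₑ)) := by
    intro ξ ζ
    have h1 := hω.dilates.commutator (fun ξ => (hω.pos ξ).le) j ξ ζ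
    have h2 := ENNReal.ofReal_le_ofReal h1
    have p1 := (hω.pos ξ).le
    have p2 := (hω.pos ζ).le
    have p3 := (hω.pos (ξ - ζ)).le
    have p4 := (wt_pos 1 (ξ - ζ)).le
    rw [ENNReal.ofReal_mul (commC_pos q).le, ENNReal.ofReal_mul p4,
      ENNReal.ofReal_add (by positivity) (by positivity),
      ENNReal.ofReal_add (by positivity) (by positivity), ENNReal.ofReal_mul p1,
      ENNReal.ofReal_mul p1, ENNReal.ofReal_mul p2] at h2
    rw [← ofReal_norm, Real.norm_eq_abs]
    calc _ ≤ _ := mul_le_mul_left h2 _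
      _ = _ := by simp only [hW, ewt]; ring
  refine (lintegral_mono fun ξ => lintegral_mono fun ζ => hpt ξ ζ).trans ?_
  simp_rw [lintegral_const_mul' _ _ (ENNReal.ofReal_ne_top)]
  gcongr
  -- In each of the three kernel terms the factor without ω goes into L¹: the differentiated a in
  -- the first, one of the two copies of f in the others. This is the origin of the constant 3.
  have hc := trilinear_N2_N1_N2 (A := fun ξ => W ξ * ‖f ξ‖ₑ) (B := fun ξ => ewt 1 ξ * ‖a ξ‖ₑ)
      (D := fun ξ => W ξ * ‖f ξ‖ₑ) (by fun_prop) (by fun_prop) (by fun_prop)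
  have hb := trilinear_N2_N2_N1 (A := fun ξ => W ξ * ‖f ξ‖ₑ)
      (B := fun ξ => W ξ * ewt 1 ξ * ‖a ξ‖ₑ)
      (D := fun ξ => ‖f ξ‖ₑ) (by fun_prop) (by fun_prop) (by fun_prop)
  have hd := trilinear_N1_N2_N2 (A := fun ξ => ‖f ξ‖ₑ)
      (B := fun ξ => W ξ * ewt 1 ξ * ‖a ξ‖ₑ)
      (D := fun ξ => W ξ * ‖f ξ‖ₑ) (by fun_prop) (by fun_prop) (by fun_prop)
  have e1 : ‖mulL (rs fun ξ => ch N ξ * ω ξ) f‖ₑ = N2 (fun ξ => W ξ * ‖f ξ‖ₑ) :=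
    enorm_mulL_ch hω.locBdd (fun ξ => (hω.pos ξ).le) hf
  have e2 : ‖mulL (rs fun ξ => ch N ξ * (ω ξ * wt 1 ξ)) a‖ₑ =
      N2 (fun ξ => W ξ * ewt 1 ξ * ‖a ξ‖ₑ) := by
    rw [enorm_mulL_ch (hω.locBdd.mul (continuous_wt 1).locBdd)
      (fun ξ => mul_nonneg (hω.pos ξ).le (wt_pos 1 ξ).le) hA]
    simp_rw [ENNReal.ofReal_mul (hω.pos _).le]; rfl
  have n1 : N1 (fun ξ => ‖f ξ‖ₑ) ≤ wienerC s * N2 (fun ξ => W ξ * ‖f ξ‖ₑ) := by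
    refine (N1_le_hs' s f).trans ?_
    gcongr
    exact N2_mono (Eventually.of_forall fun ξ => by gcongr; exact hsW ξ)
  have n2 : N1 (fun ξ => ewt 1 ξ * ‖a ξ‖ₑ) ≤
      wienerC s * N2 (fun ξ => W ξ * ewt 1 ξ * ‖a ξ‖ₑ) := by
    refine (N1_le_hs s 1 a).trans ?_
    gcongr
    refine N2_mono (Eventually.of_forall fun ξ => ?_)
    simp only [ewt_add]
    gcongr
    exact hsW ξ
  rw [e1, e2]
  set P := N2 (fun ξ => W ξ * ‖f ξ‖ₑ)
  set Q := N2 (fun ξ => W ξ * ewt 1 ξ * ‖a ξ‖ₑ)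
  rw [lintegral_lintegral_add_add
    (A := fun z : Plane × Plane =>
      (W z.1 * ‖f z.1‖ₑ) * (ewt 1 (z.1 - z.2) * ‖a (z.1 - z.2)‖ₑ) * (W z.2 * ‖f z.2‖ₑ))
    (B := fun z : Plane × Plane =>
      (W z.1 * ‖f z.1‖ₑ) * (W (z.1 - z.2) * ewt 1 (z.1 - z.2) * ‖a (z.1 - z.2)‖ₑ) * ‖f z.2‖ₑ)
    (D := fun z : Plane × Plane =>
      ‖f z.1‖ₑ * (W (z.1 - z.2) * ewt 1 (z.1 - z.2) * ‖a (z.1 - z.2)‖ₑ) * (W z.2 * ‖f z.2‖ₑ))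
    (by fun_prop) (by fun_prop)]
  calc _ ≤ P * (wienerC s * Q) * P + P * Q * (wienerC s * P) + (wienerC s * P) * Q * P := by
        refine add_le_add (add_le_add (hc.trans ?_) (hb.trans ?_)) (hd.trans ?_)
        · gcongr
        · gcongr
        · gcongr
    _ = _ := by ring

/-! ### The energy estimate -/

/-- Restriction to frequencies of size at most `N`, weighted with `w`. -/
abbrev prj (N : ℝ) (w : Plane → ℝ) : HC →L[ℝ] HC := mulL (rs fun ξ => ch N ξ * w ξ)

/-- Truncated states that are Fourier transforms of real functions. -/
structure Good (N : ℝ) (U : X) : Prop where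
  supp_fst : Supp N U.1
  supp_snd : ∀ j, Supp N (U.2 j)
  herm : liftX refl U = U

lemma Good.refl_snd {N : ℝ} {U : X} (h : Good N U) (j : Fin 2) : refl (U.2 j) = U.2 j :=
  congrFun (congrArg Prod.snd h.herm) j

lemma prj_mulL_sym {N : ℝ} {w u : Plane → ℝ} (hw : LocBdd w) (hu : LocBdd u) (j : Fin 2)
    (f : HC) : prj N w (mulL (sym j fun ξ => ch N ξ * u ξ) f) =
      mulL (sym j fun ξ => ch N ξ * (w ξ * u ξ)) f := by
  have h0 : ∀ ξ, |(1 : ℝ)| ≤ 1 * wt 2 ξ := fun ξ => by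
    rw [abs_one, one_mul]; exact one_le_wt zero_le_two ξ
  have e : ∀ v : Plane → ℝ, LocBdd v → Bdd (sym j fun ξ => ch N ξ * v ξ) := fun v hv => by
    simpa using (hv.adm N).bdd_sym measurable_const h0 j
  refine mulL_mulL (hw.bdd_ch N) (e u hu) (e _ (hw.mul hu)) (fun ξ => ?_) f
  rw [rs_mul_sym, sym, sym]
  congr 3
  linear_combination w ξ * u ξ * ch_mul_ch (le_refl N) ξ

namespace Par

variable (p : Par)

/-- The weight of the velocity in the energy. -/
def wv (ω : Plane → ℝ) (ξ : Plane) : ℝ := ω ξ * √(p.em ξ)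

/-- The energy at the level of the weight `ω`. -/
def En (ω : Plane → ℝ) (N : ℝ) (U : X) : ℝ :=
  ‖prj N ω U.1‖ ^ 2 + ∑ j, ‖prj N (p.wv ω) (U.2 j)‖ ^ 2

/-- Half the derivative of the energy. -/
def dEn (ω : Plane → ℝ) (N : ℝ) (U V : X) : ℝ :=
  inner ℝ (prj N ω U.1) (prj N ω V.1) +
    ∑ j, inner ℝ (prj N (p.wv ω) (U.2 j)) (prj N (p.wv ω) (V.2 j))

lemma En_nonneg (ω : Plane → ℝ) (N : ℝ) (U : X) : 0 ≤ p.En ω N U := by unfold En; positivity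

lemma norm_prj_fst_le (ω : Plane → ℝ) (N : ℝ) (U : X) : ‖prj N ω U.1‖ ≤ √(p.En ω N U) := by
  refine Real.le_sqrt_of_sq_le ?_
  unfold En
  have : 0 ≤ ∑ j, ‖prj N (p.wv ω) (U.2 j)‖ ^ 2 := by positivity
  linarith

lemma norm_prj_snd_le (ω : Plane → ℝ) (N : ℝ) (U : X) (j : Fin 2) :
    ‖prj N (p.wv ω) (U.2 j)‖ ≤ √(p.En ω N U) := by
  refine Real.le_sqrt_of_sq_le ?_
  unfold En
  have := Finset.single_le_sum (f := fun j => ‖prj N (p.wv ω) (U.2 j)‖ ^ 2)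
    (fun i _ => sq_nonneg _) (Finset.mem_univ j)
  have h2 := sq_nonneg ‖prj N ω U.1‖
  linarith

lemma hasDerivWithinAt_En {ω : Plane → ℝ} {N : ℝ} {U : ℝ → X} {U' : X} {S : Set ℝ} {t : ℝ}
    (h : HasDerivWithinAt U U' S t) :
    HasDerivWithinAt (fun τ => p.En ω N (U τ)) (2 * p.dEn ω N (U t) U') S t := by
  have h1 : ∀ A : X →L[ℝ] HC, HasDerivWithinAt (fun τ => ‖A (U τ)‖ ^ 2)
      (2 * inner ℝ (A (U t)) (A U')) S t := fun A =>
    (A.hasFDerivAt.comp_hasDerivWithinAt t h).norm_sq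
  have ha := h1 ((prj N ω).comp (ContinuousLinearMap.fst ℝ HC (Fin 2 → HC)))
  have hb := fun j => h1 (((prj N (p.wv ω)).comp (ContinuousLinearMap.proj j)).comp
    (ContinuousLinearMap.snd ℝ HC (Fin 2 → HC)))
  have := ha.add (HasDerivWithinAt.fun_sum (u := Finset.univ) fun j _ => hb j)
  rw [dEn, mul_add, Finset.mul_sum]
  exact this

lemma locBdd_wv {ω : Plane → ℝ} (h : LocBdd ω) : LocBdd (p.wv ω) :=
  h.mul p.continuous_em.sqrt.locBdd

lemma locBdd_al : LocBdd p.al := p.continuous_al.locBdd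
lemma locBdd_be : LocBdd p.be := p.continuous_be.locBdd

/-- By `em_mul_be` the two products of symbols coincide, and -i k_j is imaginary, so the real parts
cancel. This holds for any weight ω. -/
lemma dEn_linear {ω : Plane → ℝ} (h : LocBdd ω) (N : ℝ) (f g : HC) (j : Fin 2) :
    inner ℝ (prj N ω f) (prj N ω (mulL (sym j fun ξ => ch N ξ * p.al ξ) g)) +
      inner ℝ (prj N (p.wv ω) g) (prj N (p.wv ω) (mulL (sym j fun ξ => ch N ξ * p.be ξ) f)) = 0 := by
  have h0 : ∀ ξ, |(1 : ℝ)| ≤ 1 * wt 2 ξ := fun ξ => by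
    rw [abs_one, one_mul]; exact one_le_wt zero_le_two ξ
  have e : ∀ v : Plane → ℝ, LocBdd v → Bdd (sym j fun ξ => ch N ξ * v ξ) := fun v hv => by
    simpa using (hv.adm N).bdd_sym measurable_const h0 j
  rw [prj_mulL_sym h p.locBdd_al, prj_mulL_sym (p.locBdd_wv h) p.locBdd_be]
  refine inner_mulL_add_eq_zero (h.bdd_ch N) (e _ (h.mul p.locBdd_al)) ((p.locBdd_wv h).bdd_ch N)
    (e _ ((p.locBdd_wv h).mul p.locBdd_be)) (fun ξ => ?_) f g
  have h3 : (√(p.em ξ) : ℂ) * √(p.em ξ) = p.em ξ := by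
    rw [← Complex.ofReal_mul, Real.mul_self_sqrt (p.em_pos ξ).le]
  have h4 : (p.em ξ : ℂ) * p.be ξ = p.al ξ := by rw [← Complex.ofReal_mul, em_mul_be]
  simp only [rs, sym, wv, map_mul, map_neg, Complex.conj_ofReal, Complex.conj_I]
  push_cast
  linear_combination Complex.I * (ch N ξ : ℂ) ^ 2 * (ω ξ : ℂ) ^ 2 * (freq j ξ) * (h4 +
    (p.be ξ : ℂ) * h3)

/-- One derivative of v costs ε^(-1/2) in terms of the energy. The lifespan ε^(-1/2) originates
here. -/
lemma wt_one_le_sqrt_em (ξ : Plane) : wt 1 ξ ≤ (√(p.lo * p.ε))⁻¹ * √(p.em ξ) := by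
  have hl := p.lo_pos
  have hε := p.hε
  have hp : 0 < √(p.lo * p.ε) := by positivity
  rw [le_inv_mul_iff₀ hp]
  refine Real.le_sqrt_of_sq_le ?_
  rw [mul_pow, Real.sq_sqrt (by positivity), wt_one_sq, mul_assoc]
  refine le_trans ?_ (p.lo_mul_le_em ξ)
  gcongr
  have := p.eps_wt_le ξ
  rwa [wt_two] at this

lemma one_le_sqrt_em (ξ : Plane) : 1 ≤ (√p.lo)⁻¹ * √(p.em ξ) := by
  have hl := p.lo_pos
  have hε := p.hε
  have hp : 0 < √p.lo := by positivity
  rw [le_inv_mul_iff₀ hp, mul_one]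
  refine Real.sqrt_le_sqrt (le_trans ?_ (p.lo_mul_le_em ξ))
  have : 0 ≤ p.ε * (2 * Real.pi * ‖ξ‖) ^ 2 := by positivity
  nlinarith

lemma norm_prj_wt_le {s : ℝ} {q : ℕ} {ω : Plane → ℝ} (h : IsWeight s q ω) (N : ℝ) (f : HC) :
    ‖prj N (fun ξ => ω ξ * wt 1 ξ) f‖ ≤ (√(p.lo * p.ε))⁻¹ * ‖prj N (p.wv ω) f‖ := by
  refine norm_mulL_le ((h.locBdd.mul (continuous_wt 1).locBdd).bdd_ch N)
    ((p.locBdd_wv h.locBdd).bdd_ch N) (fun ξ => ?_) f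
  have h1 := h.pos ξ
  have h2 := ch_nonneg N ξ
  have h3 := p.wt_one_le_sqrt_em ξ
  have h4 := wt_pos 1 ξ
  rw [norm_rs, norm_rs, wv, abs_of_nonneg (by positivity), abs_of_nonneg (by positivity)]
  calc ch N ξ * (ω ξ * wt 1 ξ) ≤ ch N ξ * (ω ξ * ((√(p.lo * p.ε))⁻¹ * √(p.em ξ))) := by gcongr
    _ = _ := by ring

lemma norm_prj_le {s : ℝ} {q : ℕ} {ω : Plane → ℝ} (h : IsWeight s q ω) (N : ℝ) (f : HC) :
    ‖prj N ω f‖ ≤ (√p.lo)⁻¹ * ‖prj N (p.wv ω) f‖ := by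
  refine norm_mulL_le (h.locBdd.bdd_ch N)
    ((p.locBdd_wv h.locBdd).bdd_ch N) (fun ξ => ?_) f
  have h1 := h.pos ξ
  have h2 := ch_nonneg N ξ
  have h3 := p.one_le_sqrt_em ξ
  rw [norm_rs, norm_rs, wv, abs_of_nonneg (by positivity), abs_of_nonneg (by positivity)]
  calc ch N ξ * ω ξ = ch N ξ * (ω ξ * 1) := by ring
    _ ≤ ch N ξ * (ω ξ * ((√p.lo)⁻¹ * √(p.em ξ))) := by gcongr
    _ = _ := by ring

/-- The transport term in the equation of `η`. -/
lemma dEn_transport {s : ℝ} (hs : 1 < s) {q : ℕ} {ω : Plane → ℝ} (h : IsWeight s q ω) {N : ℝ}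
    {U : X} (hU : Good N U) (j : Fin 2) :
    |inner ℝ (prj N ω U.1) (prj N ω (convT (sym j fun ξ => ch N ξ * p.ε) U.1 (U.2 j)))| ≤
      √p.ε * (3 / 2 * commC q * (wienerC s).toReal * (√p.lo)⁻¹) * √(p.En ω N U) ^ 3 := by
  have h1 := comm_bound_weight h hU.supp_fst (hU.supp_snd j) (hU.refl_snd j) j p.hε.le
  have hc := (commC_pos q).le
  have hε := p.hε
  have hl := p.lo_pos
  have h2 : 2 * |inner ℝ (prj N ω U.1) (prj N ω (convT (sym j fun ξ => ch N ξ * p.ε) U.1 (U.2 j)))|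
      ≤ p.ε * (commC q * (3 * (wienerC s).toReal * (‖prj N ω U.1‖ ^ 2 *
        ‖prj N (fun ξ => ω ξ * wt 1 ξ) (U.2 j)‖))) := by
    have h3 := ENNReal.toReal_mono ?_ h1
    · rw [ENNReal.toReal_ofReal (by positivity)] at h3
      simpa [ENNReal.toReal_mul, ENNReal.toReal_ofReal, hc, hε.le] using h3
    · have h4 := (wienerC_lt_top hs).ne
      finiteness
  have h3 := p.norm_prj_wt_le h N (U.2 j)
  have h4 := p.norm_prj_fst_le ω N U
  have h5 := p.norm_prj_snd_le ω N U j
  -- The factor ε of the nonlinearity against the price ε^(-1/2) of one derivative leaves √ε.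
  have e : p.ε * (√(p.lo * p.ε))⁻¹ = √p.ε * (√p.lo)⁻¹ := by
    rw [Real.sqrt_mul hl.le, mul_inv, mul_left_comm]
    nth_rw 1 [← Real.mul_self_sqrt hε.le]
    have : √p.ε ≠ 0 := by positivity
    field_simp
  have hw : 0 ≤ (wienerC s).toReal := ENNReal.toReal_nonneg
  calc _ ≤ 1 / 2 * (p.ε * (commC q * (3 * (wienerC s).toReal * (√(p.En ω N U) ^ 2 *
        ((√(p.lo * p.ε))⁻¹ * √(p.En ω N U)))))) := by
        rw [← div_le_iff₀' (by norm_num)]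
        have : ‖prj N (fun ξ => ω ξ * wt 1 ξ) (U.2 j)‖ ≤ (√(p.lo * p.ε))⁻¹ * √(p.En ω N U) :=
          h3.trans (by gcongr)
        rw [div_eq_mul_inv, one_div, inv_inv, mul_comm]
        refine h2.trans ?_
        gcongr
    _ = 3 / 2 * (p.ε * (√(p.lo * p.ε))⁻¹) * commC q * (wienerC s).toReal *
        √(p.En ω N U) ^ 3 := by ring
    _ = _ := by rw [e]; ring

/-- The nonlinear term in the equation of `v`. -/
lemma dEn_quadratic {s : ℝ} (hs : 1 < s) {q : ℕ} {ω : Plane → ℝ} (h : IsWeight s q ω) {N : ℝ}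
    {U : X} (hU : Good N U) (i j : Fin 2) :
    |inner ℝ (prj N (p.wv ω) (U.2 i))
      (prj N (p.wv ω) (convT (sym i fun ξ => ch N ξ * (p.ε / 2 / p.de ξ)) (U.2 j) (U.2 j)))| ≤
      √p.ε * ((1 + p.a / p.c) * 2 ^ (q + 1) * (wienerC s).toReal * (√p.lo)⁻¹ ^ 3) *
        √(p.En ω N U) ^ 3 := by
  have hε := p.hε
  have hl := p.lo_pos
  have hac : 0 < p.a / p.c := div_pos_of_neg_of_neg p.ha p.hc
  have hω := h.measurable
  set u : Plane → ℝ := fun ξ => p.em ξ * (p.ε / 2 / p.de ξ) with hu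
  have hm : LocBdd fun ξ => p.ε / 2 / p.de ξ := Continuous.locBdd (continuous_const.div
    p.continuous_de fun ξ => (zero_lt_one.trans_le (p.one_le_de ξ)).ne')
  have huL : LocBdd u := p.continuous_em.locBdd.mul hm
  have hsq : ∀ v : Plane → ℝ, LocBdd v → SqInt (sym i fun ξ => ch N ξ * v ξ) := fun v hv => by
    simpa using (hv.adm N).sqInt_sym (w := fun _ => 1) measurable_const (C := 1) (by simp) i
  -- The factor √em on the left is moved to the right, where em / de is bounded uniformly in ε. The
  -- left factor then needs no more than the weight ω.
  have e1 : inner ℝ (prj N (p.wv ω) (U.2 i))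
      (prj N (p.wv ω) (convT (sym i fun ξ => ch N ξ * (p.ε / 2 / p.de ξ)) (U.2 j) (U.2 j))) =
      inner ℝ (prj N ω (U.2 i)) (convT (sym i fun ξ => ch N ξ * (ω ξ * u ξ)) (U.2 j) (U.2 j)) := by
    rw [prj, mulL_convT ((p.locBdd_wv h.locBdd).bdd_ch N) (hsq _ hm)
      (hsq _ ((p.locBdd_wv h.locBdd).mul hm)) (fun ξ => ?_)]
    · refine inner_mulL_convT_congr ((p.locBdd_wv h.locBdd).bdd_ch N)
        (hsq _ ((p.locBdd_wv h.locBdd).mul hm)) (h.locBdd.bdd_ch N) (hsq _ (h.locBdd.mul huL))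
        (fun ξ => ?_) _ _ _
      have h3 : (√(p.em ξ) : ℂ) * √(p.em ξ) = p.em ξ := by
        rw [← Complex.ofReal_mul, Real.mul_self_sqrt (p.em_pos ξ).le]
      simp only [rs, sym, wv, hu, Complex.conj_ofReal]
      push_cast
      linear_combination (-Complex.I) * (ch N ξ : ℂ) ^ 2 * (ω ξ : ℂ) ^ 2 * (freq i ξ) *
        (p.ε / 2 / p.de ξ) * h3
    · rw [rs_mul_sym, sym, sym]
      congr 3
      linear_combination p.wv ω ξ * (p.ε / 2 / p.de ξ) * ch_mul_ch (le_refl N) ξ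
  set k : ℝ := p.ε / 2 * (1 + p.a / p.c) with hk
  have hk0 : 0 ≤ k := by positivity
  set Θ : Plane → ENNReal := fun ξ => ENNReal.ofReal (ω ξ * wt 1 ξ) with hΘ
  have hW : ∀ ξ, ‖sym i (fun ξ => ch N ξ * (ω ξ * u ξ)) ξ‖ₑ ≤ ENNReal.ofReal k * Θ ξ := fun ξ => by
    rw [← ofReal_norm, ← ENNReal.ofReal_mul hk0]
    refine ENNReal.ofReal_le_ofReal ?_
    have h1 := h.pos ξ
    have h2 := ch_nonneg N ξ
    have h3 := ch_le_one N ξ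
    have h4 := p.em_pos ξ
    have h5 := zero_lt_one.trans_le (p.one_le_de ξ)
    have h6 := abs_freq_le_wt i ξ
    have h7 := p.em_div_de_le ξ
    have h8 := wt_pos 1 ξ
    rw [norm_sym, hu, abs_of_nonneg (by positivity : 0 ≤ ch N ξ * (ω ξ * (p.em ξ * (p.ε / 2 / p.de ξ))))]
    calc |freq i ξ| * (ch N ξ * (ω ξ * (p.em ξ * (p.ε / 2 / p.de ξ))))
        = |freq i ξ| * (ch N ξ * (ω ξ * (p.ε / 2 * (p.em ξ / p.de ξ)))) := by ring
      _ ≤ wt 1 ξ * (1 * (ω ξ * (p.ε / 2 * (1 + p.a / p.c)))) := by gcongr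
      _ = _ := by ring
  have hD : Dilates (q + 1) (fun ξ => ω ξ * wt 1 ξ) :=
    h.dilates.mul dilates_wt_one (fun ξ => (h.pos ξ).le) (fun ξ => (wt_pos 1 ξ).le)
  have h0 : ∀ ξ, 0 ≤ ω ξ * wt 1 ξ := fun ξ => mul_nonneg (h.pos ξ).le (wt_pos 1 ξ).le
  have hq : ∀ ξ ζ, Θ ξ ≤ ENNReal.ofReal (2 ^ (q + 1)) * Θ ζ +
      ENNReal.ofReal (2 ^ (q + 1)) * Θ (ξ - ζ) := fun ξ ζ => by
    have h1 := h0 ζ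
    have h2 := h0 (ξ - ζ)
    simp only [hΘ]
    rw [← ENNReal.ofReal_mul (by positivity), ← ENNReal.ofReal_mul (by positivity),
      ← ENNReal.ofReal_add (by positivity) (by positivity)]
    exact ENNReal.ofReal_le_ofReal (hD.quasi_add h0 ξ ζ)
  set f := U.2 j with hf
  have hfm := f.measurable_enorm
  have hΘm : Measurable Θ := by fun_prop
  have hS := hU.supp_snd j
  have n1 : N2 (fun ξ => Θ ξ * ‖f ξ‖ₑ) = ‖prj N (fun ξ => ω ξ * wt 1 ξ) f‖ₑ :=
    (enorm_mulL_ch (h.locBdd.mul (continuous_wt 1).locBdd) h0 hS).symm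
  have n2 : N1 (fun ξ => ‖f ξ‖ₑ) ≤ wienerC s * ‖prj N ω f‖ₑ := by
    refine (N1_le_hs' s f).trans ?_
    rw [prj, enorm_mulL_ch h.locBdd (fun ξ => (h.pos ξ).le) hS]
    gcongr
    exact N2_mono (Eventually.of_forall fun ξ => by
      gcongr; exact ENNReal.ofReal_le_ofReal (h.le ξ))
  have key : ‖convT (sym i fun ξ => ch N ξ * (ω ξ * u ξ)) f f‖ₑ ≤
      ENNReal.ofReal k * (ENNReal.ofReal (2 ^ (q + 1)) *
        (‖prj N (fun ξ => ω ξ * wt 1 ξ) f‖ₑ * (wienerC s * ‖prj N ω f‖ₑ) +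
        (wienerC s * ‖prj N ω f‖ₑ) * ‖prj N (fun ξ => ω ξ * wt 1 ξ) f‖ₑ)) := by
    refine (enorm_convT_le (hsq _ (h.locBdd.mul huL)) hW f f).trans ?_
    simp_rw [mul_assoc (ENNReal.ofReal k)]
    rw [N2_const_mul _ ENNReal.ofReal_ne_top]
    gcongr
    refine (N2_cv_weight_le ENNReal.ofReal_ne_top hΘm hq hfm hfm).trans ?_
    rw [n1]
    gcongr
  have key' : ‖convT (sym i fun ξ => ch N ξ * (ω ξ * u ξ)) f f‖ ≤
      k * (2 ^ (q + 1) * (‖prj N (fun ξ => ω ξ * wt 1 ξ) f‖ * ((wienerC s).toReal * ‖prj N ω f‖) +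
        ((wienerC s).toReal * ‖prj N ω f‖) * ‖prj N (fun ξ => ω ξ * wt 1 ξ) f‖)) := by
    have h4 := (wienerC_lt_top hs).ne
    have h3 := ENNReal.toReal_mono (by finiteness) key
    rw [toReal_enorm] at h3
    rw [ENNReal.toReal_mul, ENNReal.toReal_mul, ENNReal.toReal_add (by finiteness) (by finiteness),
      ENNReal.toReal_ofReal hk0, ENNReal.toReal_ofReal (by positivity)] at h3
    simpa [ENNReal.toReal_mul] using h3
  have hw : 0 ≤ (wienerC s).toReal := ENNReal.toReal_nonneg
  have b1 : ‖prj N (fun ξ => ω ξ * wt 1 ξ) f‖ ≤ (√(p.lo * p.ε))⁻¹ * √(p.En ω N U) :=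
    (p.norm_prj_wt_le h N _).trans (by gcongr; exact p.norm_prj_snd_le ω N U j)
  have b2 : ∀ l, ‖prj N ω (U.2 l)‖ ≤ (√p.lo)⁻¹ * √(p.En ω N U) := fun l =>
    (p.norm_prj_le h N _).trans (by gcongr; exact p.norm_prj_snd_le ω N U l)
  have e : p.ε * (√(p.lo * p.ε))⁻¹ = √p.ε * (√p.lo)⁻¹ := by
    rw [Real.sqrt_mul hl.le, mul_inv, mul_left_comm]
    nth_rw 1 [← Real.mul_self_sqrt hε.le]
    have : √p.ε ≠ 0 := by positivity
    field_simp
  rw [e1]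
  refine (abs_real_inner_le_norm _ _).trans ?_
  calc _ ≤ ((√p.lo)⁻¹ * √(p.En ω N U)) * (k * (2 ^ (q + 1) * (((√(p.lo * p.ε))⁻¹ * √(p.En ω N U)) *
        ((wienerC s).toReal * ((√p.lo)⁻¹ * √(p.En ω N U))) +
        ((wienerC s).toReal * ((√p.lo)⁻¹ * √(p.En ω N U))) *
          ((√(p.lo * p.ε))⁻¹ * √(p.En ω N U))))) := by
        refine mul_le_mul (b2 i) (key'.trans ?_) (norm_nonneg _) (by positivity)
        have b3 := b2 j
        rw [← hf] at b3
        gcongr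
    _ = (p.ε * (√(p.lo * p.ε))⁻¹) * ((1 + p.a / p.c) * 2 ^ (q + 1) * (wienerC s).toReal *
        (√p.lo)⁻¹ ^ 2) * √(p.En ω N U) ^ 3 := by rw [hk]; ring
    _ = _ := by rw [e]; ring

/-- The constant in the energy estimate; it does not depend on `ε`. -/
def enC (s : ℝ) (q : ℕ) : ℝ :=
  2 * (2 * (3 / 2 * commC q * (wienerC s).toReal * (√p.lo)⁻¹) +
    4 * ((1 + p.a / p.c) * 2 ^ (q + 1) * (wienerC s).toReal * (√p.lo)⁻¹ ^ 3))

lemma enC_nonneg (s : ℝ) (q : ℕ) : 0 ≤ p.enC s q := by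
  have hac : 0 < p.a / p.c := div_pos_of_neg_of_neg p.ha p.hc
  have := (commC_pos q).le
  have hw : 0 ≤ (wienerC s).toReal := ENNReal.toReal_nonneg
  unfold enC
  positivity

/-- The energy estimate for the truncated system. -/
lemma dEn_le {s : ℝ} (hs : 1 < s) {q : ℕ} {ω : Plane → ℝ} (h : IsWeight s q ω) {N : ℝ}
    {U : X} (hU : Good N U) :
    2 * p.dEn ω N U (p.F (ch N) U) ≤ √p.ε * p.enC s q * √(p.En ω N U) ^ 3 := by
  have hl := fun j => p.dEn_linear h.locBdd N U.1 (U.2 j) j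
  have ht := fun j => (le_abs_self _).trans (p.dEn_transport hs h hU j)
  have hq := fun i j => (le_abs_self _).trans (p.dEn_quadratic hs h hU i j)
  have e : p.dEn ω N U (p.F (ch N) U) =
      ∑ j, (inner ℝ (prj N ω U.1) (prj N ω (mulL (sym j fun ξ => ch N ξ * p.al ξ) (U.2 j))) +
        inner ℝ (prj N (p.wv ω) (U.2 j))
          (prj N (p.wv ω) (mulL (sym j fun ξ => ch N ξ * p.be ξ) U.1))) +
      (∑ j, inner ℝ (prj N ω U.1) (prj N ω (convT (sym j fun ξ => ch N ξ * p.ε) U.1 (U.2 j))) +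
      ∑ i, ∑ j, inner ℝ (prj N (p.wv ω) (U.2 i)) (prj N (p.wv ω)
        (convT (sym i fun ξ => ch N ξ * (p.ε / 2 / p.de ξ)) (U.2 j) (U.2 j)))) := by
    simp only [dEn, F, map_add, map_sum, inner_add_right, inner_sum, Finset.sum_add_distrib]
    ring
  -- The linear part is gone; two transport terms and four quadratic terms remain, whence the
  -- factors 2 and 4 in `enC`.
  rw [e, Finset.sum_eq_zero fun j _ => hl j, zero_add]
  have h1 := Finset.sum_le_sum fun j (_ : j ∈ Finset.univ) => ht j
  have h2 := Finset.sum_le_sum fun i (_ : i ∈ Finset.univ) =>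
    Finset.sum_le_sum fun j (_ : j ∈ Finset.univ) => hq i j
  simp only [Finset.sum_const, Finset.card_univ, Fintype.card_fin, nsmul_eq_mul] at h1 h2
  push_cast at h1 h2
  rw [enC]
  linear_combination 2 * h1 + 2 * h2

end Par

/-! ### Ordinary differential equations with an a priori bound -/

section ODE

variable {E : Type*} [NormedAddCommGroup E]

/-- A cut-off function, equal to one on the ball of radius `R`. -/
def cut (R : ℝ) (x : E) : ℝ := max (min 1 (R + 1 - ‖x‖)) 0

lemma cut_nonneg (R : ℝ) (x : E) : 0 ≤ cut R x := le_max_right _ _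

lemma cut_le_one (R : ℝ) (x : E) : cut R x ≤ 1 := max_le (min_le_left _ _) zero_le_one

lemma cut_of_le {R : ℝ} {x : E} (h : ‖x‖ ≤ R) : cut R x = 1 := by
  rw [cut, min_eq_left (by linarith), max_eq_left zero_le_one]

lemma cut_of_ge {R : ℝ} {x : E} (h : R + 1 ≤ ‖x‖) : cut R x = 0 := by
  rw [cut, max_eq_right (min_le_of_right_le (by linarith))]

lemma abs_cut_sub_le (R : ℝ) (x y : E) : |cut R x - cut R y| ≤ ‖x - y‖ := by
  unfold cut
  refine (abs_max_sub_max_le_abs _ _ _).trans ?_ |>.trans (abs_norm_sub_norm_le x y)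
  rw [min_comm 1, min_comm 1]
  refine (abs_min_sub_min_le_max _ _ _ _).trans ?_
  rw [sub_self, abs_zero, max_eq_left (abs_nonneg _), abs_sub_comm]
  exact le_of_eq (by congr 1; ring)

variable [NormedSpace ℝ E]

/-- The cut-off field is globally bounded and Lipschitz. An a priori bound can then show that its
solution never meets the cut-off, and no continuation argument is needed. -/
lemma LipB.cut_smul {G : E → E} (hG : LipB G) {R : ℝ} (hR : 0 ≤ R) :
    ∃ L K : NNReal, (∀ x, ‖cut R x • G x‖ ≤ L) ∧ LipschitzWith K fun x => cut R x • G x := by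
  obtain ⟨K, hK, h⟩ := hG (R + 1)
  set L := ‖G 0‖ + K * (R + 1) with hL
  have hL0 : 0 ≤ L := by positivity
  have hb : ∀ x, ‖x‖ ≤ R + 1 → ‖G x‖ ≤ L := fun x hx => by
    have h1 := h x 0 hx (by rw [norm_zero]; linarith)
    rw [sub_zero] at h1
    have h2 := norm_le_norm_add_norm_sub (G 0) (G x)
    rw [norm_sub_rev] at h2
    have : K * ‖x‖ ≤ K * (R + 1) := by gcongr
    linarith
  have hlip : ∀ x y, ‖x‖ ≤ R + 1 → ‖cut R x • G x - cut R y • G y‖ ≤ (L + K) * ‖x - y‖ := by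
    intro x y hx
    rcases le_or_gt ‖y‖ (R + 1) with hy | hy
    · have e : cut R x • G x - cut R y • G y = (cut R x - cut R y) • G x + cut R y • (G x - G y) := by
        rw [sub_smul, smul_sub]; abel
      rw [e, add_mul, mul_comm L]
      refine norm_add_le_of_le ?_ ?_
      · rw [norm_smul, Real.norm_eq_abs]
        exact mul_le_mul (abs_cut_sub_le R x y) (hb x hx) (norm_nonneg _) (norm_nonneg _)
      · rw [norm_smul, Real.norm_eq_abs, abs_of_nonneg (cut_nonneg R y)]
        calc _ ≤ 1 * (K * ‖x - y‖) := by
              gcongr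
              exacts [cut_le_one R y, h x y hx hy]
          _ = _ := one_mul _
    · have h0 : cut R y = 0 := cut_of_ge hy.le
      rw [h0, zero_smul, sub_zero, norm_smul, Real.norm_eq_abs]
      have h1 := abs_cut_sub_le R x y
      rw [h0, sub_zero] at h1
      have h2 := hb x hx
      calc |cut R x| * ‖G x‖ ≤ ‖x - y‖ * L := by gcongr
        _ ≤ _ := by nlinarith [norm_nonneg (x - y)]
  refine ⟨⟨L, hL0⟩, ⟨L + K, by positivity⟩, fun x => ?_, LipschitzWith.of_dist_le_mul fun x y => ?_⟩
  · rcases le_or_gt ‖x‖ (R + 1) with hx | hx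
    · rw [norm_smul, Real.norm_eq_abs, abs_of_nonneg (cut_nonneg R x)]
      calc _ ≤ 1 * L := by gcongr; exacts [cut_le_one R x, hb x hx]
        _ = _ := one_mul _
    · rw [cut_of_ge hx.le, zero_smul, norm_zero]; exact hL0
  · rw [dist_eq_norm, dist_eq_norm]
    change _ ≤ (L + K) * _
    rcases le_or_gt ‖x‖ (R + 1) with hx | hx
    · exact hlip x y hx
    · rcases le_or_gt ‖y‖ (R + 1) with hy | hy
      · rw [norm_sub_rev, norm_sub_rev x]; exact hlip y x hy
      · rw [cut_of_ge hx.le, cut_of_ge hy.le, zero_smul, zero_smul, sub_zero, norm_zero]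
        positivity

lemma LipB.exists_cut_solution [CompleteSpace E] {G : E → E} (hG : LipB G) {R : ℝ} (hR : 0 ≤ R)
    (x₀ : E) {T : ℝ} (hT : 0 ≤ T) : ∃ x : ℝ → E, x 0 = x₀ ∧
      ∀ t ∈ Icc 0 T, HasDerivWithinAt x (cut R (x t) • G (x t)) (Icc 0 T) t := by
  obtain ⟨L, K, hL, hK⟩ := hG.cut_smul hR
  -- The radius L · T is the farthest a curve of speed at most L can travel in time T, so T need not
  -- be small.
  have hPL : IsPicardLindelof (fun (_ : ℝ) x => cut R x • G x) (⟨0, le_rfl, hT⟩ : Icc 0 T) x₀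
      (L * T.toNNReal) 0 L K :=
    { lipschitzOnWith := fun t _ => hK.lipschitzOnWith
      continuousOn := fun x _ => continuousOn_const
      norm_le := fun t _ x _ => hL x
      mul_max_le := by simp [hT] }
  exact hPL.exists_eq_forall_mem_Icc_hasDerivWithinAt₀

/-- A quantity growing at most like the solutions of `y' = κ y^{3/2}` stays bounded on a time
interval of length of order `1 / κ`. -/
lemma le_two_mul_of_deriv_le {φ φ' : ℝ → ℝ} {κ M T : ℝ} (hM : 0 < M) (hκ : 0 ≤ κ)
    (hT : κ * (3 * √M) * T < 1) (h0 : φ 0 ≤ M)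
    (hd : ∀ t ∈ Icc 0 T, HasDerivWithinAt φ (φ' t) (Icc 0 T) t)
    (hle : ∀ t ∈ Icc 0 T, φ' t ≤ κ * √(φ t) ^ 3) : ∀ t ∈ Icc 0 T, φ t ≤ 2 * M := by
  intro t ht
  have hTpos : 0 ≤ T := ht.1.trans ht.2
  rcases hTpos.eq_or_lt with h | hTp
  · have : t = 0 := le_antisymm (h ▸ ht.2) ht.1
    rw [this]; linarith
  -- The barrier is the line from M to 2M. At a contact point φ ≤ 2M, hence φ' ≤ κ (2M)^(3/2) ≤ 3 κ
  -- M^(3/2), which is less than the slope M / T.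
  have key := image_le_of_deriv_right_lt_deriv_boundary' (f := φ) (f' := φ') (a := 0) (b := T)
    (B := fun t => M + M / T * t) (B' := fun _ => M / T)
    (fun t ht => (hd t ht).continuousWithinAt)
    (fun t ht => (hd t (Ico_subset_Icc_self ht)).mono_of_mem_nhdsWithin
      (Filter.mem_of_superset (Icc_mem_nhdsGE ht.2) (Icc_subset_Icc_left ht.1)))
    (by simpa using h0) (by fun_prop)
    (fun t _ => by simpa using (((hasDerivAt_id t).const_mul (M / T)).const_add M).hasDerivWithinAt)
    (fun t ht heq => ?_) ht
  · refine key.trans ?_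
    have : M / T * t ≤ M / T * T := by gcongr; exact ht.2
    rw [div_mul_cancel₀ _ hTp.ne'] at this
    linarith
  · refine (hle t (Ico_subset_Icc_self ht)).trans_lt ?_
    have h1 : M / T * t ≤ M / T * T := by gcongr; exact ht.2.le
    rw [div_mul_cancel₀ _ hTp.ne'] at h1
    have h2 : φ t ≤ 2 * M := by rw [heq]; linarith
    have h3 : √(φ t) ≤ √2 * √M := by
      rw [← Real.sqrt_mul zero_le_two]; exact Real.sqrt_le_sqrt h2
    have h4 : √2 ^ 3 ≤ 3 := by
      have h5 : √2 ^ 2 = 2 := Real.sq_sqrt zero_le_two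
      have h6 : √2 ≤ 3 / 2 := by rw [Real.sqrt_le_left (by norm_num)]; norm_num
      rw [pow_succ, h5]; linarith
    have h7 : √M ^ 2 = M := Real.sq_sqrt hM.le
    rw [lt_div_iff₀ hTp]
    calc κ * √(φ t) ^ 3 * T ≤ κ * (√2 * √M) ^ 3 * T := by gcongr
      _ = κ * (√2 ^ 3 * (√M * √M ^ 2)) * T := by ring
      _ ≤ κ * (3 * (√M * √M ^ 2)) * T := by gcongr
      _ = (κ * (3 * √M) * T) * M := by rw [h7]; ring
      _ < 1 * M := by gcongr
      _ = M := one_mul M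

/-- Global solutions of an ordinary differential equation with a Lyapunov-type quantity `φ`. -/
lemma LipB.exists_solution_of_bound [CompleteSpace E] {G : E → E} (hG : LipB G) {φ : E → ℝ}
    {dφ : E → E → ℝ} {κ M T r : ℝ} (hM : 0 < M) (hκ : 0 ≤ κ) (hT0 : 0 ≤ T)
    (hT : κ * (3 * √M) * T < 1)
    (hφ : ∀ (x : ℝ → E) (x' : E) (S : Set ℝ) (t : ℝ), HasDerivWithinAt x x' S t →
      HasDerivWithinAt (fun τ => φ (x τ)) (dφ (x t) x') S t)
    (hlin : ∀ (c : ℝ) (x y : E), dφ x (c • y) = c * dφ x y)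
    (hle : ∀ x, dφ x (G x) ≤ κ * √(φ x) ^ 3)
    (hr : ∀ x, φ x ≤ 2 * M → ‖x‖ ≤ r) (x₀ : E) (h0 : φ x₀ ≤ M) :
    ∃ x : ℝ → E, x 0 = x₀ ∧ ∀ t ∈ Icc 0 T,
      HasDerivWithinAt x (G (x t)) (Icc 0 T) t ∧ φ (x t) ≤ 2 * M := by
  have hr0 : 0 ≤ r := (norm_nonneg _).trans (hr x₀ (by linarith))
  obtain ⟨x, hx0, hx⟩ := hG.exists_cut_solution hr0 x₀ hT0
  -- Along the cut-off field the derivative of φ is only multiplied by a number in [0, 1], so the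
  -- differential inequality persists. The resulting bound keeps the curve where the cut-off equals
  -- one.
  have hb := le_two_mul_of_deriv_le (φ := fun t => φ (x t)) hM hκ hT (by rw [hx0]; exact h0)
    (fun t ht => hφ x _ _ t (hx t ht)) (fun t ht => by
      rw [hlin]
      have h1 : 0 ≤ κ * √(φ (x t)) ^ 3 := by positivity
      calc _ ≤ cut r (x t) * (κ * √(φ (x t)) ^ 3) := by
            gcongr
            exacts [cut_nonneg _ _, hle _]
        _ ≤ 1 * (κ * √(φ (x t)) ^ 3) := by gcongr; exact cut_le_one _ _
        _ = _ := one_mul _)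
  refine ⟨x, hx0, fun t ht => ⟨?_, hb t ht⟩⟩
  have := hx t ht
  rwa [cut_of_le (hr _ (hb t ht)), one_smul] at this

end ODE

/-! ### The truncated system -/

/-- The space of truncated Hermitian states. -/
def goodSub (N : ℝ) : Submodule ℝ X where
  carrier := {U | Good N U}
  add_mem' := fun {U V} hU hV =>
    ⟨by rw [Supp, Prod.fst_add, map_add, hU.supp_fst, hV.supp_fst],
      fun j => by rw [Supp, Prod.snd_add, Pi.add_apply, map_add, hU.supp_snd j, hV.supp_snd j],
      by rw [map_add, hU.herm, hV.herm]⟩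
  zero_mem' := ⟨map_zero _, fun j => map_zero _, map_zero _⟩
  smul_mem' := fun c U hU =>
    ⟨by rw [Supp, Prod.smul_fst, map_smul, hU.supp_fst],
      fun j => by rw [Supp, Prod.smul_snd, Pi.smul_apply, map_smul, hU.supp_snd j],
      by rw [map_smul, hU.herm]⟩

lemma isClosed_goodSub (N : ℝ) : IsClosed (goodSub N : Set X) := by
  have e : (goodSub N : Set X) = {U | mulX (ch N) U = U} ∩ {U | liftX refl U = U} := by
    ext U
    refine ⟨fun h => ⟨X.ext h.supp_fst h.supp_snd, h.herm⟩, fun h => ⟨?_, fun j => ?_, h.2⟩⟩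
    · exact congrArg Prod.fst h.1
    · exact congrFun (congrArg Prod.snd h.1) j
  rw [e]
  exact (isClosed_eq (mulX (ch N)).continuous continuous_id).inter
    (isClosed_eq (liftX refl).continuous continuous_id)

instance (N : ℝ) : CompleteSpace (goodSub N) := (isClosed_goodSub N).completeSpace_coe

namespace Par

variable (p : Par)

/-- Frequency support is kept since `ch N` is idempotent, reality since the symbols are Hermitian.
The truncated system thus lives on the complete space `goodSub N`. -/
lemma good_F {N : ℝ} {U : X} (hU : Good N U) : Good N (p.F (ch N) U) := by
  have e : (fun ξ => ch N ξ * ch N ξ) = ch N := funext (ch_mul_ch le_rfl)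
  have h := p.mulX_F (adm_ch N) (bdd_ch N) (by rw [e]; exact adm_ch N) U
  rw [e] at h
  refine ⟨congrArg Prod.fst h, fun j => congrFun (congrArg Prod.snd h) j, ?_⟩
  rw [← p.F_refl (adm_ch N) (ch_neg N), hU.herm]

lemma dEn_smul (ω : Plane → ℝ) (N c : ℝ) (U V : X) : p.dEn ω N U (c • V) = c * p.dEn ω N U V := by
  simp only [dEn, Prod.smul_fst, Prod.smul_snd, Pi.smul_apply, map_smul, inner_smul_right, mul_add,
    Finset.mul_sum]

/-- Supplies the norm bound that prevents the truncated solution from reaching the cut-off. On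
supported states a weight that is at least one dominates the L² norm. -/
lemma norm_le_of_En_le {s : ℝ} (hs : 0 ≤ s) {q : ℕ} {ω : Plane → ℝ} (h : IsWeight s q ω) {N : ℝ}
    {U : X} (hU : Good N U) {M : ℝ} (hM : p.En ω N U ≤ M) :
    ‖U‖ ≤ max (√M) ((√p.lo)⁻¹ * √M) := by
  have h0 : ∀ f : HC, Supp N f → ‖f‖ ≤ ‖prj N ω f‖ := fun f hf => by
    have : ‖f‖ₑ ≤ ‖prj N ω f‖ₑ := by
      rw [prj, enorm_mulL_ch h.locBdd (fun ξ => (h.pos ξ).le) hf]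
      refine (norm_le_hs hs f).trans (N2_mono (Eventually.of_forall fun ξ => ?_))
      gcongr
      exact ENNReal.ofReal_le_ofReal (h.le ξ)
    simpa using ENNReal.toReal_mono enorm_ne_top this
  have hl := p.lo_pos
  rw [norm_prod_le_iff, pi_norm_le_iff_of_nonneg (by positivity)]
  refine ⟨?_, fun j => ?_⟩
  · refine (h0 _ hU.supp_fst).trans ((p.norm_prj_fst_le ω N U).trans ?_)
    exact (Real.sqrt_le_sqrt hM).trans (le_max_left _ _)
  · refine (h0 _ (hU.supp_snd j)).trans ((p.norm_prj_le h N _).trans ?_)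
    refine le_trans ?_ (le_max_right _ _)
    gcongr
    exact (p.norm_prj_snd_le ω N U j).trans (Real.sqrt_le_sqrt hM)

/-- The truncated system has solutions that are bounded on a time interval of length of
order `ε ^ (-1/2)`, uniformly in the truncation. -/
lemma exists_truncated {s : ℝ} (hs : 1 < s) {q : ℕ} {ω : Plane → ℝ} (h : IsWeight s q ω) (N : ℝ)
    {U₀ : X} (hU : Good N U₀) {M T : ℝ} (hM : 0 < M) (h0 : p.En ω N U₀ ≤ M) (hT0 : 0 ≤ T)
    (hT : √p.ε * p.enC s q * (3 * √M) * T < 1) :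
    ∃ U : ℝ → X, U 0 = U₀ ∧ ∀ t ∈ Icc 0 T, Good N (U t) ∧
      HasDerivWithinAt U (p.F (ch N) (U t)) (Icc 0 T) t ∧ p.En ω N (U t) ≤ 2 * M := by
  set G : goodSub N → goodSub N := fun x => ⟨p.F (ch N) x, p.good_F x.2⟩ with hG
  have hGL : LipB G := fun R => by
    obtain ⟨K, hK, hl⟩ := p.lipB_F (ch N) R
    exact ⟨K, hK, fun x y hx hy => hl x y hx hy⟩
  obtain ⟨x, hx0, hx⟩ := hGL.exists_solution_of_bound (φ := fun x => p.En ω N x)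
    (dφ := fun x y => 2 * p.dEn ω N x y) (κ := √p.ε * p.enC s q) hM
    (mul_nonneg (Real.sqrt_nonneg _) (p.enC_nonneg s q)) hT0 hT
    (fun x x' S t hx => p.hasDerivWithinAt_En
      ((goodSub N).subtypeL.hasFDerivAt.comp_hasDerivWithinAt t hx))
    (fun c x y => by
      change 2 * p.dEn ω N x (c • (y : X)) = _
      rw [dEn_smul]; ring)
    (fun x => p.dEn_le hs h x.2)
    (fun x hx => p.norm_le_of_En_le (by linarith) h x.2 hx) ⟨U₀, hU⟩ h0
  refine ⟨fun t => x t, congrArg Subtype.val hx0, fun t ht => ⟨(x t).2, ?_, (hx t ht).2⟩⟩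
  exact (goodSub N).subtypeL.hasFDerivAt.comp_hasDerivWithinAt t (hx t ht).1

end Par

/-! ### Truncation errors -/

/-- The decay of `wt (1 - s)` beyond radius `N`. -/
def tl (s N : ℝ) : ℝ := (1 + (2 * Real.pi * N) ^ 2) ^ ((1 - s) / 2)

lemma tl_nonneg (s N : ℝ) : 0 ≤ tl s N := by unfold tl; positivity

lemma wt_le_tl {s N : ℝ} (hs : 1 ≤ s) (hN : 0 ≤ N) {ξ : Plane} (h : N ≤ ‖ξ‖) :
    wt (1 - s) ξ ≤ tl s N := by
  unfold wt tl
  refine Real.rpow_le_rpow_of_nonpos (by positivity) ?_ (by linarith)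
  gcongr

lemma tendsto_tl {s : ℝ} (hs : 1 < s) : Tendsto (tl s) atTop (𝓝 0) := by
  have h1 : Tendsto (fun N : ℝ => 1 + (2 * Real.pi * N) ^ 2) atTop atTop := by
    refine tendsto_atTop_add_const_left _ _ ((tendsto_pow_atTop two_ne_zero).comp ?_)
    exact Tendsto.const_mul_atTop (by positivity) tendsto_id
  have h2 := (tendsto_rpow_neg_atTop (y := (s - 1) / 2) (by linarith)).comp h1
  refine h2.congr fun N => ?_
  simp only [Function.comp, tl]
  congr 1; ring

lemma hs_prj_le (r N : ℝ) (f : HC) : hs r (mulL (rs (ch N)) f) ≤ hs r f := by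
  refine N2_mono ?_
  filter_upwards [mulL_coe (bdd_ch N) f] with ξ h
  rw [h, enorm_mul]
  gcongr
  refine mul_le_of_le_one_left' ?_
  rw [← ofReal_norm, norm_rs, abs_of_nonneg (ch_nonneg N ξ), ← ENNReal.ofReal_one]
  exact ENNReal.ofReal_le_ofReal (ch_le_one N ξ)

/-- Beyond radius N the s - 1 spare derivatives turn into the decay factor `tl s N`. -/
lemma hs_sub_prj_le {s N : ℝ} (hs1 : 1 ≤ s) (hN : 0 ≤ N) (f : HC) :
    hs 1 (f - mulL (rs (ch N)) f) ≤ ENNReal.ofReal (tl s N) * hs s f := by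
  unfold hs
  rw [← N2_const_mul _ ENNReal.ofReal_ne_top]
  refine N2_mono ?_
  filter_upwards [mulL_coe (bdd_ch N) f, Lp.coeFn_sub f (mulL (rs (ch N)) f)] with ξ h h'
  rw [h', Pi.sub_apply, h]
  rcases le_or_gt ‖ξ‖ N with h1 | h1
  · simp [rs, ch_of_le h1]
  · simp only [rs, ch_of_lt h1, Complex.ofReal_zero, zero_mul, sub_zero, ← mul_assoc]
    gcongr
    rw [show (1 : ℝ) = (1 - s) + s by ring, ewt_add]
    gcongr
    exact ENNReal.ofReal_le_ofReal (wt_le_tl hs1 hN h1.le)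

section TruncationError

variable {s C : ℝ} {w : Plane → ℝ}

lemma sqInt_sym_ch (hw : Measurable w) (hC : ∀ ξ, |w ξ| ≤ C) (N : ℝ) (j : Fin 2) :
    SqInt (sym j fun ξ => ch N ξ * w ξ) :=
  (adm_ch N).sqInt_sym hw hC j

lemma enorm_sym_ch_le (hC : ∀ ξ, |w ξ| ≤ C) (N : ℝ) (j : Fin 2) (ξ : Plane) :
    ‖sym j (fun ξ => ch N ξ * w ξ) ξ‖ₑ ≤ ENNReal.ofReal C * ewt 1 ξ := by
  have hC0 : 0 ≤ C := (abs_nonneg _).trans (hC 0)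
  rw [← ofReal_norm, norm_sym, ewt, ← ENNReal.ofReal_mul hC0]
  refine ENNReal.ofReal_le_ofReal ?_
  have h1 := abs_freq_le_wt j ξ
  have h2 := wt_pos 1 ξ
  have h3 := ch_nonneg N ξ
  rw [abs_mul, abs_of_nonneg h3]
  calc _ ≤ wt 1 ξ * (1 * C) := by gcongr; exacts [ch_le_one N ξ, hC ξ]
    _ = _ := by ring

/-- The product estimate `H^s × H^1 → H^1` for the truncated bilinear operators. -/
lemma enorm_convT_ch_le (hs1 : 1 ≤ s) (hw : Measurable w) (hC : ∀ ξ, |w ξ| ≤ C) (N : ℝ) (j : Fin 2)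
    (f g : HC) : ‖convT (sym j fun ξ => ch N ξ * w ξ) f g‖ₑ ≤
      ENNReal.ofReal C * (4 * wienerC s * hs s f * hs 1 g) := by
  refine (enorm_convT_le (sqInt_sym_ch hw hC N j) (enorm_sym_ch_le hC N j) f g).trans ?_
  simp_rw [mul_assoc (ENNReal.ofReal C)]
  rw [N2_const_mul _ ENNReal.ofReal_ne_top]
  gcongr
  exact N2_cv_wt_one_le hs1 f.measurable_enorm g.measurable_enorm

lemma enorm_convT_ch_le' (hs1 : 1 ≤ s) (hw : Measurable w) (hC : ∀ ξ, |w ξ| ≤ C) (N : ℝ)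
    (j : Fin 2) (f g : HC) : ‖convT (sym j fun ξ => ch N ξ * w ξ) f g‖ₑ ≤
      ENNReal.ofReal C * (4 * wienerC s * hs s g * hs 1 f) := by
  have e : convT (sym j fun ξ => ch N ξ * w ξ) f g = convT (sym j fun ξ => ch N ξ * w ξ) g f := by
    apply Lp.ext
    filter_upwards [convT_coe (sqInt_sym_ch hw hC N j) f g, convT_coe (sqInt_sym_ch hw hC N j) g f]
      with ξ h h'
    rw [h, h', conv_comm]
  rw [e]
  exact enorm_convT_ch_le hs1 hw hC N j g f

lemma N2_cv_ewt_le (hs0 : 0 ≤ s) (f g : HC) :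
    N2 (fun ξ => ewt s ξ * cv (fun ζ => ‖f ζ‖ₑ) (fun ζ => ‖g ζ‖ₑ) ξ) ≤
      ENNReal.ofReal (2 ^ s) * (2 * wienerC s * hs s f * hs s g) := by
  refine (N2_cv_weight_le (C := ENNReal.ofReal (2 ^ s)) ENNReal.ofReal_ne_top (measurable_ewt s)
    (fun ξ ζ => ?_) f.measurable_enorm g.measurable_enorm).trans ?_
  · have h1 := (wt_pos s ζ).le
    have h2 := (wt_pos s (ξ - ζ)).le
    rw [ewt, ewt, ewt, ← ENNReal.ofReal_mul (by positivity), ← ENNReal.ofReal_mul (by positivity),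
      ← ENNReal.ofReal_add (by positivity) (by positivity)]
    exact ENNReal.ofReal_le_ofReal (wt_quasi_add hs0 ξ ζ)
  · gcongr
    calc _ ≤ hs s f * (wienerC s * hs s g) + (wienerC s * hs s f) * hs s g := by
          gcongr
          · exact le_rfl
          · exact N1_le_hs' s g
          · exact N1_le_hs' s f
          · exact le_rfl
      _ = _ := by ring

/-- The two symbols agree below N. Above N the symbol costs one derivative of a product that lies in
H^s, which leaves the decay `wt (1 - s)`. -/
lemma enorm_convT_ch_sub_le (hs1 : 1 ≤ s) (hw : Measurable w) (hC : ∀ ξ, |w ξ| ≤ C) {N K : ℝ}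
    (hN : 0 ≤ N) (hK : N ≤ K) (j : Fin 2) (f g : HC) :
    ‖convT (sym j fun ξ => ch N ξ * w ξ) f g - convT (sym j fun ξ => ch K ξ * w ξ) f g‖ₑ ≤
      ENNReal.ofReal C * (ENNReal.ofReal (tl s N) *
        (ENNReal.ofReal (2 ^ s) * (2 * wienerC s * hs s f * hs s g))) := by
  rw [HC.enorm_eq]
  have hC0 : 0 ≤ C := (abs_nonneg _).trans (hC 0)
  calc _ ≤ N2 (fun ξ => ENNReal.ofReal C * (ENNReal.ofReal (tl s N) *
        (ewt s ξ * cv (fun ζ => ‖f ζ‖ₑ) (fun ζ => ‖g ζ‖ₑ) ξ))) := by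
        refine N2_mono ?_
        filter_upwards [convT_coe (sqInt_sym_ch hw hC N j) f g,
          convT_coe (sqInt_sym_ch hw hC K j) f g, Lp.coeFn_sub
            (convT (sym j fun ξ => ch N ξ * w ξ) f g) (convT (sym j fun ξ => ch K ξ * w ξ) f g)]
          with ξ h1 h2 h3
        rw [h3, Pi.sub_apply, h1, h2]
        rcases le_or_gt ‖ξ‖ N with h | h
        · simp [sym, ch_of_le h, ch_of_le (h.trans hK)]
        · have e : sym j (fun ξ => ch N ξ * w ξ) ξ = 0 := by simp [sym, ch_of_lt h]
          rw [e, zero_mul, zero_sub, enorm_neg, enorm_mul]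
          calc _ ≤ (ENNReal.ofReal C * ewt 1 ξ) * cv (fun ζ => ‖f ζ‖ₑ) (fun ζ => ‖g ζ‖ₑ) ξ := by
                gcongr
                exacts [enorm_sym_ch_le hC K j ξ, enorm_conv_le f g ξ]
            _ = ENNReal.ofReal C * (ewt (1 - s) ξ *
                (ewt s ξ * cv (fun ζ => ‖f ζ‖ₑ) (fun ζ => ‖g ζ‖ₑ) ξ)) := by
                rw [← mul_assoc (ewt (1 - s) ξ), ← ewt_add, sub_add_cancel, mul_assoc]
            _ ≤ _ := by
                gcongr
                exact ENNReal.ofReal_le_ofReal (wt_le_tl hs1 hN h.le)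
    _ = ENNReal.ofReal C * (ENNReal.ofReal (tl s N) *
        N2 (fun ξ => ewt s ξ * cv (fun ζ => ‖f ζ‖ₑ) (fun ζ => ‖g ζ‖ₑ) ξ)) := by
        rw [N2_const_mul _ ENNReal.ofReal_ne_top, N2_const_mul _ ENNReal.ofReal_ne_top]
    _ ≤ _ := by gcongr; exact N2_cv_ewt_le (by linarith) f g

/-- The constant in the bound of the truncation errors. -/
def truncC (s : ℝ) : ℝ := (8 + 2 * 2 ^ s) * (wienerC s).toReal

lemma truncC_nonneg (s : ℝ) : 0 ≤ truncC s := by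
  have : 0 ≤ (wienerC s).toReal := ENNReal.toReal_nonneg
  unfold truncC; positivity

/-- The error made by truncating both the arguments and the value of a bilinear operator. -/
lemma norm_trunc_error_le (hs1 : 1 < s) (hw : Measurable w) (hC : ∀ ξ, |w ξ| ≤ C) {N K : ℝ}
    (hN : 0 ≤ N) (hK : N ≤ K) (j : Fin 2) {f g : HC} {R : ℝ} (hR : 0 ≤ R)
    (hf : hs s f ≤ ENNReal.ofReal R) (hg : hs s g ≤ ENNReal.ofReal R) :
    ‖convT (sym j fun ξ => ch N ξ * w ξ) f g -
      convT (sym j fun ξ => ch K ξ * w ξ) (mulL (rs (ch N)) f) (mulL (rs (ch N)) g)‖ ≤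
      C * truncC s * R ^ 2 * tl s N := by
  have hC0 : 0 ≤ C := (abs_nonneg _).trans (hC 0)
  have ht := tl_nonneg s N
  set B := convT (sym j fun ξ => ch K ξ * w ξ)
  set f' := mulL (rs (ch N)) f
  set g' := mulL (rs (ch N)) g
  -- The outer cut-off is exchanged first; then the arguments are truncated one at a time.
  have e : convT (sym j fun ξ => ch N ξ * w ξ) f g - B f' g' =
      (convT (sym j fun ξ => ch N ξ * w ξ) f g - B f g) + (B (f - f') g + B f' (g - g')) := by
    simp only [map_sub, sub_apply]; abel
  have hf' : hs s f' ≤ ENNReal.ofReal R := (hs_prj_le s N f).trans hf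
  have key : ‖convT (sym j fun ξ => ch N ξ * w ξ) f g - B f' g'‖ₑ ≤
      ENNReal.ofReal C * (ENNReal.ofReal (tl s N) *
        (ENNReal.ofReal (2 ^ s) * (2 * wienerC s * ENNReal.ofReal R * ENNReal.ofReal R))) +
      (ENNReal.ofReal C * (4 * wienerC s * ENNReal.ofReal R *
        (ENNReal.ofReal (tl s N) * ENNReal.ofReal R)) +
      ENNReal.ofReal C * (4 * wienerC s * ENNReal.ofReal R *
        (ENNReal.ofReal (tl s N) * ENNReal.ofReal R))) := by
    rw [e]
    refine (enorm_add_le _ _).trans (add_le_add ?_ ((enorm_add_le _ _).trans (add_le_add ?_ ?_)))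
    · refine (enorm_convT_ch_sub_le hs1.le hw hC hN hK j f g).trans ?_
      gcongr
    · refine (enorm_convT_ch_le' hs1.le hw hC K j _ g).trans ?_
      gcongr
      exact (hs_sub_prj_le hs1.le hN f).trans (by gcongr)
    · refine (enorm_convT_ch_le hs1.le hw hC K j f' _).trans ?_
      gcongr
      exact (hs_sub_prj_le hs1.le hN g).trans (by gcongr)
  have hW := (wienerC_lt_top hs1).ne
  have h3 := ENNReal.toReal_mono (by finiteness) key
  rw [toReal_enorm, ENNReal.toReal_add (by finiteness) (by finiteness),
    ENNReal.toReal_add (by finiteness) (by finiteness)] at h3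
  simp only [ENNReal.toReal_mul, ENNReal.toReal_ofReal hC0, ENNReal.toReal_ofReal hR,
    ENNReal.toReal_ofReal ht, ENNReal.toReal_ofReal (by positivity : (0 : ℝ) ≤ 2 ^ s),
    ENNReal.toReal_ofNat] at h3
  refine h3.trans (le_of_eq ?_)
  rw [truncC]; ring

end TruncationError

/-! ### The energy of a difference of solutions -/

/-- Differences of solutions are measured with the trivial weight, that is, η in L² and v with
weight √em. -/
lemma isWeight_one : IsWeight 0 0 (fun _ => 1) where
  measurable := measurable_const
  le ξ := (wt_zero ξ).le
  dilates l _ ξ ζ _ := by simp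

lemma norm_prj_one {K : ℝ} {f : HC} (hf : Supp K f) : prj K (fun _ => 1) f = f := by
  simp only [prj, mul_one]
  exact hf

lemma enorm_prj_wt_one {K : ℝ} {f : HC} (hf : Supp K f) :
    ‖prj K (fun ξ => 1 * wt 1 ξ) f‖ₑ = hs 1 f := by
  simp_rw [one_mul]
  exact enorm_mulL_ch (continuous_wt 1).locBdd (fun ξ => (wt_pos 1 ξ).le) hf

lemma lintegral_comm_one_le {s : ℝ} (f a : HC) (j : Fin 2) :
    ∫⁻ ξ, ∫⁻ ζ, ‖(1 : ℝ) ^ 2 * freq j ξ - 1 ^ 2 * freq j ζ‖ₑ *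
      (‖f ξ‖ₑ * ‖f ζ‖ₑ * ‖a (ξ - ζ)‖ₑ) ≤ ‖f‖ₑ ^ 2 * (wienerC s * hs (s + 1) a) := by
  have hf := f.measurable_enorm
  have ha := a.measurable_enorm
  calc _ ≤ ∫⁻ ξ, ∫⁻ ζ, ‖f ξ‖ₑ * (ewt 1 (ξ - ζ) * ‖a (ξ - ζ)‖ₑ) * ‖f ζ‖ₑ := by
        refine lintegral_mono fun ξ => lintegral_mono fun ζ => ?_
        have h : ‖(1 : ℝ) ^ 2 * freq j ξ - 1 ^ 2 * freq j ζ‖ₑ ≤ ewt 1 (ξ - ζ) := by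
          rw [← ofReal_norm]
          refine ENNReal.ofReal_le_ofReal ?_
          refine le_trans (le_of_eq ?_) (abs_freq_le_wt j (ξ - ζ))
          rw [Real.norm_eq_abs]
          congr 1
          simp only [freq, PiLp.sub_apply]; ring
        calc _ ≤ ewt 1 (ξ - ζ) * (‖f ξ‖ₑ * ‖f ζ‖ₑ * ‖a (ξ - ζ)‖ₑ) := by gcongr
          _ = _ := by ring
    _ ≤ ‖f‖ₑ * (wienerC s * hs (s + 1) a) * ‖f‖ₑ := by
        refine (trilinear_N2_N1_N2 (A := fun ξ => ‖f ξ‖ₑ) (B := fun ξ => ewt 1 ξ * ‖a ξ‖ₑ)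
          (D := fun ξ => ‖f ξ‖ₑ) (by fun_prop) (by fun_prop) (by fun_prop)).trans ?_
        rw [← HC.enorm_eq]
        gcongr
        exact N1_le_hs s 1 a
    _ = _ := by ring

namespace Par

variable (p : Par)

/-- The `H^1` norm of the velocity in terms of the energy with trivial weight. -/
lemma hs_one_le {K : ℝ} {U : X} (hU : Good K U) (j : Fin 2) :
    hs 1 (U.2 j) ≤ ENNReal.ofReal ((√(p.lo * p.ε))⁻¹ * √(p.En (fun _ => 1) K U)) := by
  rw [← enorm_prj_wt_one (hU.supp_snd j), ← ofReal_norm]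
  refine ENNReal.ofReal_le_ofReal ((p.norm_prj_wt_le isWeight_one K (U.2 j)).trans ?_)
  gcongr
  exact p.norm_prj_snd_le _ K U j

/-- The weight of the quadratic term in the energy with trivial weight. -/
def wq (ξ : Plane) : ℝ := p.wv (fun _ => 1) ξ * (p.ε / 2 / p.de ξ)

lemma measurable_wq : Measurable p.wq :=
  (p.locBdd_wv isWeight_one.locBdd).1.mul (by fun_prop)

/-- From em ≤ (1 + a/c) de, with 1 + a/c and de both at least one, √em is at most (1 + a/c) de; the
division by de absorbs it. -/
lemma wq_le (ξ : Plane) : |p.wq ξ| ≤ 1 + p.a / p.c := by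
  have hac : 0 < p.a / p.c := div_pos_of_neg_of_neg p.ha p.hc
  have h1 := p.one_le_de ξ
  have h2 := p.em_div_de_le ξ
  have hε := p.hε
  have hε1 := p.hε1
  have hem := p.em_pos ξ
  have h3 : √(p.em ξ) ≤ (1 + p.a / p.c) * p.de ξ := by
    refine Real.sqrt_le_iff.2 ⟨by positivity, ?_⟩
    rw [div_le_iff₀ (by linarith)] at h2
    refine h2.trans ?_
    rw [sq]
    refine le_mul_of_one_le_left (by positivity) ?_
    nlinarith
  rw [wq, wv, one_mul, abs_of_nonneg (by positivity)]
  rw [← mul_div_assoc, div_le_iff₀ (by linarith)]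
  calc √(p.em ξ) * (p.ε / 2) ≤ ((1 + p.a / p.c) * p.de ξ) * 1 := by
        gcongr; linarith
    _ = _ := mul_one _

lemma prj_wv_convT {N K : ℝ} (h : N ≤ K) (i : Fin 2) (f g : HC) :
    prj K (p.wv fun _ => 1) (convT (sym i fun ξ => ch N ξ * (p.ε / 2 / p.de ξ)) f g) =
      convT (sym i fun ξ => ch N ξ * p.wq ξ) f g := by
  refine mulL_convT ((p.locBdd_wv isWeight_one.locBdd).bdd_ch K)
    (p.sqInt_de (adm_ch N) i) (sqInt_sym_ch p.measurable_wq p.wq_le N i) (fun ξ => ?_) f g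
  rw [rs_mul_sym, sym, sym, wq]
  congr 3
  linear_combination p.wv (fun _ => 1) ξ * (p.ε / 2 / p.de ξ) * ch_mul_ch h ξ

lemma prj_one_convT {N K : ℝ} (h : N ≤ K) (i : Fin 2) (f g : HC) :
    prj K (fun _ => 1) (convT (sym i fun ξ => ch N ξ * p.ε) f g) =
      convT (sym i fun ξ => ch N ξ * p.ε) f g := by
  refine mulL_convT (isWeight_one.locBdd.bdd_ch K)
    (p.sqInt_eps (adm_ch N) i) (p.sqInt_eps (adm_ch N) i) (fun ξ => ?_) f g
  rw [rs_mul_sym, sym, sym]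
  congr 3
  linear_combination p.ε * ch_mul_ch h ξ

lemma abs_eps_le (_ : Plane) : |p.ε| ≤ 1 := by rw [abs_of_pos p.hε]; exact p.hε1

/-- The truncation error of the vector field. -/
lemma F_sub_F_trunc {N K : ℝ} (h : N ≤ K) (U : X) :
    p.F (ch N) U - p.F (ch K) (mulX (ch N) U) =
      (∑ j, (convT (sym j fun ξ => ch N ξ * p.ε) U.1 (U.2 j) -
        convT (sym j fun ξ => ch K ξ * p.ε) (mulL (rs (ch N)) U.1) (mulL (rs (ch N)) (U.2 j))),
      fun i => ∑ j, (convT (sym i fun ξ => ch N ξ * (p.ε / 2 / p.de ξ)) (U.2 j) (U.2 j) -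
        convT (sym i fun ξ => ch K ξ * (p.ε / 2 / p.de ξ)) (mulL (rs (ch N)) (U.2 j))
          (mulL (rs (ch N)) (U.2 j)))) := by
  have e : ∀ (v : Plane → ℝ) (j : Fin 2) (ξ : Plane),
      sym j (fun ξ => ch K ξ * v ξ) ξ * rs (ch N) ξ = sym j (fun ξ => ch N ξ * v ξ) ξ := fun v j ξ => by
    rw [mul_comm, rs_mul_sym, sym, sym]
    congr 3
    linear_combination v ξ * ch_mul_ch h ξ
  refine X.ext ?_ fun i => ?_
  · simp only [F, Prod.fst_sub, mulX, liftX_fst, liftX_snd, Finset.sum_add_distrib,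
      Finset.sum_sub_distrib]
    have : ∀ j, mulL (sym j fun ξ => ch K ξ * p.al ξ) (mulL (rs (ch N)) (U.2 j)) =
        mulL (sym j fun ξ => ch N ξ * p.al ξ) (U.2 j) := fun j =>
      mulL_mulL (p.bdd_al (adm_ch K) j) (bdd_ch N) (p.bdd_al (adm_ch N) j) (e _ j) _
    simp_rw [this]
    abel
  · simp only [F, Prod.snd_sub, Pi.sub_apply, mulX, liftX_fst, liftX_snd, Finset.sum_sub_distrib]
    rw [mulL_mulL (p.bdd_be (adm_ch K) i) (bdd_ch N) (p.bdd_be (adm_ch N) i) (e _ i)]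
    abel

/-- The constant in the bound of the truncation error of the vector field. -/
def errC (s : ℝ) : ℝ := (2 + 4 * (1 + p.a / p.c)) * truncC s

lemma errC_nonneg (s : ℝ) : 0 ≤ p.errC s := by
  have hac : 0 < p.a / p.c := div_pos_of_neg_of_neg p.ha p.hc
  have := truncC_nonneg s
  unfold errC; positivity

lemma abs_dEn_err_le {s : ℝ} (hs1 : 1 < s) {N K : ℝ} (hN : 0 ≤ N) (hK : N ≤ K) (D : X) {U : X}
    {R : ℝ} (hR : 0 ≤ R) (h1 : hs s U.1 ≤ ENNReal.ofReal R)
    (h2 : ∀ j, hs s (U.2 j) ≤ ENNReal.ofReal R) :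
    |p.dEn (fun _ => 1) K D (p.F (ch N) U - p.F (ch K) (mulX (ch N) U))| ≤
      p.errC s * R ^ 2 * tl s N * √(p.En (fun _ => 1) K D) := by
  have hac : 0 < p.a / p.c := div_pos_of_neg_of_neg p.ha p.hc
  set y := √(p.En (fun _ => 1) K D) with hy
  set B := truncC s * R ^ 2 * tl s N with hB
  have b1 : ∀ j, ‖convT (sym j fun ξ => ch N ξ * p.ε) U.1 (U.2 j) -
        convT (sym j fun ξ => ch K ξ * p.ε) (mulL (rs (ch N)) U.1) (mulL (rs (ch N)) (U.2 j))‖ ≤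
        1 * B := fun j =>
    (norm_trunc_error_le hs1 measurable_const p.abs_eps_le hN hK j hR h1 (h2 j)).trans
      (le_of_eq (by ring))
  have b2 : ∀ i j, ‖convT (sym i fun ξ => ch N ξ * p.wq ξ) (U.2 j) (U.2 j) -
        convT (sym i fun ξ => ch K ξ * p.wq ξ) (mulL (rs (ch N)) (U.2 j))
          (mulL (rs (ch N)) (U.2 j))‖ ≤ (1 + p.a / p.c) * B := fun i j =>
    (norm_trunc_error_le hs1 p.measurable_wq p.wq_le hN hK i hR (h2 j) (h2 j)).trans
      (le_of_eq (by ring))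
  rw [F_sub_F_trunc p hK, dEn]
  simp only [map_sum, map_sub, prj_one_convT p hK, prj_one_convT p le_rfl, prj_wv_convT p hK,
    prj_wv_convT p le_rfl, inner_sum]
  have c1 : ∀ j, |inner ℝ (prj K (fun _ => 1) D.1) (convT (sym j fun ξ => ch N ξ * p.ε) U.1 (U.2 j) -
        convT (sym j fun ξ => ch K ξ * p.ε) (mulL (rs (ch N)) U.1) (mulL (rs (ch N)) (U.2 j)))| ≤
      y * (1 * B) := fun j =>
    (abs_real_inner_le_norm _ _).trans (mul_le_mul (p.norm_prj_fst_le _ K D) (b1 j) (norm_nonneg _)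
      (Real.sqrt_nonneg _))
  have c2 : ∀ i j, |inner ℝ (prj K (p.wv fun _ => 1) (D.2 i))
        (convT (sym i fun ξ => ch N ξ * p.wq ξ) (U.2 j) (U.2 j) -
        convT (sym i fun ξ => ch K ξ * p.wq ξ) (mulL (rs (ch N)) (U.2 j))
          (mulL (rs (ch N)) (U.2 j)))| ≤ y * ((1 + p.a / p.c) * B) := fun i j =>
    (abs_real_inner_le_norm _ _).trans (mul_le_mul (p.norm_prj_snd_le _ K D i) (b2 i j)
      (norm_nonneg _) (Real.sqrt_nonneg _))
  refine (abs_add_le _ _).trans ?_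
  refine (add_le_add (Finset.abs_sum_le_sum_abs _ _) (Finset.abs_sum_le_sum_abs _ _)).trans ?_
  refine (add_le_add (Finset.sum_le_sum fun j _ => c1 j) (Finset.sum_le_sum fun i _ =>
    (Finset.abs_sum_le_sum_abs _ _).trans (Finset.sum_le_sum fun j _ => c2 i j))).trans ?_
  simp only [Finset.sum_const, Finset.card_univ, Fintype.card_fin, nsmul_eq_mul]
  refine le_of_eq ?_
  rw [errC, hB]; push_cast; ring

/-- The constant in the energy estimate for differences. -/
def diffC (s : ℝ) : ℝ :=
  (wienerC s).toReal + 8 * (wienerC s).toReal * (√(p.lo * p.ε))⁻¹ +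
    32 * (1 + p.a / p.c) * (wienerC s).toReal * (√(p.lo * p.ε))⁻¹

lemma diffC_nonneg (s : ℝ) : 0 ≤ p.diffC s := by
  have hac : 0 < p.a / p.c := div_pos_of_neg_of_neg p.ha p.hc
  have hw : 0 ≤ (wienerC s).toReal := ENNReal.toReal_nonneg
  unfold diffC; positivity

/-- Each bilinear difference is split as B(D, U) + B(V, D). The transport of D.1 by U.2 is handled
by the commutator. In the other terms the derivative meets D.2, whose H^1 norm the energy controls
at the price ε^(-1/2); this is harmless, as ε is fixed here. -/
lemma dEn_sub_le {s : ℝ} (hs1 : 1 < s) {K : ℝ} {U V : X} (hU : Good K U) (hV : Good K V)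
    {R : ℝ} (hR : 0 ≤ R) (hU2 : ∀ j, hs (s + 1) (U.2 j) ≤ ENNReal.ofReal R)
    (hV1 : hs s V.1 ≤ ENNReal.ofReal R) (hV2 : ∀ j, hs (s + 1) (V.2 j) ≤ ENNReal.ofReal R) :
    p.dEn (fun _ => 1) K (U - V) (p.F (ch K) U - p.F (ch K) V) ≤
      p.diffC s * R * p.En (fun _ => 1) K (U - V) := by
  have hac : 0 < p.a / p.c := div_pos_of_neg_of_neg p.ha p.hc
  have hw : 0 ≤ (wienerC s).toReal := ENNReal.toReal_nonneg
  have hW := (wienerC_lt_top hs1).ne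
  set D := U - V with hDdef
  have hD : Good K D := (goodSub K).sub_mem hU hV
  set y := √(p.En (fun _ => 1) K D) with hy
  have hyy : y ^ 2 = p.En (fun _ => 1) K D := Real.sq_sqrt (p.En_nonneg _ K D)
  have hy0 : 0 ≤ y := Real.sqrt_nonneg _
  set l := (√(p.lo * p.ε))⁻¹ with hl
  have hl0 : 0 ≤ l := by positivity
  have hD1 : ∀ j, hs 1 (D.2 j) ≤ ENNReal.ofReal (l * y) := p.hs_one_le hD
  have h2s : ∀ f : HC, hs (s + 1) f ≤ ENNReal.ofReal R → hs s f ≤ ENNReal.ofReal R := fun f hf =>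
    (hs_mono (by linarith) f).trans hf
  have t1 : ∀ j, |inner ℝ (prj K (fun _ => 1) D.1)
      (prj K (fun _ => 1) (convT (sym j fun ξ => ch K ξ * p.ε) D.1 (U.2 j)))| ≤
      1 / 2 * ((wienerC s).toReal * R * y ^ 2) := fun j => by
    have h1 := (comm_bound isWeight_one.locBdd hD.supp_fst (hU.refl_snd j) j p.hε.le).trans
      (mul_le_mul_right (lintegral_comm_one_le (s := s) D.1 (U.2 j) j) _)
    have h2 : ENNReal.ofReal p.ε * (‖D.1‖ₑ ^ 2 * (wienerC s * hs (s + 1) (U.2 j))) ≤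
        ENNReal.ofReal 1 * (‖D.1‖ₑ ^ 2 * (wienerC s * ENNReal.ofReal R)) := by
      gcongr
      exacts [p.hε1, hU2 j]
    have h3 := ENNReal.toReal_mono (by finiteness) (h1.trans h2)
    rw [ENNReal.toReal_ofReal (by positivity)] at h3
    have h4 : ‖D.1‖ ≤ y := by
      have := p.norm_prj_fst_le (fun _ => 1) K D
      rwa [norm_prj_one hD.supp_fst] at this
    simp only [ENNReal.toReal_mul, ENNReal.toReal_pow, toReal_enorm, ENNReal.toReal_ofReal hR,
      ENNReal.ofReal_one, one_mul] at h3
    have h5 : ‖D.1‖ ^ 2 * ((wienerC s).toReal * R) ≤ y ^ 2 * ((wienerC s).toReal * R) := by gcongr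
    linarith
  have tB : ∀ (w : Plane → ℝ) (C : ℝ) (i j : Fin 2) (f : HC), Measurable w → (∀ ξ, |w ξ| ≤ C) →
      hs s f ≤ ENNReal.ofReal R →
      ‖convT (sym i fun ξ => ch K ξ * w ξ) f (D.2 j)‖ ≤ C * (4 * (wienerC s).toReal * R * (l * y)) ∧
      ‖convT (sym i fun ξ => ch K ξ * w ξ) (D.2 j) f‖ ≤
        C * (4 * (wienerC s).toReal * R * (l * y)) := fun w C i j f hwm hC hf => by
    have hC0 : 0 ≤ C := (abs_nonneg _).trans (hC 0)
    have hfin : ENNReal.ofReal C * (4 * wienerC s * hs s f * hs 1 (D.2 j)) ≤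
        ENNReal.ofReal C * (4 * wienerC s * ENNReal.ofReal R * ENNReal.ofReal (l * y)) := by
      gcongr; exact hD1 j
    have g1 := ENNReal.toReal_mono (by finiteness)
      ((enorm_convT_ch_le hs1.le hwm hC K i f (D.2 j)).trans hfin)
    have g2 := ENNReal.toReal_mono (by finiteness)
      ((enorm_convT_ch_le' hs1.le hwm hC K i (D.2 j) f).trans hfin)
    simp only [ENNReal.toReal_mul, toReal_enorm, ENNReal.toReal_ofReal hR,
      ENNReal.toReal_ofReal hC0, ENNReal.toReal_ofReal (mul_nonneg hl0 hy0),
      ENNReal.toReal_ofNat] at g1 g2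
    exact ⟨g1, g2⟩
  have t2 : ∀ j, |inner ℝ (prj K (fun _ => 1) D.1)
      (prj K (fun _ => 1) (convT (sym j fun ξ => ch K ξ * p.ε) V.1 (D.2 j)))| ≤
      y * (1 * (4 * (wienerC s).toReal * R * (l * y))) := fun j => by
    rw [prj_one_convT p le_rfl]
    exact (abs_real_inner_le_norm _ _).trans (mul_le_mul (p.norm_prj_fst_le _ K D)
      (tB _ 1 j j V.1 measurable_const p.abs_eps_le hV1).1 (norm_nonneg _) hy0)
  have t3 : ∀ i j, |inner ℝ (prj K (p.wv fun _ => 1) (D.2 i))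
      (prj K (p.wv fun _ => 1) (convT (sym i fun ξ => ch K ξ * (p.ε / 2 / p.de ξ)) (D.2 j) (U.2 j)))| ≤
      y * ((1 + p.a / p.c) * (4 * (wienerC s).toReal * R * (l * y))) := fun i j => by
    rw [prj_wv_convT p le_rfl]
    exact (abs_real_inner_le_norm _ _).trans (mul_le_mul (p.norm_prj_snd_le _ K D i)
      (tB _ _ i j (U.2 j) p.measurable_wq p.wq_le (h2s _ (hU2 j))).2 (norm_nonneg _) hy0)
  have t4 : ∀ i j, |inner ℝ (prj K (p.wv fun _ => 1) (D.2 i))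
      (prj K (p.wv fun _ => 1) (convT (sym i fun ξ => ch K ξ * (p.ε / 2 / p.de ξ)) (V.2 j) (D.2 j)))| ≤
      y * ((1 + p.a / p.c) * (4 * (wienerC s).toReal * R * (l * y))) := fun i j => by
    rw [prj_wv_convT p le_rfl]
    exact (abs_real_inner_le_norm _ _).trans (mul_le_mul (p.norm_prj_snd_le _ K D i)
      (tB _ _ i j (V.2 j) p.measurable_wq p.wq_le (h2s _ (hV2 j))).1 (norm_nonneg _) hy0)
  have hlin := fun j => p.dEn_linear isWeight_one.locBdd K D.1 (D.2 j) j
  have eB : ∀ (m : Plane → ℂ) (f g f' g' : HC), convT m f g - convT m f' g' =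
      convT m (f - f') g + convT m f' (g - g') := fun m f g f' g' => by
    simp only [map_sub, sub_apply]; abel
  have eF : p.F (ch K) U - p.F (ch K) V =
      (∑ j, (mulL (sym j fun ξ => ch K ξ * p.al ξ) (D.2 j) +
        (convT (sym j fun ξ => ch K ξ * p.ε) D.1 (U.2 j) +
          convT (sym j fun ξ => ch K ξ * p.ε) V.1 (D.2 j))),
      fun i => mulL (sym i fun ξ => ch K ξ * p.be ξ) D.1 +
        ∑ j, (convT (sym i fun ξ => ch K ξ * (p.ε / 2 / p.de ξ)) (D.2 j) (U.2 j) +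
          convT (sym i fun ξ => ch K ξ * (p.ε / 2 / p.de ξ)) (V.2 j) (D.2 j))) := by
    refine X.ext ?_ fun i => ?_
    · simp only [F, hDdef, Prod.fst_sub, Prod.snd_sub, Pi.sub_apply, ← Finset.sum_sub_distrib]
      refine Finset.sum_congr rfl fun j _ => ?_
      rw [← eB, map_sub]; abel
    · simp only [F, hDdef, Prod.fst_sub, Prod.snd_sub, Pi.sub_apply]
      simp_rw [← eB]
      rw [map_sub, Finset.sum_sub_distrib]
      abel
  have e : p.dEn (fun _ => 1) K D (p.F (ch K) U - p.F (ch K) V) =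
      ∑ j, (inner ℝ (prj K (fun _ => 1) D.1)
          (prj K (fun _ => 1) (mulL (sym j fun ξ => ch K ξ * p.al ξ) (D.2 j))) +
        inner ℝ (prj K (p.wv fun _ => 1) (D.2 j))
          (prj K (p.wv fun _ => 1) (mulL (sym j fun ξ => ch K ξ * p.be ξ) D.1))) +
      ((∑ j, (inner ℝ (prj K (fun _ => 1) D.1)
          (prj K (fun _ => 1) (convT (sym j fun ξ => ch K ξ * p.ε) D.1 (U.2 j))) +
        inner ℝ (prj K (fun _ => 1) D.1)
          (prj K (fun _ => 1) (convT (sym j fun ξ => ch K ξ * p.ε) V.1 (D.2 j))))) +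
      ∑ i, ∑ j, (inner ℝ (prj K (p.wv fun _ => 1) (D.2 i)) (prj K (p.wv fun _ => 1)
        (convT (sym i fun ξ => ch K ξ * (p.ε / 2 / p.de ξ)) (D.2 j) (U.2 j))) +
        inner ℝ (prj K (p.wv fun _ => 1) (D.2 i)) (prj K (p.wv fun _ => 1)
        (convT (sym i fun ξ => ch K ξ * (p.ε / 2 / p.de ξ)) (V.2 j) (D.2 j))))) := by
    rw [eF]
    simp only [dEn, map_add, map_sum, inner_add_right, inner_sum, Finset.sum_add_distrib]
    ring
  rw [e, Finset.sum_eq_zero fun j _ => hlin j, zero_add]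
  have h1 := Finset.sum_le_sum fun j (_ : j ∈ Finset.univ) =>
    add_le_add ((le_abs_self _).trans (t1 j)) ((le_abs_self _).trans (t2 j))
  have h2 := Finset.sum_le_sum fun i (_ : i ∈ Finset.univ) =>
    Finset.sum_le_sum fun j (_ : j ∈ Finset.univ) =>
      add_le_add ((le_abs_self _).trans (t3 i j)) ((le_abs_self _).trans (t4 i j))
  simp only [Finset.sum_const, Finset.card_univ, Fintype.card_fin, nsmul_eq_mul] at h1 h2
  push_cast at h1 h2
  refine (add_le_add h1 h2).trans (le_of_eq ?_)
  rw [← hyy, diffC, ← hl]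
  ring

end Par

/-! ### Stability -/

lemma le_mul_exp_of_deriv_le {φ φ' : ℝ → ℝ} {κ b T : ℝ}
    (hd : ∀ t ∈ Icc 0 T, HasDerivWithinAt φ (φ' t) (Icc 0 T) t)
    (hle : ∀ t ∈ Icc 0 T, φ' t ≤ κ * (φ t + b)) :
    ∀ t ∈ Icc 0 T, φ t + b ≤ (φ 0 + b) * Real.exp (κ * t) := by
  intro t ht
  have := le_gronwallBound_of_liminf_deriv_right_le (f := fun t => φ t + b) (f' := φ') (a := 0)
    (b := T) (δ := φ 0 + b) (K := κ) (ε := 0)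
    (fun t ht => ((hd t ht).add_const b).continuousWithinAt)
    (fun t ht r hr => (((hd t (Ico_subset_Icc_self ht)).mono_of_mem_nhdsWithin
      (Filter.mem_of_superset (Icc_mem_nhdsGE ht.2)
        (Icc_subset_Icc_left ht.1))).add_const b).liminf_right_slope_le hr) le_rfl
    (fun t ht => by simpa using hle t (Ico_subset_Icc_self ht)) t ht
  simpa [gronwallBound_ε0] using this

/-- Bounded solutions of the system whose frequencies above `N` need not solve anything. -/
structure TruncSol (p : Par) (s T R N : ℝ) (U : ℝ → X) : Prop where
  herm : ∀ t ∈ Icc 0 T, liftX refl (U t) = U t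
  fst_le : ∀ t ∈ Icc 0 T, hs s (U t).1 ≤ ENNReal.ofReal R
  snd_le : ∀ t ∈ Icc 0 T, ∀ j, hs (s + 1) ((U t).2 j) ≤ ENNReal.ofReal R
  deriv : ∀ t ∈ Icc 0 T,
    HasDerivWithinAt (fun τ => mulX (ch N) (U τ)) (p.F (ch N) (U t)) (Icc 0 T) t

lemma good_mulX_ch {U : X} (h : liftX refl U = U) (N : ℝ) : Good N (mulX (ch N) U) := by
  have e : liftX refl (mulX (ch N) U) = mulX (ch N) U := by
    have h1 : ∀ f : HC, refl (mulL (rs (ch N)) f) = mulL (rs (ch N)) (refl f) := fun f =>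
      refl_mulL (bdd_ch N) (fun ξ => by simp [rs, ch_neg]) f
    conv_rhs => rw [← h]
    exact X.ext (h1 _) fun i => h1 _
  exact ⟨supp_mulL N _, fun j => supp_mulL N _, e⟩

lemma Good.mono {N M : ℝ} (hNM : N ≤ M) {U : X} (h : Good N U) : Good M U :=
  ⟨h.supp_fst.mono hNM, fun j => (h.supp_snd j).mono hNM, h.herm⟩

lemma hs_prj_sub_prj_le {s N M R : ℝ} (hs1 : 1 ≤ s) (hN : 0 ≤ N) (hM : 0 ≤ M) {f : HC}
    (hf : hs s f ≤ ENNReal.ofReal R) :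
    hs 1 (mulL (rs (ch N)) f - mulL (rs (ch M)) f) ≤ ENNReal.ofReal ((tl s N + tl s M) * R) := by
  have e : mulL (rs (ch N)) f - mulL (rs (ch M)) f =
      (f - mulL (rs (ch M)) f) - (f - mulL (rs (ch N)) f) := by abel
  rw [e, add_mul, add_comm]
  have h1 := tl_nonneg s N
  have h2 := tl_nonneg s M
  refine (hs_sub_le _ _ _).trans ?_
  rcases le_or_gt 0 R with hR | hR
  · rw [ENNReal.ofReal_add (by positivity) (by positivity), ENNReal.ofReal_mul h1,
      ENNReal.ofReal_mul h2]
    exact add_le_add ((hs_sub_prj_le hs1 hM f).trans (by gcongr))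
      ((hs_sub_prj_le hs1 hN f).trans (by gcongr))
  · rw [ENNReal.ofReal_of_nonpos hR.le] at hf
    have h3 := (hs_sub_prj_le hs1 hM f).trans (mul_le_mul_right hf _)
    have h4 := (hs_sub_prj_le hs1 hN f).trans (mul_le_mul_right hf _)
    rw [mul_zero] at h3 h4
    exact (add_le_add h3 h4).trans (by simp)

namespace Par

variable (p : Par)

lemma norm_prj_wv_le {K : ℝ} {f : HC} (hf : Supp K f) {B : ℝ}
    (h : hs 1 f ≤ ENNReal.ofReal B) (hB : 0 ≤ B) :
    ‖prj K (p.wv fun _ => 1) f‖ ≤ √p.hi * B := by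
  have h1 : ‖prj K (p.wv fun _ => 1) f‖ ≤ √p.hi * ‖prj K (fun ξ => 1 * wt 1 ξ) f‖ := by
    refine norm_mulL_le ((p.locBdd_wv isWeight_one.locBdd).bdd_ch K)
      ((isWeight_one.locBdd.mul (continuous_wt 1).locBdd).bdd_ch K) (fun ξ => ?_) f
    have h2 := ch_nonneg K ξ
    have h3 := wt_pos 1 ξ
    have h4 : √(p.em ξ) ≤ √p.hi * wt 1 ξ := by
      refine Real.sqrt_le_iff.2 ⟨by positivity, ?_⟩
      rw [mul_pow, Real.sq_sqrt p.hi_pos.le, wt_one_sq, ← wt_two]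
      exact (p.em_le ξ).trans (mul_le_mul_of_nonneg_left (p.one_add_eps_le ξ) p.hi_pos.le)
    rw [norm_rs, norm_rs, wv, abs_of_nonneg (by positivity), abs_of_nonneg (by positivity)]
    calc ch K ξ * (1 * √(p.em ξ)) ≤ ch K ξ * (1 * (√p.hi * wt 1 ξ)) := by gcongr
      _ = _ := by ring
  refine h1.trans ?_
  gcongr
  rw [← enorm_prj_wt_one hf, ← ofReal_norm] at h
  exact (ENNReal.ofReal_le_ofReal_iff hB).1 h

/-- Bounded solutions depend on the truncation and on the data in a controlled way. -/
theorem stability {s : ℝ} (hs1 : 1 < s) {T R : ℝ} (hR : 0 ≤ R) :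
    ∃ L : ℝ, ∀ (N M : ℝ) (U V : ℝ → X) (W : X), 0 ≤ N → 0 ≤ M →
      TruncSol p s T R N U → TruncSol p s T R M V →
      hs s W.1 ≤ ENNReal.ofReal R → (∀ j, hs s (W.2 j) ≤ ENNReal.ofReal R) →
      mulX (ch N) (U 0) = mulX (ch N) W → mulX (ch M) (V 0) = mulX (ch M) W →
      ∀ t ∈ Icc 0 T, ‖mulX (ch N) (U t) - mulX (ch M) (V t)‖ ≤ L * (tl s N + tl s M) := by
  set κ := 2 * (p.diffC s * R) + p.errC s * R ^ 2 with hκ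
  set A := ((1 + 2 * p.hi) * R ^ 2 + 1) * Real.exp (κ * T) with hA
  have he := p.errC_nonneg s
  have hd := p.diffC_nonneg s
  have hh := p.hi_pos
  have hκ0 : 0 ≤ κ := by positivity
  -- Gronwall gives energy at most A (`tl s N` + `tl s M`)², and `norm_le_of_En_le` converts this
  -- into a norm bound.
  refine ⟨max (√A) ((√p.lo)⁻¹ * √A), fun N M U V W hN hM hU hV hW1 hW2 hU0 hV0 t ht => ?_⟩
  set K := max N M
  have hNK : N ≤ K := le_max_left _ _
  have hMK : M ≤ K := le_max_right _ _
  set τ := tl s N + tl s M with hτ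
  have hτ0 : 0 ≤ τ := add_nonneg (tl_nonneg s N) (tl_nonneg s M)
  set D : ℝ → X := fun t => mulX (ch N) (U t) - mulX (ch M) (V t) with hD
  have hgU : ∀ t ∈ Icc 0 T, Good K (mulX (ch N) (U t)) := fun t ht =>
    (good_mulX_ch (hU.herm t ht) N).mono hNK
  have hgV : ∀ t ∈ Icc 0 T, Good K (mulX (ch M) (V t)) := fun t ht =>
    (good_mulX_ch (hV.herm t ht) M).mono hMK
  have hgD : ∀ t ∈ Icc 0 T, Good K (D t) := fun t ht =>
    (goodSub K).sub_mem (hgU t ht) (hgV t ht)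
  have hs2 : ∀ f : HC, hs (s + 1) f ≤ ENNReal.ofReal R → hs s f ≤ ENNReal.ofReal R := fun f hf =>
    (hs_mono (by linarith) f).trans hf
  have hder : ∀ t ∈ Icc 0 T, HasDerivWithinAt (fun t => p.En (fun _ => 1) K (D t))
      (2 * p.dEn (fun _ => 1) K (D t) (p.F (ch N) (U t) - p.F (ch M) (V t))) (Icc 0 T) t :=
    fun t ht => p.hasDerivWithinAt_En ((hU.deriv t ht).sub (hV.deriv t ht))
  have hle : ∀ t ∈ Icc 0 T,
      2 * p.dEn (fun _ => 1) K (D t) (p.F (ch N) (U t) - p.F (ch M) (V t)) ≤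
      κ * (p.En (fun _ => 1) K (D t) + τ ^ 2) := fun t ht => by
    -- Both truncated states are viewed in the larger ball of radius K. There they solve one and the
    -- same truncated system up to the two truncation errors.
    have e : p.F (ch N) (U t) - p.F (ch M) (V t) =
        (p.F (ch K) (mulX (ch N) (U t)) - p.F (ch K) (mulX (ch M) (V t))) +
        ((p.F (ch N) (U t) - p.F (ch K) (mulX (ch N) (U t))) -
        (p.F (ch M) (V t) - p.F (ch K) (mulX (ch M) (V t)))) := by abel
    have eadd : ∀ A B C : X, p.dEn (fun _ => 1) K (D t) (A + (B - C)) =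
        p.dEn (fun _ => 1) K (D t) A + (p.dEn (fun _ => 1) K (D t) B -
          p.dEn (fun _ => 1) K (D t) C) := fun A B C => by
      simp only [dEn, Prod.fst_add, Prod.snd_add, Prod.fst_sub, Prod.snd_sub, Pi.add_apply,
        Pi.sub_apply, map_add, map_sub, inner_add_right, inner_sub_right, Finset.sum_add_distrib,
        Finset.sum_sub_distrib]
      ring
    have h1 := p.dEn_sub_le hs1 (hgU t ht) (hgV t ht) hR
      (fun j => (hs_prj_le _ N _).trans (hU.snd_le t ht j))
      ((hs_prj_le _ M _).trans (hV.fst_le t ht))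
      (fun j => (hs_prj_le _ M _).trans (hV.snd_le t ht j))
    have h2 := (le_abs_self _).trans (p.abs_dEn_err_le hs1 hN hNK (D t) hR (hU.fst_le t ht)
      (fun j => hs2 _ (hU.snd_le t ht j)))
    have h3 := (neg_abs_le _).trans' (neg_le_neg (p.abs_dEn_err_le hs1 hM hMK (D t) hR
      (hV.fst_le t ht) (fun j => hs2 _ (hV.snd_le t ht j))))
    have h4 := Real.sq_sqrt (p.En_nonneg (fun _ => 1) K (D t))
    set y := √(p.En (fun _ => 1) K (D t))
    -- The source is linear in y, the root of the energy. The arithmetic–geometric mean inequality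
    -- absorbs it into energy + τ², the quantity in Gronwall's inequality.
    have h5 : 2 * (p.errC s * R ^ 2 * τ * y) ≤ p.errC s * R ^ 2 * (τ ^ 2 + y ^ 2) := by
      have := two_mul_le_add_sq τ y
      calc _ = p.errC s * R ^ 2 * (2 * τ * y) := by ring
        _ ≤ _ := by gcongr
    have h6 : 0 ≤ 2 * (p.diffC s * R) * τ ^ 2 := by positivity
    rw [e, eadd, hκ]
    rw [← h4] at h1 ⊢
    rw [hτ] at h5 h6 ⊢
    linarith
  have hE0 : p.En (fun _ => 1) K (D 0) ≤ (1 + 2 * p.hi) * R ^ 2 * τ ^ 2 := by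
    have h0 : (0 : ℝ) ∈ Icc 0 T := ⟨le_rfl, ht.1.trans ht.2⟩
    have hg0 := hgD 0 h0
    -- Both solutions start from truncations of the same W, so the initial difference consists of
    -- tails of W only.
    have eD : D 0 = mulX (ch N) W - mulX (ch M) W := by rw [hD]; simp only [hU0, hV0]
    have h1 : ‖prj K (fun _ => 1) (D 0).1‖ ≤ τ * R := by
      rw [norm_prj_one hg0.supp_fst, eD]
      have := (norm_le_hs zero_le_one _).trans (hs_prj_sub_prj_le hs1.le hN hM hW1)
      rw [← ofReal_norm] at this
      exact (ENNReal.ofReal_le_ofReal_iff (by positivity)).1 this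
    have h2 : ∀ j, ‖prj K (p.wv fun _ => 1) ((D 0).2 j)‖ ≤ √p.hi * (τ * R) := fun j => by
      refine p.norm_prj_wv_le (hg0.supp_snd j) ?_ (by positivity)
      rw [eD]
      exact hs_prj_sub_prj_le hs1.le hN hM (hW2 j)
    have h3 : ∀ j, ‖prj K (p.wv fun _ => 1) ((D 0).2 j)‖ ^ 2 ≤ p.hi * (τ * R) ^ 2 := fun j => by
      have := pow_le_pow_left₀ (norm_nonneg _) (h2 j) 2
      rwa [mul_pow, Real.sq_sqrt hh.le] at this
    have h4 := pow_le_pow_left₀ (norm_nonneg _) h1 2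
    have h5 := Finset.sum_le_sum fun j (_ : j ∈ Finset.univ) => h3 j
    simp only [Finset.sum_const, Finset.card_univ, Fintype.card_fin, nsmul_eq_mul] at h5
    push_cast at h5
    rw [En]
    linarith
  have key := le_mul_exp_of_deriv_le (b := τ ^ 2) hder hle t ht
  have hfin : p.En (fun _ => 1) K (D t) ≤ A * τ ^ 2 := by
    have h1 : Real.exp (κ * t) ≤ Real.exp (κ * T) := by gcongr; exact ht.2
    calc p.En (fun _ => 1) K (D t) ≤ p.En (fun _ => 1) K (D t) + τ ^ 2 := by
          linarith [sq_nonneg τ]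
      _ ≤ _ := key
      _ ≤ ((1 + 2 * p.hi) * R ^ 2 * τ ^ 2 + τ ^ 2) * Real.exp (κ * T) := by gcongr
      _ = _ := by rw [hA]; ring
  refine (p.norm_le_of_En_le le_rfl isWeight_one (hgD t ht) hfin).trans (le_of_eq ?_)
  rw [Real.sqrt_mul (by positivity), Real.sqrt_sq hτ0, max_mul_of_nonneg _ _ hτ0]
  ring_nf

end Par

/-! ### Existence and uniqueness on the Fourier side -/

lemma tendsto_N2_of_dominated {F : ℕ → Plane → ENNReal} {G : Plane → ENNReal}
    (hF : ∀ n, Measurable (F n)) (hG : N2 G < ⊤) (hle : ∀ n, ∀ᵐ ξ, F n ξ ≤ G ξ)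
    (hlim : ∀ᵐ ξ, Tendsto (fun n => F n ξ) atTop (𝓝 0)) :
    Tendsto (fun n => N2 (F n)) atTop (𝓝 0) := by
  have hfin : ∫⁻ ξ, G ξ ^ (2 : ℝ) ≠ ⊤ := by
    rw [← N2_sq]; exact (ENNReal.rpow_lt_top_of_nonneg zero_le_two hG.ne).ne
  have h1 := tendsto_lintegral_of_dominated_convergence (μ := (volume : Measure Plane))
    (F := fun n ξ => F n ξ ^ (2 : ℝ)) (f := fun _ => 0) (fun ξ => G ξ ^ (2 : ℝ))
    (fun n => (hF n).pow_const _) (fun n => (hle n).mono fun ξ h => ENNReal.rpow_le_rpow h zero_le_two) hfin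
    (hlim.mono fun ξ h => by
      have := (ENNReal.continuous_rpow_const (y := (2 : ℝ))).tendsto 0 |>.comp h
      simpa [Function.comp_def] using this)
  rw [lintegral_zero] at h1
  have h2 := (ENNReal.continuous_rpow_const (y := (1 / 2 : ℝ))).tendsto 0 |>.comp h1
  simpa [N2, Function.comp_def] using h2

lemma tendsto_prj (f : HC) : Tendsto (fun n : ℕ => mulL (rs (ch n)) f) atTop (𝓝 f) := by
  rw [tendsto_iff_edist_tendsto_0]
  have e : ∀ n : ℕ, edist (mulL (rs (ch n)) f) f = N2 (fun ξ => ‖rs (ch n) ξ * f ξ - f ξ‖ₑ) := by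
    intro n
    rw [edist_eq_enorm_sub, HC.enorm_eq]
    refine N2_congr ?_
    filter_upwards [Lp.coeFn_sub (mulL (rs (ch n)) f) f, mulL_coe (bdd_ch n) f] with ξ h1 h2
    rw [h1, Pi.sub_apply, h2]
  simp_rw [e]
  have hf := f.measurable
  refine tendsto_N2_of_dominated (G := fun ξ => ‖f ξ‖ₑ) (fun n => by fun_prop) f.N2_lt_top
    (fun n => Eventually.of_forall fun ξ => ?_) (Eventually.of_forall fun ξ => ?_)
  · rcases le_or_gt ‖ξ‖ n with h | h
    · simp [rs, ch_of_le h]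
    · simp [rs, ch_of_lt h]
  · refine tendsto_const_nhds.congr' ?_
    filter_upwards [eventually_ge_atTop ⌈‖ξ‖⌉₊] with n hn
    have h : ‖ξ‖ ≤ n := (Nat.le_ceil _).trans (by exact_mod_cast hn)
    simp [rs, ch_of_le h]

lemma tendsto_mulX_ch (U : X) : Tendsto (fun n : ℕ => mulX (ch n) U) atTop (𝓝 U) := by
  refine Tendsto.prodMk_nhds (tendsto_prj U.1) ?_
  rw [tendsto_pi_nhds]
  exact fun i => tendsto_prj (U.2 i)

lemma norm_mulX_ch_le (N : ℝ) (U : X) : ‖mulX (ch N) U‖ ≤ ‖U‖ := by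
  have h : ∀ f : HC, ‖mulL (rs (ch N)) f‖ ≤ ‖f‖ := fun f => by
    have := hs_prj_le 0 N f
    rw [hs_zero, hs_zero] at this
    simpa using ENNReal.toReal_mono enorm_ne_top this
  rw [norm_prod_le_iff, pi_norm_le_iff_of_nonneg (norm_nonneg _)]
  exact ⟨(h _).trans (norm_fst_le U), fun j => (h _).trans
    ((norm_le_pi_norm U.2 j).trans (norm_snd_le U))⟩

/-- Weighted `L²` bounds pass to limits in `L²`. -/
lemma N2_le_of_tendsto {w : Plane → ℝ} (hw : LocBdd w) (h0 : ∀ ξ, 0 ≤ w ξ) {f : ℕ → HC} {g : HC}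
    (hf : Tendsto f atTop (𝓝 g)) {B : ENNReal}
    (hB : ∀ n, N2 (fun ξ => ENNReal.ofReal (w ξ) * ‖f n ξ‖ₑ) ≤ B) :
    N2 (fun ξ => ENNReal.ofReal (w ξ) * ‖g ξ‖ₑ) ≤ B := by
  have hg := g.measurable_enorm
  have hwm := hw.1
  have e : ∀ (K : ℝ) (f : HC), ‖prj K w f‖ₑ =
      N2 (fun ξ => ENNReal.ofReal (ch K ξ * w ξ) * ‖f ξ‖ₑ) := fun K f => by
    rw [prj, enorm_mulL (hw.bdd_ch K)]
    refine N2_congr (Eventually.of_forall fun ξ => ?_)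
    rw [← ofReal_norm, norm_rs, abs_of_nonneg (mul_nonneg (ch_nonneg K ξ) (h0 ξ))]
  have h1 : ∀ K : ℝ, ‖prj K w g‖ₑ ≤ B := fun K => by
    have h2 : Tendsto (fun n => ‖prj K w (f n)‖ₑ) atTop (𝓝 ‖prj K w g‖ₑ) :=
      (continuous_enorm.tendsto _).comp (((prj K w).continuous.tendsto g).comp hf)
    refine le_of_tendsto' h2 fun n => le_trans ?_ (hB n)
    rw [e]
    refine N2_mono (Eventually.of_forall fun ξ => ?_)
    gcongr
    exact mul_le_of_le_one_left (h0 ξ) (ch_le_one K ξ)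
  -- For each cut-off the weighted norm is continuous on L², so the bound passes to the limit;
  -- Fatou's lemma then removes the cut-off.
  have h3 : ∫⁻ ξ, (ENNReal.ofReal (w ξ) * ‖g ξ‖ₑ) ^ (2 : ℝ) ≤ B ^ (2 : ℝ) := by
    calc _ = ∫⁻ ξ, liminf (fun n : ℕ => (ENNReal.ofReal (ch n ξ * w ξ) * ‖g ξ‖ₑ) ^ (2 : ℝ)) atTop := by
          refine lintegral_congr fun ξ => (Tendsto.liminf_eq ?_).symm
          refine tendsto_const_nhds.congr' ?_
          filter_upwards [eventually_ge_atTop ⌈‖ξ‖⌉₊] with n hn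
          have h : ‖ξ‖ ≤ n := (Nat.le_ceil _).trans (by exact_mod_cast hn)
          rw [ch_of_le h, one_mul]
      _ ≤ liminf (fun n : ℕ => ∫⁻ ξ, (ENNReal.ofReal (ch n ξ * w ξ) * ‖g ξ‖ₑ) ^ (2 : ℝ)) atTop :=
          lintegral_liminf_le fun n => by fun_prop
      _ ≤ B ^ (2 : ℝ) := by
          refine liminf_le_of_frequently_le' (Frequently.of_forall fun n => ?_)
          rw [← N2_sq, ← e]
          gcongr
          exact h1 n
  rw [← N2_sq] at h3
  exact (ENNReal.rpow_le_rpow_iff two_pos).1 h3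

/-- A pointwise limit of solutions of `Y' = Z`. -/
lemma hasDerivWithinAt_of_tendsto {E : Type*} [NormedAddCommGroup E] [NormedSpace ℝ E]
    [CompleteSpace E] {Y Z : ℕ → ℝ → E} {y z : ℝ → E} {T B : ℝ}
    (hY : ∀ n, ∀ t ∈ Icc 0 T, HasDerivWithinAt (Y n) (Z n t) (Icc 0 T) t)
    (hZ : ∀ n, ContinuousOn (Z n) (Icc 0 T)) (hz : ContinuousOn z (Icc 0 T))
    (hB : ∀ n, ∀ t ∈ Icc 0 T, ‖Z n t‖ ≤ B)
    (hYy : ∀ t ∈ Icc 0 T, Tendsto (fun n => Y n t) atTop (𝓝 (y t)))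
    (hZz : ∀ t ∈ Icc 0 T, Tendsto (fun n => Z n t) atTop (𝓝 (z t))) :
    ∀ t ∈ Icc 0 T, HasDerivWithinAt y (z t) (Icc 0 T) t := by
  intro t₀ ht₀
  have hT : 0 ≤ T := ht₀.1.trans ht₀.2
  have h0 : (0 : ℝ) ∈ Icc 0 T := ⟨le_rfl, hT⟩
  have hint : ∀ t ∈ Icc 0 T, y t = y 0 + ∫ τ in (0 : ℝ)..t, z τ := by
    intro t ht
    have hsub : Icc 0 t ⊆ Icc 0 T := Icc_subset_Icc_right ht.2
    have h1 : ∀ n, ∫ τ in (0 : ℝ)..t, Z n τ = Y n t - Y n 0 := fun n => by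
      refine intervalIntegral.integral_eq_sub_of_hasDeriv_right_of_le ht.1
        (fun τ hτ => ((hY n τ (hsub hτ)).continuousWithinAt).mono hsub) (fun τ hτ => ?_)
        (((hZ n).mono hsub).intervalIntegrable_of_Icc ht.1)
      have := hY n τ (hsub (Ioo_subset_Icc_self hτ))
      exact this.mono_of_mem_nhdsWithin (mem_nhdsWithin_of_mem_nhds
        (Icc_mem_nhds hτ.1 (hτ.2.trans_le ht.2)))
    have h2 : Tendsto (fun n => ∫ τ in (0 : ℝ)..t, Z n τ) atTop (𝓝 (∫ τ in (0 : ℝ)..t, z τ)) := by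
      refine intervalIntegral.tendsto_integral_filter_of_dominated_convergence (fun _ => B)
        (Eventually.of_forall fun n => ?_) (Eventually.of_forall fun n => ?_)
        intervalIntegrable_const ?_
      · exact (((hZ n).mono hsub).intervalIntegrable_of_Icc ht.1).aestronglyMeasurable_restrict_uIoc
      · refine Eventually.of_forall fun τ hτ => hB n τ ?_
        rw [uIoc_of_le ht.1] at hτ
        exact hsub (Ioc_subset_Icc_self hτ)
      · refine Eventually.of_forall fun τ hτ => hZz τ ?_
        rw [uIoc_of_le ht.1] at hτ
        exact hsub (Ioc_subset_Icc_self hτ)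
    have h3 := tendsto_nhds_unique h2 (((hYy t ht).sub (hYy 0 h0)).congr fun n => (h1 n).symm)
    rw [h3]; abel
  -- Constant extension of z beyond [0, T], so that the fundamental theorem of calculus also serves
  -- the endpoints.
  set z' : ℝ → E := fun t => z (projIcc 0 T hT t) with hz'
  have hz'c : Continuous z' := by
    have := (continuousOn_iff_continuous_domRestrict.1 hz).comp (continuous_projIcc (h := hT))
    exact this
  have hd : HasDerivAt (fun t => y 0 + ∫ τ in (0 : ℝ)..t, z' τ) (z' t₀) t₀ :=
    (hz'c.integral_hasStrictDerivAt 0 t₀).hasDerivAt.const_add _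
  have e : ∀ t ∈ Icc 0 T, z' t = z t := fun t ht => by simp only [hz', projIcc_of_mem hT ht]
  rw [← e t₀ ht₀]
  refine hd.hasDerivWithinAt.congr (fun t ht => ?_) ?_
  all_goals
    first
    | (rw [hint t ht]; congr 1
       refine intervalIntegral.integral_congr fun τ hτ => (e τ ?_).symm
       rw [uIcc_of_le ht.1] at hτ
       exact Icc_subset_Icc_right ht.2 hτ)
    | (rw [hint t₀ ht₀]; congr 1
       refine intervalIntegral.integral_congr fun τ hτ => (e τ ?_).symm
       rw [uIcc_of_le ht₀.1] at hτ
       exact Icc_subset_Icc_right ht₀.2 hτ)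

/-- Solutions of the system on the Fourier side. -/
structure FSol (p : Par) (s T : ℝ) (U : ℝ → X) : Prop where
  herm : ∀ t ∈ Icc 0 T, liftX refl (U t) = U t
  fst_lt : ∀ t ∈ Icc 0 T, hs s (U t).1 < ⊤
  snd_lt : ∀ t ∈ Icc 0 T, ∀ j, hs (s + 1) ((U t).2 j) < ⊤
  fst_cont : ∀ t ∈ Icc 0 T, Tendsto (fun τ => hs s ((U τ).1 - (U t).1)) (𝓝[Icc 0 T] t) (𝓝 0)
  snd_cont : ∀ t ∈ Icc 0 T, ∀ j,
    Tendsto (fun τ => hs (s + 1) ((U τ).2 j - (U t).2 j)) (𝓝[Icc 0 T] t) (𝓝 0)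
  deriv : ∀ t ∈ Icc 0 T,
    HasDerivWithinAt (fun τ => mulX (wt (-4)) (U τ)) (p.F (wt (-4)) (U t)) (Icc 0 T) t

lemma bdd_wt_neg : Bdd (rs (wt (-4))) :=
  ⟨by fun_prop, 1, fun ξ => by
    rw [norm_rs, abs_of_pos (wt_pos _ _)]; exact wt_le_one (by norm_num) ξ⟩

/-- Continuity bounds the norm near each time, and compactness of [0, T] makes the bound global. -/
lemma exists_bound_of_cont {r T : ℝ} {f : ℝ → HC} (hfin : ∀ t ∈ Icc 0 T, hs r (f t) < ⊤)
    (hc : ∀ t ∈ Icc 0 T, Tendsto (fun τ => hs r (f τ - f t)) (𝓝[Icc 0 T] t) (𝓝 0)) :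
    ∃ R : ℝ, 0 ≤ R ∧ ∀ t ∈ Icc 0 T, hs r (f t) ≤ ENNReal.ofReal R := by
  have hloc : ∀ t ∈ Icc 0 T, ∃ u ∈ 𝓝[Icc 0 T] t, ∃ R : ℝ, ∀ τ ∈ u, hs r (f τ) ≤ ENNReal.ofReal R := by
    intro t ht
    refine ⟨{τ | hs r (f τ - f t) < 1}, (hc t ht).eventually_lt_const one_pos,
      (hs r (f t)).toReal + 1, fun τ hτ => ?_⟩
    rw [ENNReal.ofReal_add ENNReal.toReal_nonneg zero_le_one, ENNReal.ofReal_toReal (hfin t ht).ne,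
      ENNReal.ofReal_one]
    calc hs r (f τ) = hs r (f t + (f τ - f t)) := by rw [add_sub_cancel]
      _ ≤ _ := (hs_add_le _ _ _).trans (by gcongr; exact (show hs r (f τ - f t) < 1 from hτ).le)
  obtain ⟨R, hR⟩ := (isCompact_Icc (a := (0 : ℝ)) (b := T)).induction_on
    (p := fun u => ∃ R : ℝ, ∀ τ ∈ u, hs r (f τ) ≤ ENNReal.ofReal R)
    ⟨0, fun τ hτ => hτ.elim⟩ (fun u v huv ⟨R, hR⟩ => ⟨R, fun τ hτ => hR τ (huv hτ)⟩)
    (fun u v ⟨R, hR⟩ ⟨R', hR'⟩ => ⟨max R R', fun τ hτ => hτ.elim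
      (fun h => (hR τ h).trans (ENNReal.ofReal_le_ofReal (le_max_left _ _)))
      (fun h => (hR' τ h).trans (ENNReal.ofReal_le_ofReal (le_max_right _ _)))⟩) hloc
  exact ⟨max R 0, le_max_right _ _, fun t ht =>
    (hR t ht).trans (ENNReal.ofReal_le_ofReal (le_max_left _ _))⟩

namespace FSol

variable {p : Par} {s T : ℝ} {U : ℝ → X}

lemma exists_bound (h : FSol p s T U) : ∃ R : ℝ, 0 ≤ R ∧
    ∀ t ∈ Icc 0 T, hs s (U t).1 ≤ ENNReal.ofReal R ∧
      ∀ j, hs (s + 1) ((U t).2 j) ≤ ENNReal.ofReal R := by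
  obtain ⟨R, hR, h1⟩ := exists_bound_of_cont h.fst_lt h.fst_cont
  choose R' hR' h2 using fun j => exists_bound_of_cont (f := fun t => (U t).2 j)
    (fun t ht => h.snd_lt t ht j) (fun t ht => h.snd_cont t ht j)
  have hs : 0 ≤ ∑ j, R' j := Finset.sum_nonneg fun j _ => hR' j
  refine ⟨R + ∑ j, R' j, by positivity, fun t ht => ⟨(h1 t ht).trans ?_, fun j =>
    (h2 j t ht).trans ?_⟩⟩
  · exact ENNReal.ofReal_le_ofReal (by linarith)
  · have := Finset.single_le_sum (fun i _ => hR' i) (Finset.mem_univ j)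
    exact ENNReal.ofReal_le_ofReal (by linarith)

/-- On a ball the factor `wt (-4)` can be undone by the bounded symbol `ch N · wt 4`. Every
low-frequency part of a solution is therefore differentiable in L². -/
lemma deriv_ch (h : FSol p s T U) (N : ℝ) : ∀ t ∈ Icc 0 T,
    HasDerivWithinAt (fun τ => mulX (ch N) (U τ)) (p.F (ch N) (U t)) (Icc 0 T) t := by
  intro t ht
  have hb := (continuous_wt 4).locBdd.bdd_ch N
  have h1 := (mulX fun ξ => ch N ξ * wt 4 ξ).hasFDerivAt.comp_hasDerivWithinAt t (h.deriv t ht)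
  have e : (fun ξ => (ch N ξ * wt 4 ξ) * wt (-4) ξ) = ch N := funext fun ξ => by
    rw [mul_assoc, mul_comm (wt 4 ξ), wt_neg_mul, mul_one]
  rw [p.mulX_F adm_wt hb (by rw [e]; exact adm_ch N), e] at h1
  have e2 : ∀ f, mulL (rs fun ξ => ch N ξ * wt 4 ξ) (mulL (rs (wt (-4))) f) = mulL (rs (ch N)) f :=
    mulL_mulL hb bdd_wt_neg (bdd_ch N) (fun ξ => by rw [rs_mul_rs, e])
  refine h1.congr_of_eventuallyEq (Eventually.of_forall fun τ => ?_) ?_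
  · exact X.ext (e2 _).symm fun i => (e2 _).symm
  · exact X.ext (e2 _).symm fun i => (e2 _).symm

lemma truncSol (h : FSol p s T U) {R : ℝ} (hR : ∀ t ∈ Icc 0 T, hs s (U t).1 ≤ ENNReal.ofReal R ∧
    ∀ j, hs (s + 1) ((U t).2 j) ≤ ENNReal.ofReal R) (N : ℝ) : TruncSol p s T R N U :=
  ⟨h.herm, fun t ht => (hR t ht).1, fun t ht => (hR t ht).2, h.deriv_ch N⟩

/-- Both curves fit the stability estimate at every truncation radius with the same data, and its
right-hand side 2L `tl s n` tends to zero. -/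
theorem unique (hs1 : 1 < s) {V : ℝ → X} (hU : FSol p s T U) (hV : FSol p s T V)
    (h0 : U 0 = V 0) : ∀ t ∈ Icc 0 T, U t = V t := by
  intro t ht
  obtain ⟨R, hR, hUR⟩ := hU.exists_bound
  obtain ⟨R', hR', hVR⟩ := hV.exists_bound
  have hle := ENNReal.ofReal_le_ofReal (le_max_left R R')
  have hle' := ENNReal.ofReal_le_ofReal (le_max_right R R')
  have hUR2 : ∀ t ∈ Icc 0 T, hs s (U t).1 ≤ ENNReal.ofReal (max R R') ∧
      ∀ j, hs (s + 1) ((U t).2 j) ≤ ENNReal.ofReal (max R R') := fun t ht =>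
    ⟨(hUR t ht).1.trans hle, fun j => ((hUR t ht).2 j).trans hle⟩
  have hVR2 : ∀ t ∈ Icc 0 T, hs s (V t).1 ≤ ENNReal.ofReal (max R R') ∧
      ∀ j, hs (s + 1) ((V t).2 j) ≤ ENNReal.ofReal (max R R') := fun t ht =>
    ⟨(hVR t ht).1.trans hle', fun j => ((hVR t ht).2 j).trans hle'⟩
  obtain ⟨L, hL⟩ := p.stability hs1 (T := T) (R := max R R') (hR.trans (le_max_left _ _))
  have h00 : (0 : ℝ) ∈ Icc 0 T := ⟨le_rfl, ht.1.trans ht.2⟩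
  have key := fun n : ℕ => hL n n U V (U 0) n.cast_nonneg n.cast_nonneg (hU.truncSol hUR2 n)
    (hV.truncSol hVR2 n) (hUR2 0 h00).1
    (fun j => (hs_mono (by linarith) _).trans ((hUR2 0 h00).2 j)) rfl (by rw [h0]) t ht
  have h1 : Tendsto (fun n : ℕ => ‖mulX (ch n) (U t) - mulX (ch n) (V t)‖) atTop
      (𝓝 ‖U t - V t‖) := ((tendsto_mulX_ch _).sub (tendsto_mulX_ch _)).norm
  have h2 : Tendsto (fun n : ℕ => L * (tl s n + tl s n)) atTop (𝓝 0) := by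
    have := (tendsto_tl hs1).comp tendsto_natCast_atTop_atTop
    simpa using (this.add this).const_mul L
  have h3 := le_of_tendsto_of_tendsto' h1 h2 key
  exact sub_eq_zero.1 (norm_le_zero_iff.1 h3)

end FSol

lemma tl_anti {s : ℝ} (hs : 1 ≤ s) {N M : ℝ} (hN : 0 ≤ N) (h : N ≤ M) : tl s M ≤ tl s N := by
  unfold tl
  refine Real.rpow_le_rpow_of_nonpos (by positivity) ?_ (by linarith)
  gcongr

/-- Convergence in `L²` and boundedness with respect to a stronger weight imply convergence in
the weighted norm. -/
lemma tendsto_hs_of_tendsto {r : ℝ} {θ : Plane → ℝ} (hθ : Measurable θ) (hθ0 : ∀ ξ, 0 ≤ θ ξ)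
    (hdec : ∀ δ : ℝ, 0 < δ → ∃ ρ : ℝ, ∀ ξ, ρ ≤ ‖ξ‖ → wt r ξ ≤ δ * θ ξ) {f : ℝ → HC} {g : HC}
    {l : Filter ℝ} (hf : Tendsto f l (𝓝 g)) {b : ℝ} (hb : 0 ≤ b)
    (hfb : ∀ᶠ τ in l, N2 (fun ξ => ENNReal.ofReal (θ ξ) * ‖f τ ξ‖ₑ) ≤ ENNReal.ofReal b)
    (hgb : N2 (fun ξ => ENNReal.ofReal (θ ξ) * ‖g ξ‖ₑ) ≤ ENNReal.ofReal b) :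
    Tendsto (fun τ => hs r (f τ - g)) l (𝓝 0) := by
  have main : ∀ δ : ℝ, 0 < δ → ∀ᶠ τ in l, hs r (f τ - g) ≤ ENNReal.ofReal δ := by
    intro δ hδ
    -- High frequencies contribute at most δ' · 2b ≤ δ/2 by the stronger weight. On the remaining
    -- ball `wt r` is bounded by C', and L² convergence gives the other δ/2.
    set δ' := δ / (4 * b + 1) / 2 with hδ'
    have hδ'0 : 0 < δ' := by positivity
    obtain ⟨ρ, hρ⟩ := hdec δ' hδ'0
    obtain ⟨C, hC⟩ := (continuous_wt r).locBdd.2 ρ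
    set C' := max C 1 with hC'
    have hC'0 : 0 < C' := zero_lt_one.trans_le (le_max_right _ _)
    have hsmall : ∀ᶠ τ in l, ‖f τ - g‖ ≤ δ / 2 / C' :=
      (tendsto_iff_norm_sub_tendsto_zero.1 hf).eventually_le_const (by positivity)
    filter_upwards [hsmall, hfb] with τ h1 h2
    have hgm := g.measurable_enorm
    have hfm := (f τ).measurable_enorm
    have hdm := (f τ - g).measurable_enorm
    have h3 : N2 (fun ξ => ENNReal.ofReal (θ ξ) * ‖(f τ - g : HC) ξ‖ₑ) ≤ ENNReal.ofReal (2 * b) := by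
      rw [two_mul, ENNReal.ofReal_add hb hb]
      refine (N2_mono (G := fun ξ => ENNReal.ofReal (θ ξ) * ‖f τ ξ‖ₑ +
        ENNReal.ofReal (θ ξ) * ‖g ξ‖ₑ) ?_).trans ((N2_add_le (by fun_prop) (by fun_prop)).trans
          (add_le_add h2 hgb))
      filter_upwards [Lp.coeFn_sub (f τ) g] with ξ hξ
      rw [hξ, Pi.sub_apply, ← mul_add]
      gcongr
      exact enorm_sub_le
    have h4 : hs r (f τ - g) ≤ ENNReal.ofReal δ' * ENNReal.ofReal (2 * b) +
        ENNReal.ofReal C' * ENNReal.ofReal (δ / 2 / C') := by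
      calc hs r (f τ - g) ≤ N2 (fun ξ => ENNReal.ofReal δ' * (ENNReal.ofReal (θ ξ) *
            ‖(f τ - g : HC) ξ‖ₑ) + ENNReal.ofReal C' * ‖(f τ - g : HC) ξ‖ₑ) := by
            refine N2_mono (Eventually.of_forall fun ξ => ?_)
            rw [← mul_assoc, ← add_mul, ← ENNReal.ofReal_mul hδ'0.le,
              ← ENNReal.ofReal_add (mul_nonneg hδ'0.le (hθ0 ξ)) hC'0.le]
            gcongr
            refine ENNReal.ofReal_le_ofReal ?_
            have h5 := mul_nonneg hδ'0.le (hθ0 ξ)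
            rcases le_or_gt ρ ‖ξ‖ with h | h
            · linarith [hρ ξ h]
            · have := (le_abs_self _).trans (hC ξ h.le)
              linarith [le_max_left C 1]
        _ ≤ _ := by
            refine (N2_add_le (by fun_prop) (by fun_prop)).trans ?_
            rw [N2_const_mul _ ENNReal.ofReal_ne_top, N2_const_mul _ ENNReal.ofReal_ne_top,
              ← HC.enorm_eq, ← ofReal_norm]
            gcongr
    refine h4.trans ?_
    rw [← ENNReal.ofReal_mul hδ'0.le, ← ENNReal.ofReal_mul hC'0.le,
      ← ENNReal.ofReal_add (by positivity) (by positivity)]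
    refine ENNReal.ofReal_le_ofReal ?_
    rw [mul_div_cancel₀ _ hC'0.ne', hδ']
    have h6 : δ / (4 * b + 1) * b ≤ δ / 2 := by
      rw [div_mul_eq_mul_div, div_le_div_iff₀ (by positivity) two_pos]
      nlinarith
    linarith
  rw [ENNReal.tendsto_nhds_zero]
  intro e he
  rcases eq_or_ne e ⊤ with h | h
  · exact Eventually.of_forall fun τ => h ▸ le_top
  · have := main e.toReal (ENNReal.toReal_pos he.ne' h)
    rwa [ENNReal.ofReal_toReal h] at this

namespace Par

variable (p : Par)

/-- The energy of truncated data. -/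
lemma En_mulX_ch_le {s : ℝ} {q : ℕ} {ω h : Plane → ℝ} (hω : IsWeight s q ω)
    (hωh : ∀ ξ, ω ξ ^ 2 = wt s ξ ^ 2 * h ξ) (W : X) (N : ℝ) {M : ℝ} (hM : 0 ≤ M)
    (hW : ∫⁻ ξ, ((ewt s ξ * ‖W.1 ξ‖ₑ) ^ (2 : ℝ) + ENNReal.ofReal p.hi *
      ∑ j, (ewt (s + 1) ξ * ‖W.2 j ξ‖ₑ) ^ (2 : ℝ)) * ENNReal.ofReal (h ξ) ≤ ENNReal.ofReal M) :
    p.En ω N (mulX (ch N) W) ≤ M := by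
  have hωm := hω.measurable
  have hh0 : ∀ ξ, 0 ≤ h ξ := fun ξ => by
    have h1 := wt_pos s ξ
    have h2 : 0 ≤ wt s ξ ^ 2 * h ξ := by rw [← hωh]; positivity
    exact nonneg_of_mul_nonneg_right h2 (by positivity)
  have hcut : ∀ (w : Plane → ℝ) (f : HC), LocBdd w → (∀ ξ, 0 ≤ w ξ) →
      ‖prj N w (mulL (rs (ch N)) f)‖ₑ ^ (2 : ℝ) ≤
        ∫⁻ ξ, (ENNReal.ofReal (w ξ) * ‖f ξ‖ₑ) ^ (2 : ℝ) := fun w f hw hw0 => by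
    rw [prj, enorm_mulL_ch hw hw0 (supp_mulL N f), N2_sq]
    refine lintegral_mono_ae ?_
    filter_upwards [mulL_coe (bdd_ch N) f] with ξ hξ
    rw [hξ, enorm_mul]
    gcongr
    refine mul_le_of_le_one_left' ?_
    rw [← ofReal_norm, norm_rs, abs_of_nonneg (ch_nonneg N ξ), ← ENNReal.ofReal_one]
    exact ENNReal.ofReal_le_ofReal (ch_le_one N ξ)
  have hω2 : ∀ ξ, ENNReal.ofReal (ω ξ) ^ (2 : ℝ) = ewt s ξ ^ (2 : ℝ) * ENNReal.ofReal (h ξ) :=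
    fun ξ => by
      rw [ENNReal.rpow_two, ENNReal.rpow_two, ← ENNReal.ofReal_pow (hω.pos ξ).le, hωh,
        ENNReal.ofReal_mul (by positivity), ENNReal.ofReal_pow (wt_pos s ξ).le, ewt]
  have hv2 : ∀ ξ, ENNReal.ofReal (p.wv ω ξ) ^ (2 : ℝ) ≤
      ENNReal.ofReal p.hi * ewt (s + 1) ξ ^ (2 : ℝ) * ENNReal.ofReal (h ξ) := fun ξ => by
    have h1 := wt_pos s ξ
    have h2 := wt_pos (s + 1) ξ
    have h3 := hh0 ξ
    have h5 := (hω.pos ξ).le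
    have h4 := p.hi_pos
    rw [ENNReal.rpow_two, ENNReal.rpow_two, ewt, ← ENNReal.ofReal_pow h2.le,
      ← ENNReal.ofReal_mul h4.le, ← ENNReal.ofReal_mul (by positivity),
      ← ENNReal.ofReal_pow (by unfold wv; positivity)]
    refine ENNReal.ofReal_le_ofReal ?_
    rw [wv, mul_pow, Real.sq_sqrt (p.em_pos ξ).le, hωh, wt_add, mul_pow, wt_one_sq, ← wt_two]
    have := (p.em_le ξ).trans (mul_le_mul_of_nonneg_left (p.one_add_eps_le ξ) h4.le)
    calc wt s ξ ^ 2 * h ξ * p.em ξ ≤ wt s ξ ^ 2 * h ξ * (p.hi * wt 2 ξ) := by gcongr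
      _ = _ := by ring
  rw [← ENNReal.ofReal_le_ofReal_iff hM]
  refine le_trans ?_ hW
  rw [En, ENNReal.ofReal_add (by positivity) (by positivity), ENNReal.ofReal_sum_of_nonneg
    (fun j _ => by positivity)]
  simp_rw [ENNReal.ofReal_pow (norm_nonneg _), ofReal_norm, ← ENNReal.rpow_two]
  have m1 := W.1.measurable_enorm
  have m2 := fun j => (W.2 j).measurable_enorm
  calc _ ≤ (∫⁻ ξ, (ENNReal.ofReal (ω ξ) * ‖W.1 ξ‖ₑ) ^ (2 : ℝ)) +
        ∑ j, ∫⁻ ξ, (ENNReal.ofReal (p.wv ω ξ) * ‖W.2 j ξ‖ₑ) ^ (2 : ℝ) := by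
        refine add_le_add (hcut ω W.1 hω.locBdd fun ξ => (hω.pos ξ).le)
          (Finset.sum_le_sum fun j _ => hcut _ (W.2 j) (p.locBdd_wv hω.locBdd) fun ξ => ?_)
        exact mul_nonneg (hω.pos ξ).le (Real.sqrt_nonneg _)
    _ = ∫⁻ ξ, ((ENNReal.ofReal (ω ξ) * ‖W.1 ξ‖ₑ) ^ (2 : ℝ) +
        ∑ j, (ENNReal.ofReal (p.wv ω ξ) * ‖W.2 j ξ‖ₑ) ^ (2 : ℝ)) := by
        have m3 := (p.locBdd_wv hω.locBdd).1
        rw [lintegral_add_left (by fun_prop), lintegral_finsetSum _ (fun j _ => by fun_prop)]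
    _ ≤ _ := by
        refine lintegral_mono fun ξ => ?_
        rw [add_mul, Finset.mul_sum, Finset.sum_mul]
        simp_rw [ENNReal.mul_rpow_of_nonneg _ _ zero_le_two]
        refine add_le_add (le_of_eq ?_) (Finset.sum_le_sum fun j _ => ?_)
        · rw [hω2]; ring
        · calc _ ≤ (ENNReal.ofReal p.hi * ewt (s + 1) ξ ^ (2 : ℝ) * ENNReal.ofReal (h ξ)) *
              ‖W.2 j ξ‖ₑ ^ (2 : ℝ) := by gcongr; exact hv2 ξ
            _ = _ := by ring

/-- Existence of solutions on the Fourier side, with bounds. -/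
theorem exists_fsol {s : ℝ} (hs1 : 1 < s) {W : X} (hherm : liftX refl W = W) {B T : ℝ} (hB : 0 ≤ B)
    (hW : hs s W.1 ^ (2 : ℝ) + ENNReal.ofReal p.hi * ∑ j, hs (s + 1) (W.2 j) ^ (2 : ℝ) ≤
      ENNReal.ofReal B) (hT0 : 0 ≤ T)
    (hT : √p.ε * p.enC s (⌈s⌉₊ + 1) * (3 * √(B + 1)) * T < 1) :
    ∃ U : ℝ → X, FSol p s T U ∧ U 0 = W ∧ ∀ t ∈ Icc 0 T,
      hs s (U t).1 ≤ ENNReal.ofReal (√(2 * (B + 1))) ∧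
      (∀ j, hs s ((U t).2 j) ≤ ENNReal.ofReal ((√p.lo)⁻¹ * √(2 * (B + 1)))) ∧
      ∀ j, hs (s + 1) ((U t).2 j) ≤ ENNReal.ofReal ((√(p.lo * p.ε))⁻¹ * √(2 * (B + 1))) := by
  have m1 := W.1.measurable_enorm
  have m2 := fun j => (W.2 j).measurable_enorm
  set g : Plane → ENNReal := fun ξ => (ewt s ξ * ‖W.1 ξ‖ₑ) ^ (2 : ℝ) + ENNReal.ofReal p.hi *
      ∑ j, (ewt (s + 1) ξ * ‖W.2 j ξ‖ₑ) ^ (2 : ℝ) with hg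
  have hgm : Measurable g := by fun_prop
  have hgi : ∫⁻ ξ, g ξ ≤ ENNReal.ofReal B := by
    refine le_trans (le_of_eq ?_) hW
    rw [hg, lintegral_add_left (by fun_prop), lintegral_const_mul _ (by fun_prop),
      lintegral_finsetSum _ (fun j _ => by fun_prop)]
    simp only [hs, N2_sq]
  -- The weight depends on the data, but its growth exponent ⌈s⌉₊ + 1 does not, and neither does the
  -- energy constant. The price is a data energy of at most B + 1 in place of B.
  obtain ⟨ω, h, hω, hωh, hdec, hint⟩ := exists_weight (s := s) (by linarith) hgm
    (hgi.trans_lt ENNReal.ofReal_lt_top).ne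
  have hint' : ∫⁻ ξ, g ξ * ENNReal.ofReal (h ξ) ≤ ENNReal.ofReal (B + 1) := by
    rw [ENNReal.ofReal_add hB zero_le_one, ENNReal.ofReal_one]
    exact hint.trans (by gcongr)
  have hM : 0 < B + 1 := by linarith
  choose U hU0 hU using fun n : ℕ => p.exists_truncated hs1 hω n (good_mulX_ch hherm n) hM
    (p.En_mulX_ch_le hω hωh W n hM.le hint') hT0 hT
  set b := √(2 * (B + 1)) with hb
  have hb0 : 0 ≤ b := Real.sqrt_nonneg _
  have hw0 : ∀ ξ, 0 ≤ ω ξ := fun ξ => (hω.pos ξ).le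
  have hw1 : ∀ ξ, 0 ≤ ω ξ * wt 1 ξ := fun ξ => mul_nonneg (hw0 ξ) (wt_pos 1 ξ).le
  have hL1 : LocBdd fun ξ => ω ξ * wt 1 ξ := hω.locBdd.mul (continuous_wt 1).locBdd
  have hE : ∀ n : ℕ, ∀ t ∈ Icc 0 T, √(p.En ω n (U n t)) ≤ b := fun n t ht =>
    Real.sqrt_le_sqrt (hU n t ht).2.2
  have c1 : ∀ n, ∀ t ∈ Icc 0 T, N2 (fun ξ => ENNReal.ofReal (ω ξ) * ‖(U n t).1 ξ‖ₑ) ≤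
      ENNReal.ofReal b := fun n t ht => by
    rw [← enorm_mulL_ch hω.locBdd hw0 (hU n t ht).1.supp_fst, ← ofReal_norm]
    exact ENNReal.ofReal_le_ofReal ((p.norm_prj_fst_le ω n _).trans (hE n t ht))
  have c2 : ∀ n, ∀ t ∈ Icc 0 T, ∀ j, N2 (fun ξ => ENNReal.ofReal (ω ξ) * ‖(U n t).2 j ξ‖ₑ) ≤
      ENNReal.ofReal ((√p.lo)⁻¹ * b) := fun n t ht j => by
    rw [← enorm_mulL_ch hω.locBdd hw0 ((hU n t ht).1.supp_snd j), ← ofReal_norm]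
    refine ENNReal.ofReal_le_ofReal ((p.norm_prj_le hω n _).trans ?_)
    gcongr
    exact (p.norm_prj_snd_le ω n _ j).trans (hE n t ht)
  have c3 : ∀ n, ∀ t ∈ Icc 0 T, ∀ j,
      N2 (fun ξ => ENNReal.ofReal (ω ξ * wt 1 ξ) * ‖(U n t).2 j ξ‖ₑ) ≤
      ENNReal.ofReal ((√(p.lo * p.ε))⁻¹ * b) := fun n t ht j => by
    rw [← enorm_mulL_ch hL1 hw1 ((hU n t ht).1.supp_snd j), ← ofReal_norm]
    refine ENNReal.ofReal_le_ofReal ((p.norm_prj_wt_le hω n _).trans ?_)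
    gcongr
    exact (p.norm_prj_snd_le ω n _ j).trans (hE n t ht)
  have d1 : ∀ {f : HC} {C : ENNReal}, N2 (fun ξ => ENNReal.ofReal (ω ξ) * ‖f ξ‖ₑ) ≤ C →
      hs s f ≤ C := fun {f C} hf => (N2_mono (Eventually.of_forall fun ξ => by
    gcongr; exact ENNReal.ofReal_le_ofReal (hω.le ξ))).trans hf
  have d2 : ∀ {f : HC} {C : ENNReal}, N2 (fun ξ => ENNReal.ofReal (ω ξ * wt 1 ξ) * ‖f ξ‖ₑ) ≤ C →
      hs (s + 1) f ≤ C := fun {f C} hf => (N2_mono (Eventually.of_forall fun ξ => by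
    gcongr
    refine ENNReal.ofReal_le_ofReal ?_
    rw [wt_add]
    exact mul_le_mul_of_nonneg_right (hω.le ξ) (wt_pos 1 ξ).le)).trans hf
  set R₁ := (√(p.lo * p.ε))⁻¹ * b with hR₁
  have hR₁0 : 0 ≤ R₁ := by positivity
  have hWfin : ∃ R₂ : ℝ, 0 ≤ R₂ ∧ hs s W.1 ≤ ENNReal.ofReal R₂ ∧
      ∀ j, hs s (W.2 j) ≤ ENNReal.ofReal R₂ := by
    have hhi := p.hi_pos
    have f1 : hs s W.1 ≠ ⊤ := fun h => by simp [h] at hW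
    have f2 : ∀ j, hs (s + 1) (W.2 j) ≠ ⊤ := fun j h => by
      have h1 : ∑ j, hs (s + 1) (W.2 j) ^ (2 : ℝ) = ⊤ :=
        ENNReal.sum_eq_top.2 ⟨j, Finset.mem_univ j, by rw [h]; simp⟩
      rw [h1, ENNReal.mul_top (by simpa using hhi)] at hW
      simp at hW
    have h0 : 0 ≤ ∑ j, (hs (s + 1) (W.2 j)).toReal :=
      Finset.sum_nonneg fun j _ => ENNReal.toReal_nonneg
    refine ⟨(hs s W.1).toReal + ∑ j, (hs (s + 1) (W.2 j)).toReal,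
      add_nonneg ENNReal.toReal_nonneg h0, ?_, fun j => ?_⟩
    · rw [← ENNReal.ofReal_toReal f1]
      exact ENNReal.ofReal_le_ofReal (by simpa using h0)
    · refine (hs_mono (q := s + 1) (by linarith) _).trans ?_
      rw [← ENNReal.ofReal_toReal (f2 j)]
      refine ENNReal.ofReal_le_ofReal ?_
      have := Finset.single_le_sum (f := fun j => (hs (s + 1) (W.2 j)).toReal)
        (fun i _ => ENNReal.toReal_nonneg) (Finset.mem_univ j)
      have h3 : 0 ≤ (hs s W.1).toReal := ENNReal.toReal_nonneg
      linarith
  obtain ⟨R₂, hR₂0, hW1, hW2⟩ := hWfin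
  set R := b + R₁ + R₂ with hR
  have hR0 : 0 ≤ R := by positivity
  have hP : ∀ n : ℕ, ∀ t ∈ Icc 0 T, mulX (ch n) (U n t) = U n t := fun n t ht =>
    X.ext (hU n t ht).1.supp_fst (hU n t ht).1.supp_snd
  have hTS : ∀ n : ℕ, TruncSol p s T R n (U n) := fun n =>
    { herm := fun t ht => (hU n t ht).1.herm
      fst_le := fun t ht => (d1 (c1 n t ht)).trans (ENNReal.ofReal_le_ofReal (by linarith))
      snd_le := fun t ht j => (d2 (c3 n t ht j)).trans (ENNReal.ofReal_le_ofReal (by linarith))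
      deriv := fun t ht => (hU n t ht).2.1.congr (fun τ hτ => hP n τ hτ) (hP n t ht) }
  have hRW : ENNReal.ofReal R₂ ≤ ENNReal.ofReal R := ENNReal.ofReal_le_ofReal (by linarith)
  obtain ⟨L, hL⟩ := p.stability hs1 (T := T) hR0
  have h00 : (0 : ℝ) ∈ Icc 0 T := ⟨le_rfl, hT0⟩
  -- Stability with W as the common data makes the truncated solutions Cauchy in L², uniformly in
  -- time.
  have hcau : ∀ n m : ℕ, ∀ t ∈ Icc 0 T, ‖U n t - U m t‖ ≤ L * (tl s n + tl s m) := by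
    intro n m t ht
    have := hL n m (U n) (U m) W n.cast_nonneg m.cast_nonneg (hTS n) (hTS m) (hW1.trans hRW)
      (fun j => (hW2 j).trans hRW) (by rw [hP n 0 h00, hU0]) (by rw [hP m 0 h00, hU0]) t ht
    rwa [hP n t ht, hP m t ht] at this
  have htl : Tendsto (fun n : ℕ => tl s n) atTop (𝓝 0) :=
    (tendsto_tl hs1).comp tendsto_natCast_atTop_atTop
  have hlim : ∀ t ∈ Icc 0 T, ∃ v, Tendsto (fun n => U n t) atTop (𝓝 v) := fun t ht => by
    refine cauchySeq_tendsto_of_complete (cauchySeq_of_le_tendsto_0 (fun N : ℕ => |L| * (tl s N + tl s N))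
      (fun n m N hn hm => ?_) (by simpa using (htl.add htl).const_mul |L|))
    rw [dist_eq_norm]
    have h1 := tl_anti hs1.le N.cast_nonneg (Nat.cast_le.2 hn)
    have h2 := tl_anti hs1.le N.cast_nonneg (Nat.cast_le.2 hm)
    have h3 := tl_nonneg s n
    have h4 := tl_nonneg s m
    refine (hcau n m t ht).trans ?_
    gcongr
    exact le_abs_self L
  choose! V hV using hlim
  have hunif : ∀ n : ℕ, ∀ t ∈ Icc 0 T, ‖V t - U n t‖ ≤ L * tl s n := fun n t ht => by
    have h1 : Tendsto (fun m => ‖U m t - U n t‖) atTop (𝓝 ‖V t - U n t‖) :=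
      ((hV t ht).sub_const _).norm
    have h2 : Tendsto (fun m : ℕ => L * (tl s m + tl s n)) atTop (𝓝 (L * (0 + tl s n))) :=
      (htl.add_const _).const_mul L
    rw [zero_add] at h2
    exact le_of_tendsto_of_tendsto' h1 h2 fun m => hcau m n t ht
  have hUc : ∀ n, ContinuousOn (U n) (Icc 0 T) := fun n t ht => (hU n t ht).2.1.continuousWithinAt
  have hVc : ContinuousOn V (Icc 0 T) := by
    have hu : TendstoUniformlyOn (fun n t => U n t) V atTop (Icc 0 T) := by
      rw [Metric.tendstoUniformlyOn_iff]
      intro e he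
      have h1 : Tendsto (fun n : ℕ => L * tl s n) atTop (𝓝 0) := by simpa using htl.const_mul L
      filter_upwards [h1.eventually_lt_const he] with n hn t ht
      rw [dist_eq_norm]
      exact (hunif n t ht).trans_lt hn
    exact hu.continuousOn (Frequently.of_forall hUc)
  have hV1 : ∀ t ∈ Icc 0 T, Tendsto (fun n => (U n t).1) atTop (𝓝 (V t).1) := fun t ht =>
    (continuous_fst.tendsto _).comp (hV t ht)
  have hV2 : ∀ t ∈ Icc 0 T, ∀ j, Tendsto (fun n => (U n t).2 j) atTop (𝓝 ((V t).2 j)) :=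
    fun t ht j => (((continuous_apply j).comp continuous_snd).tendsto (V t)).comp (hV t ht)
  have e1 := fun t ht => N2_le_of_tendsto hω.locBdd hw0 (hV1 t ht) fun n => c1 n t ht
  have e2 := fun t ht j => N2_le_of_tendsto hω.locBdd hw0 (hV2 t ht j) fun n => c2 n t ht j
  have e3 := fun t ht j => N2_le_of_tendsto hL1 hw1 (hV2 t ht j) fun n => c3 n t ht j
  have hnorm : ∀ n, ∀ t ∈ Icc 0 T, ‖U n t‖ ≤ max b ((√p.lo)⁻¹ * b) := fun n t ht =>
    p.norm_le_of_En_le (by linarith) hω (hU n t ht).1 (hU n t ht).2.2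
  have hFc : Continuous (p.F (wt (-4))) := (p.lipB_F _).continuous
  refine ⟨V, ⟨fun t ht => ?_, fun t ht => (d1 (e1 t ht)).trans_lt ENNReal.ofReal_lt_top,
    fun t ht j => (d2 (e3 t ht j)).trans_lt ENNReal.ofReal_lt_top, fun t ht => ?_, fun t ht j => ?_,
    ?_⟩, ?_, fun t ht => ⟨d1 (e1 t ht), fun j => d1 (e2 t ht j), fun j => d2 (e3 t ht j)⟩⟩
  · refine tendsto_nhds_unique (((liftX refl).continuous.tendsto _).comp (hV t ht)) ?_
    exact (hV t ht).congr fun n => (hU n t ht).1.herm.symm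
  -- The limit is continuous in L² and bounded with respect to ω, which dominates `wt s` at
  -- infinity; so it is continuous in H^s.
  · refine tendsto_hs_of_tendsto hω.measurable hw0 hdec
      (f := fun τ => (V τ).1) (((continuous_fst.tendsto _).comp (hVc t ht))) hb0 ?_ (e1 t ht)
    exact eventually_mem_nhdsWithin.mono fun τ hτ => e1 τ hτ
  · refine tendsto_hs_of_tendsto (θ := fun ξ => ω ξ * wt 1 ξ) hL1.1 hw1 (fun δ hδ => ?_)
      (f := fun τ => (V τ).2 j)
      ((((continuous_apply j).comp continuous_snd).tendsto (V t)).comp (hVc t ht)) hR₁0 ?_ (e3 t ht j)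
    · obtain ⟨ρ, hρ⟩ := hdec δ hδ
      refine ⟨ρ, fun ξ hξ => ?_⟩
      rw [wt_add, ← mul_assoc]
      exact mul_le_mul_of_nonneg_right (hρ ξ hξ) (wt_pos 1 ξ).le
    · exact eventually_mem_nhdsWithin.mono fun τ hτ => e3 τ hτ j
  -- The fields `F (ch n)` need not converge in L². After multiplication with `wt (-4)` the
  -- truncated equation has right-hand side `ch n` times `F (wt (-4))`, which is bounded and
  -- converges at each time.
  · obtain ⟨K, hK, hlip⟩ := p.lipB_F (wt (-4)) (max b ((√p.lo)⁻¹ * b))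
    have hmax : 0 ≤ max b ((√p.lo)⁻¹ * b) := hb0.trans (le_max_left _ _)
    refine hasDerivWithinAt_of_tendsto (Y := fun n t => mulX (wt (-4)) (U n t))
      (Z := fun n t => mulX (ch n) (p.F (wt (-4)) (U n t)))
      (B := ‖p.F (wt (-4)) 0‖ + K * max b ((√p.lo)⁻¹ * b)) (fun n t ht => ?_) (fun n => ?_)
      (hFc.comp_continuousOn hVc) (fun n t ht => ?_)
      (fun t ht => ((mulX _).continuous.tendsto _).comp (hV t ht)) (fun t ht => ?_)
    · have h1 := (mulX (wt (-4))).hasFDerivAt.comp_hasDerivWithinAt t (hU n t ht).2.1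
      have a1 : Adm fun ξ => wt (-4) ξ * ch n ξ := by
        simpa [mul_comm] using (continuous_wt (-4)).locBdd.adm n
      have a2 : Adm fun ξ => ch n ξ * wt (-4) ξ := (continuous_wt (-4)).locBdd.adm n
      rw [p.mulX_F (adm_ch n) bdd_wt_neg a1] at h1
      change HasDerivWithinAt _ (mulX (ch n) (p.F (wt (-4)) (U n t))) _ _
      rw [p.mulX_F adm_wt (bdd_ch n) a2]
      simp_rw [mul_comm (wt (-4) _)] at h1
      exact h1
    · exact (mulX (ch n)).continuous.comp_continuousOn (hFc.comp_continuousOn (hUc n))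
    · refine (norm_mulX_ch_le _ _).trans ?_
      have h1 := hlip (U n t) 0 (hnorm n t ht) (by rw [norm_zero]; exact hmax)
      rw [sub_zero] at h1
      have h2 := norm_le_norm_add_norm_sub (p.F (wt (-4)) 0) (p.F (wt (-4)) (U n t))
      rw [norm_sub_rev] at h2
      have h3 : K * ‖U n t‖ ≤ K * max b ((√p.lo)⁻¹ * b) := by gcongr; exact hnorm n t ht
      linarith
    · have h1 := tendsto_mulX_ch (p.F (wt (-4)) (V t))
      have h2 : Tendsto (fun n => p.F (wt (-4)) (U n t) - p.F (wt (-4)) (V t)) atTop (𝓝 0) := by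
        rw [← sub_self (p.F (wt (-4)) (V t))]
        exact ((hFc.tendsto _).comp (hV t ht)).sub_const _
      have h3 : Tendsto (fun n : ℕ => mulX (ch n) (p.F (wt (-4)) (U n t) - p.F (wt (-4)) (V t)))
          atTop (𝓝 0) :=
        squeeze_zero_norm (fun n => norm_mulX_ch_le _ _) (by simpa using h2.norm)
      have h4 := h3.add h1
      rw [zero_add] at h4
      refine h4.congr fun n => ?_
      rw [map_sub, sub_add_cancel]
  · refine tendsto_nhds_unique (hV 0 h00) ?_
    simp_rw [hU0]
    exact tendsto_mulX_ch W

end Par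

/-! ### The Fourier transform of real functions -/

/-- The Fourier transform of a real square integrable function. -/
def hat (u : L2) : HC := 𝓕 (toComplex u)

/-- Pointwise complex conjugation. -/
def conjL : HC →L[ℝ] HC := Complex.conjCLE.toContinuousLinearMap.compLpL 2 volume

/-- A real Schwartz function regarded as a complex-valued one. -/
def cx (φ : 𝓢(Plane, ℝ)) : 𝓢(Plane, ℂ) := SchwartzMap.postcompCLM Complex.ofRealCLM φ

lemma cx_apply (φ : 𝓢(Plane, ℝ)) (x : Plane) : cx φ x = (φ x : ℂ) := rfl

lemma toComplex_coe (u : L2) : toComplex u =ᵐ[volume] fun x => (u x : ℂ) :=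
  ContinuousLinearMap.coeFn_compLp _ u

lemma conjL_coe (f : HC) : conjL f =ᵐ[volume] fun x => (starRingEnd ℂ) (f x) :=
  ContinuousLinearMap.coeFn_compLp _ f

lemma toComplex_sub (u v : L2) : toComplex (u - v) = toComplex u - toComplex v :=
  (Complex.ofRealCLM.compLpL 2 volume).map_sub u v

lemma norm_toComplex (u : L2) : ‖toComplex u‖ = ‖u‖ := by
  have : ‖toComplex u‖ₑ = ‖u‖ₑ := by
    rw [Lp.enorm_def, Lp.enorm_def]
    refine eLpNorm_congr_enorm_ae ?_
    filter_upwards [toComplex_coe u] with x hx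
    rw [hx]; simp [enorm_eq_nnnorm]
  simpa using congrArg ENNReal.toReal this

lemma conjL_toComplex (u : L2) : conjL (toComplex u) = toComplex u := by
  apply Lp.ext
  filter_upwards [conjL_coe (toComplex u), toComplex_coe u] with x h1 h2
  rw [h1, h2, Complex.conj_ofReal]

lemma exists_toComplex {f : HC} (h : conjL f = f) : ∃ u : L2, toComplex u = f := by
  refine ⟨Complex.reCLM.compLp f, Lp.ext ?_⟩
  filter_upwards [toComplex_coe (Complex.reCLM.compLp f), Complex.reCLM.coeFn_compLp f,
    conjL_coe f] with x h1 h2 h3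
  rw [h] at h3
  rw [h1, h2]
  exact (Complex.conj_eq_iff_re.1 h3.symm)

lemma continuous_fourier_HC : Continuous (fun f : HC => (𝓕 f : HC)) :=
  FourierTransform.continuous_fourier

lemma fourier_conj_apply (f : 𝓢(Plane, ℂ)) (ξ : Plane) :
    (𝓕 (SchwartzMap.postcompCLM Complex.conjCLE.toContinuousLinearMap f : 𝓢(Plane, ℂ))
      : 𝓢(Plane, ℂ)) ξ = (starRingEnd ℂ) ((𝓕 f : 𝓢(Plane, ℂ)) (-ξ)) := by
  rw [SchwartzMap.fourier_coe, SchwartzMap.fourier_coe, Real.fourier_eq', Real.fourier_eq',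
    ← integral_conj]
  congr 1
  ext x
  change _ * (starRingEnd ℂ) (f x) = _
  simp only [smul_eq_mul, map_mul, ← Complex.exp_conj, Complex.conj_ofReal, Complex.conj_I,
    inner_neg_right]
  congr 2
  push_cast; ring

/-- Both sides are continuous in f, and on Schwartz functions the identity is a computation with the
integral. -/
lemma fourier_conjL (f : HC) : (𝓕 (conjL f) : HC) = refl (𝓕 f) := by
  refine DenseRange.induction_on
    (SchwartzMap.denseRange_toLpCLM (F := ℂ) (μ := (volume : Measure Plane)) (p := 2)
      ENNReal.ofNat_ne_top) f
    (isClosed_eq (continuous_fourier_HC.comp conjL.continuous)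
      (refl.continuous.comp continuous_fourier_HC)) fun g => ?_
  rw [SchwartzMap.toLpCLM_apply, SchwartzMap.toLp_fourier_eq]
  have h1 : conjL (g.toLp 2) =
      (SchwartzMap.postcompCLM Complex.conjCLE.toContinuousLinearMap g : 𝓢(Plane, ℂ)).toLp 2 := by
    apply Lp.ext
    filter_upwards [conjL_coe (g.toLp 2), g.coeFn_toLp 2 volume,
      (SchwartzMap.postcompCLM Complex.conjCLE.toContinuousLinearMap g : 𝓢(Plane, ℂ)).coeFn_toLp
        2 volume] with x h1 h2 h3
    rw [h1, h2, h3]; rfl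
  rw [h1, SchwartzMap.toLp_fourier_eq]
  apply Lp.ext
  filter_upwards [SchwartzMap.coeFn_toLp (𝓕 (SchwartzMap.postcompCLM
      Complex.conjCLE.toContinuousLinearMap g : 𝓢(Plane, ℂ)) : 𝓢(Plane, ℂ)) 2 volume,
    refl_coe ((𝓕 g : 𝓢(Plane, ℂ)).toLp 2), ae_neg ((𝓕 g : 𝓢(Plane, ℂ)).coeFn_toLp 2 volume)]
    with ξ h1 h2 h3
  rw [h1, h2, h3, fourier_conj_apply]

lemma refl_hat (u : L2) : refl (hat u) = hat u := by
  rw [hat, ← fourier_conjL, conjL_toComplex]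

lemma hat_sub (u v : L2) : hat (u - v) = hat u - hat v := by
  rw [hat, toComplex_sub]
  exact (FourierTransform.fourierCLM ℂ HC).map_sub _ _

lemma norm_hat (u : L2) : ‖hat u‖ = ‖u‖ := by
  rw [hat, Lp.norm_fourier_eq, norm_toComplex]

lemma hat_injective : Function.Injective hat := fun u v h => by
  rw [← sub_eq_zero, ← norm_eq_zero, ← norm_hat, hat_sub, h, sub_self, norm_zero]

/-- With `refl_hat`: the fixed points of `refl` are exactly the transforms of real functions. This
brings solutions back from the Fourier side. -/
lemma exists_hat {f : HC} (h : refl f = f) : ∃ u : L2, hat u = f := by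
  obtain ⟨u, hu⟩ := exists_toComplex (f := 𝓕⁻ f) (by
    have h1 := fourier_conjL (𝓕⁻ f : HC)
    rw [FourierTransform.fourier_fourierInv_eq, h] at h1
    rw [← FourierTransform.fourierInv_fourier_eq (E := HC) (F := HC) (conjL (𝓕⁻ f : HC)), h1])
  exact ⟨u, by rw [hat, hu, FourierTransform.fourier_fourierInv_eq]⟩

/-! ### Sobolev norms -/

lemma normH_eq (s : ℝ) (u : L2) : normH s u = (hs s (hat u)).toReal := by
  rw [normH, eLpNorm_eq_lintegral_rpow_enorm_toReal two_ne_zero ENNReal.ofNat_ne_top, hs, N2]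
  congr 2
  · refine lintegral_congr fun ξ => ?_
    rw [enorm_mul, ewt]
    change (‖((wt s ξ : ℝ) : ℂ)‖ₑ * _) ^ _ = _
    rw [← ofReal_norm ((wt s ξ : ℝ) : ℂ), Complex.norm_real, Real.norm_of_nonneg (wt_pos s ξ).le]
    simp [hat]

lemma temperate_weight (s : ℝ) :
    (fun x : Plane => ((((1 + ‖x‖ ^ 2) ^ (s / 2) : ℝ)) : ℂ)).HasTemperateGrowth := by
  fun_prop

/-- The Sobolev space is defined with the weight (1 + |ξ|²)^(s/2), without 2π; the two weights agree
up to the factor (2π)^s. The identity of distributions becomes one almost everywhere by testing with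
smooth functions of compact support. -/
lemma memH_iff {s : ℝ} (hs0 : 0 ≤ s) (u : L2) : MemH s u ↔ hs s (hat u) < ⊤ := by
  have hpi := Real.pi_pos
  rw [MemH, TemperedDistribution.memSobolev_iff_exists_smulLeftCLM_fourier,
    Lp.fourier_toTemperedDistribution_eq]
  change (∃ f' : HC, _ = Lp.toTemperedDistribution f') ↔ _
  have key : ∀ φ : 𝓢(Plane, ℂ), (TemperedDistribution.smulLeftCLM ℂ
      (fun x : Plane => ((((1 + ‖x‖ ^ 2) ^ (s / 2) : ℝ)) : ℂ))
      (Lp.toTemperedDistribution (hat u))) φ =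
      ∫ x, φ x • ((((1 + ‖x‖ ^ 2) ^ (s / 2) : ℝ) : ℂ) * hat u x) := fun φ => by
    rw [TemperedDistribution.smulLeftCLM_apply_apply, Lp.toTemperedDistribution_apply]
    refine integral_congr_ae (Eventually.of_forall fun x => ?_)
    simp only [SchwartzMap.smulLeftCLM_apply_apply (temperate_weight s), smul_eq_mul]
    ring
  have hcont : Continuous fun x : Plane => ((((1 + ‖x‖ ^ 2) ^ (s / 2) : ℝ)) : ℂ) :=
    Complex.continuous_ofReal.comp
      (Continuous.rpow_const (by fun_prop) fun x => Or.inl (by positivity))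
  constructor
  · rintro ⟨f', hf'⟩
    have hae : ∀ᵐ x, (((1 + ‖x‖ ^ 2) ^ (s / 2) : ℝ) : ℂ) * hat u x - f' x = 0 := by
      refine ae_eq_zero_of_integral_contDiff_smul_eq_zero ?_ fun g hg hgc => ?_
      · refine LocallyIntegrable.sub ?_ ((Lp.memLp f').locallyIntegrable (by norm_num))
        exact ((Lp.memLp (hat u)).locallyIntegrable (by norm_num)).continuous_mul hcont
      · have hg₁ : HasCompactSupport (Complex.ofRealCLM ∘ g) := hgc.comp_left rfl
        have hg₂ : ContDiff ℝ ((⊤ : ℕ∞) : WithTop ℕ∞) (Complex.ofRealCLM ∘ g) := by fun_prop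
        have h1 := key (hg₁.toSchwartzMap hg₂)
        rw [hat, hf', Lp.toTemperedDistribution_apply] at h1
        have h2 : (hg₁.toSchwartzMap hg₂ : 𝓢(Plane, ℂ)) = fun x => ((g x : ℝ) : ℂ) := rfl
        rw [h2] at h1
        have hwl := ((Lp.memLp (hat u)).locallyIntegrable (by norm_num)).continuous_mul hcont
        have i1 := hwl.integrable_smul_left_of_hasCompactSupport hg.continuous hgc
        have i2 := ((Lp.memLp f').locallyIntegrable
          (by norm_num)).integrable_smul_left_of_hasCompactSupport hg.continuous hgc
        simp_rw [smul_sub]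
        rw [integral_sub i1 i2, sub_eq_zero]
        simpa only [smul_eq_mul, Complex.real_smul, hat] using h1.symm
    have hle : hs s (hat u) ≤ ENNReal.ofReal ((2 * Real.pi) ^ s) * ‖f'‖ₑ := by
      rw [HC.enorm_eq, hs, ← N2_const_mul _ ENNReal.ofReal_ne_top]
      refine N2_mono ?_
      filter_upwards [hae] with ξ hξ
      rw [← sub_eq_zero.1 hξ, enorm_mul, ← mul_assoc, ewt, ← ofReal_norm
        ((((1 + ‖ξ‖ ^ 2) ^ (s / 2) : ℝ)) : ℂ), Complex.norm_real,
        Real.norm_of_nonneg (by positivity), ← ENNReal.ofReal_mul (by positivity)]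
      gcongr
      rw [wt]
      calc (1 + (2 * Real.pi * ‖ξ‖) ^ 2) ^ (s / 2)
          ≤ ((2 * Real.pi) ^ 2 * (1 + ‖ξ‖ ^ 2)) ^ (s / 2) := by
            gcongr
            nlinarith [Real.pi_gt_three]
        _ = (2 * Real.pi) ^ s * (1 + ‖ξ‖ ^ 2) ^ (s / 2) := by
            rw [Real.mul_rpow (by positivity) (by positivity), ← Real.rpow_natCast,
              ← Real.rpow_mul (by positivity)]
            congr 2; push_cast; ring
    exact hle.trans_lt (ENNReal.mul_lt_top ENNReal.ofReal_lt_top enorm_lt_top)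
  · intro h
    have hmem : MemLp (fun ξ => (((1 + ‖ξ‖ ^ 2) ^ (s / 2) : ℝ) : ℂ) * hat u ξ) 2 volume := by
      refine memLp_two_of_N2 (hcont.measurable.mul (hat u).measurable) (lt_of_le_of_lt ?_ h)
      refine N2_mono (Eventually.of_forall fun ξ => ?_)
      rw [enorm_mul, ewt, ← ofReal_norm ((((1 + ‖ξ‖ ^ 2) ^ (s / 2) : ℝ)) : ℂ), Complex.norm_real,
        Real.norm_of_nonneg (by positivity)]
      gcongr
      rw [wt]
      gcongr
      nlinarith [Real.pi_gt_three, norm_nonneg ξ]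
    refine ⟨hmem.toLp, ?_⟩
    ext φ
    refine (key φ).trans ?_
    rw [Lp.toTemperedDistribution_apply]
    refine integral_congr_ae ?_
    filter_upwards [hmem.coeFn_toLp] with x hx
    rw [hx]

/-! ### Fourier transforms of test functions -/

/-- The Fourier transform of a real test function. -/
def sh (φ : 𝓢(Plane, ℝ)) : 𝓢(Plane, ℂ) := 𝓕 (cx φ)

lemma sh_add (φ ψ : 𝓢(Plane, ℝ)) : sh (φ + ψ) = sh φ + sh ψ := by
  have : cx (φ + ψ) = cx φ + cx ψ := by ext x; simp [cx_apply]
  rw [sh, this, FourierTransform.fourier_add]; rfl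

lemma sh_smul (r : ℝ) (φ : 𝓢(Plane, ℝ)) (ξ : Plane) : sh (r • φ) ξ = (r : ℂ) * sh φ ξ := by
  have : cx (r • φ) = (r : ℂ) • cx φ := by ext x; simp [cx_apply]
  rw [sh, this, FourierTransform.fourier_smul]; rfl

lemma cx_pd (j : Fin 2) (φ : 𝓢(Plane, ℝ)) :
    cx (pd j φ) = ∂_{(EuclideanSpace.single j 1 : Plane)} (cx φ) := by
  ext x
  rw [cx_apply, pd, SchwartzMap.lineDerivOp_apply_eq_fderiv,
    SchwartzMap.lineDerivOp_apply_eq_fderiv]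
  have h : HasFDerivAt (cx φ) (Complex.ofRealCLM.comp (fderiv ℝ φ x)) x :=
    Complex.ofRealCLM.hasFDerivAt.comp x (φ.differentiableAt).hasFDerivAt
  rw [h.fderiv]; rfl

lemma sh_pd (j : Fin 2) (φ : 𝓢(Plane, ℝ)) (ξ : Plane) :
    sh (pd j φ) ξ = Complex.I * freq j ξ * sh φ ξ := by
  have : (inner ℝ · (EuclideanSpace.single j 1 : Plane)).HasTemperateGrowth := by fun_prop
  rw [sh, cx_pd, SchwartzMap.fourier_lineDerivOp_eq]
  change (2 * Real.pi * Complex.I : ℂ) • (SchwartzMap.smulLeftCLM ℂ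
    (inner ℝ · (EuclideanSpace.single j 1 : Plane)) (𝓕 (cx φ))) ξ = _
  rw [SchwartzMap.smulLeftCLM_apply_apply this]
  simp [freq, EuclideanSpace.inner_single_right, sh]
  ring

lemma sh_laplacian (φ : 𝓢(Plane, ℝ)) (ξ : Plane) :
    sh (Δ φ) ξ = -(((2 * Real.pi * ‖ξ‖) ^ 2 : ℝ) : ℂ) * sh φ ξ := by
  have h : Δ φ = pd 0 (pd 0 φ) + pd 1 (pd 1 φ) := by
    rw [SchwartzMap.laplacian_eq_sum (EuclideanSpace.basisFun (Fin 2) ℝ), Fin.sum_univ_two]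
    simp [pd]
  have h2 : (2 * Real.pi * ‖ξ‖) ^ 2 = freq 0 ξ ^ 2 + freq 1 ξ ^ 2 := by
    rw [mul_pow, EuclideanSpace.norm_sq_eq, Fin.sum_univ_two, Real.norm_eq_abs, Real.norm_eq_abs,
      sq_abs, sq_abs, freq, freq]
    ring
  rw [h, sh_add, h2]
  change sh _ ξ + sh _ ξ = _
  simp only [sh_pd]
  push_cast
  linear_combination (freq 0 ξ ^ 2 + freq 1 ξ ^ 2 : ℂ) * sh φ ξ * Complex.I_mul_I

lemma wt_four (ξ : Plane) : wt 4 ξ = (1 + (2 * Real.pi * ‖ξ‖) ^ 2) ^ 2 := by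
  rw [show (4 : ℝ) = 2 + 2 by norm_num, wt_add, wt_two]; ring

lemma temperate_wt_four : (fun ξ : Plane => ((wt 4 ξ : ℝ) : ℂ)).HasTemperateGrowth := by
  simp_rw [wt_four, mul_pow]
  fun_prop

/-- The element of `L²` representing a test function on the Fourier side, in the pairing
weighted by `wt (-4)`. -/
def testW (φ : 𝓢(Plane, ℝ)) : HC :=
  (SchwartzMap.smulLeftCLM ℂ (fun ξ : Plane => ((wt 4 ξ : ℝ) : ℂ)) (sh φ)).toLp 2

lemma testW_coe (φ : 𝓢(Plane, ℝ)) : testW φ =ᵐ[volume] fun ξ => (wt 4 ξ : ℂ) * sh φ ξ := by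
  filter_upwards [SchwartzMap.coeFn_toLp
    (SchwartzMap.smulLeftCLM ℂ (fun ξ : Plane => ((wt 4 ξ : ℝ) : ℂ)) (sh φ)) 2 volume] with ξ h
  rw [testW, h, SchwartzMap.smulLeftCLM_apply_apply temperate_wt_four]; rfl

lemma inner_mulL_eq {Φ Ψ f : HC} {m n : Plane → ℂ} (hm : Bdd m) (hn : Bdd n)
    (h : ∀ᵐ ξ, (starRingEnd ℂ) (Φ ξ) * m ξ = (starRingEnd ℂ) (Ψ ξ) * n ξ) :
    inner ℝ Φ (mulL m f) = inner ℝ Ψ (mulL n f) := by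
  rw [HC.inner_eq, HC.inner_eq]
  refine integral_congr_ae ?_
  filter_upwards [h, mulL_coe hm f, mulL_coe hn f] with ξ h h1 h2
  rw [h1, h2, ← mul_assoc, ← mul_assoc, h]

lemma inner_convT_eq {Φ Ψ f g : HC} {m n : Plane → ℂ} (hm : SqInt m) (hn : SqInt n)
    (h : ∀ᵐ ξ, (starRingEnd ℂ) (Φ ξ) * m ξ = (starRingEnd ℂ) (Ψ ξ) * n ξ) :
    inner ℝ Φ (convT m f g) = inner ℝ Ψ (convT n f g) := by
  rw [HC.inner_eq, HC.inner_eq]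
  refine integral_congr_ae ?_
  filter_upwards [h, convT_coe hm f g, convT_coe hn f g] with ξ h h1 h2
  rw [h1, h2, ← mul_assoc, ← mul_assoc, h]

lemma sqInt_wt_neg : SqInt (rs (wt (-4))) := by
  refine ⟨measurable_rs (measurable_wt _), lt_of_le_of_lt (le_of_eq ?_)
    (wienerC_lt_top (s := 4) (by norm_num))⟩
  rw [wienerC]
  refine N2_congr (Eventually.of_forall fun ξ => ?_)
  rw [← ofReal_norm, norm_rs, abs_of_pos (wt_pos _ _), ewt]

lemma inner_fourier (f g : HC) : inner ℝ (𝓕 f : HC) (𝓕 g : HC) = inner ℝ f g := by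
  rw [real_inner_eq_norm_add_mul_self_sub_norm_mul_self_sub_norm_mul_self_div_two,
    real_inner_eq_norm_add_mul_self_sub_norm_mul_self_sub_norm_mul_self_div_two,
    ← FourierTransform.fourier_add, Lp.norm_fourier_eq, Lp.norm_fourier_eq, Lp.norm_fourier_eq]

lemma wt_mul_wt_neg (r : ℝ) (ξ : Plane) : wt r ξ * wt (-r) ξ = 1 := by
  rw [mul_comm, wt_neg_mul]

/-- The factors `wt 4` and `wt (-4)` cancel, and Plancherel's identity remains. -/
lemma inner_testW_mulL (φ : 𝓢(Plane, ℝ)) (f : HC) :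
    inner ℝ (testW φ) (mulL (rs (wt (-4))) (𝓕 f)) = inner ℝ ((cx φ).toLp 2) f := by
  rw [← inner_fourier ((cx φ).toLp 2 volume) f, SchwartzMap.toLp_fourier_eq, HC.inner_eq, HC.inner_eq]
  refine integral_congr_ae ?_
  filter_upwards [testW_coe φ, mulL_coe bdd_wt_neg (𝓕 f), SchwartzMap.coeFn_toLp (sh φ) 2 volume]
    with ξ h1 h2 h3
  change ((starRingEnd ℂ) (testW φ ξ) * mulL (rs (wt (-4))) (𝓕 f) ξ).re =
    ((starRingEnd ℂ) ((sh φ).toLp 2 volume ξ) * (𝓕 f : HC) ξ).re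
  rw [h1, h2, h3, map_mul, Complex.conj_ofReal, rs]
  congr 1
  have : (wt 4 ξ : ℂ) * wt (-4) ξ = 1 := by exact_mod_cast wt_mul_wt_neg 4 ξ
  linear_combination (starRingEnd ℂ) (sh φ ξ) * (𝓕 f : HC) ξ * this

/-- The pointwise product of Schwartz functions. -/
def sprod (f g : 𝓢(Plane, ℂ)) : 𝓢(Plane, ℂ) := SchwartzMap.pairing (ContinuousLinearMap.mul ℂ ℂ) f g

/-- The formula for the transform of a convolution is applied to the inverse transforms of f and g,
and then reflected in ξ. -/
lemma fourier_sprod (f g : 𝓢(Plane, ℂ)) (ξ : Plane) :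
    (𝓕 (sprod f g) : 𝓢(Plane, ℂ)) ξ =
      conv (𝓕 f : 𝓢(Plane, ℂ)) (𝓕 g : 𝓢(Plane, ℂ)) ξ := by
  have hneg : ∀ (h : 𝓢(Plane, ℂ)) (x : Plane),
      (𝓕 h : 𝓢(Plane, ℂ)) x = (𝓕⁻ h : 𝓢(Plane, ℂ)) (-x) := fun h x => by
    rw [SchwartzMap.fourier_coe, SchwartzMap.fourierInv_coe, Real.fourierInv_eq_fourier_neg,
      neg_neg]
  have h1 : sprod f g = 𝓕 (SchwartzMap.convolution (ContinuousLinearMap.mul ℂ ℂ)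
      (𝓕⁻ f : 𝓢(Plane, ℂ)) (𝓕⁻ g : 𝓢(Plane, ℂ))) := by
    rw [SchwartzMap.fourier_convolution, FourierTransform.fourier_fourierInv_eq,
      FourierTransform.fourier_fourierInv_eq, sprod]
  rw [h1, hneg, FourierTransform.fourierInv_fourier_eq, SchwartzMap.convolution_apply,
    MeasureTheory.convolution, conv, ← integral_neg_eq_self]
  refine integral_congr_ae (Eventually.of_forall fun ζ => ?_)
  simp only [ContinuousLinearMap.mul_apply', hneg]
  congr 2
  abel

/-- Both sides are continuous in (f, g) on L² × L². On Schwartz functions the identity combines the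
convolution theorem with `inner_testW_mulL`. -/
lemma inner_testW_convT (φ : 𝓢(Plane, ℝ)) (f g : HC) :
    inner ℝ (testW φ) (convT (rs (wt (-4))) (𝓕 f) (𝓕 g)) =
      ∫ x, (f x * g x).re * φ x := by
  have hb : Bdd (cx φ) := by
    refine ⟨(cx φ).continuous.measurable, SchwartzMap.seminorm ℝ 0 0 (cx φ), fun ξ =>
      SchwartzMap.norm_le_seminorm ℝ (cx φ) ξ⟩
  suffices h : inner ℝ (testW φ) (convT (rs (wt (-4))) (𝓕 f) (𝓕 g)) =
      inner ℝ (conjL f) (mulL (cx φ) g) by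
    rw [h, HC.inner_eq]
    refine integral_congr_ae ?_
    filter_upwards [conjL_coe f, mulL_coe hb g] with x h1 h2
    rw [h1, h2, Complex.conj_conj, cx_apply, mul_left_comm, Complex.re_ofReal_mul, mul_comm]
  have hd := SchwartzMap.denseRange_toLpCLM (F := ℂ) (μ := (volume : Measure Plane)) (p := 2)
      ENNReal.ofNat_ne_top
  refine DenseRange.induction_on₂ (p := fun f g => inner ℝ (testW φ)
    (convT (rs (wt (-4))) (𝓕 f) (𝓕 g)) = inner ℝ (conjL f) (mulL (cx φ) g)) hd
    (isClosed_eq ?_ ?_) (fun f g => ?_) f g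
  · refine Continuous.inner continuous_const (Continuous.clm_apply ?_ ?_)
    · exact (convT (rs (wt (-4)))).continuous.comp (continuous_fourier_HC.comp continuous_fst)
    · exact continuous_fourier_HC.comp continuous_snd
  · exact Continuous.inner (conjL.continuous.comp continuous_fst)
      ((mulL (cx φ)).continuous.comp continuous_snd)
  · rw [SchwartzMap.toLpCLM_apply, SchwartzMap.toLpCLM_apply]
    have h1 : inner ℝ (conjL (f.toLp 2)) (mulL (cx φ) (g.toLp 2)) =
        inner ℝ ((cx φ).toLp 2 : HC) ((sprod f g).toLp 2) := by
      rw [HC.inner_eq, HC.inner_eq]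
      refine integral_congr_ae ?_
      filter_upwards [conjL_coe (f.toLp 2), mulL_coe hb (g.toLp 2), f.coeFn_toLp 2 volume,
        g.coeFn_toLp 2 volume, (cx φ).coeFn_toLp 2 volume, (sprod f g).coeFn_toLp 2 volume]
        with x h1 h2 h3 h4 h5 h6
      rw [h1, h2, h3, h4, h5, h6, Complex.conj_conj, cx_apply, Complex.conj_ofReal, mul_left_comm]
      rfl
    rw [h1, ← inner_testW_mulL, SchwartzMap.toLp_fourier_eq, SchwartzMap.toLp_fourier_eq,
      SchwartzMap.toLp_fourier_eq]
    congr 1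
    apply Lp.ext
    filter_upwards [convT_coe sqInt_wt_neg ((𝓕 f : 𝓢(Plane, ℂ)).toLp 2)
        ((𝓕 g : 𝓢(Plane, ℂ)).toLp 2),
      mulL_coe bdd_wt_neg ((𝓕 (sprod f g) : 𝓢(Plane, ℂ)).toLp 2),
      (𝓕 (sprod f g) : 𝓢(Plane, ℂ)).coeFn_toLp 2 volume] with ξ h1 h2 h3
    rw [h1, h2, h3, fourier_sprod, conv_congr ((𝓕 f : 𝓢(Plane, ℂ)).coeFn_toLp 2 volume)
      ((𝓕 g : 𝓢(Plane, ℂ)).coeFn_toLp 2 volume)]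

lemma integral_mul_eq (u : L2) (φ : 𝓢(Plane, ℝ)) :
    ∫ x, u x * φ x = inner ℝ (testW φ) (mulL (rs (wt (-4))) (hat u)) := by
  rw [hat, inner_testW_mulL, HC.inner_eq]
  refine integral_congr_ae ?_
  filter_upwards [toComplex_coe u, (cx φ).coeFn_toLp 2 volume] with x h1 h2
  rw [h1, h2, cx_apply, Complex.conj_ofReal, Complex.re_ofReal_mul, Complex.ofReal_re, mul_comm]

lemma integral_mul_mul_eq (u v : L2) (φ : 𝓢(Plane, ℝ)) :
    ∫ x, u x * v x * φ x = inner ℝ (testW φ) (convT (rs (wt (-4))) (hat u) (hat v)) := by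
  rw [hat, hat, inner_testW_convT]
  refine integral_congr_ae ?_
  filter_upwards [toComplex_coe u, toComplex_coe v] with x h1 h2
  rw [h1, h2, Complex.re_ofReal_mul, Complex.ofReal_re]

lemma integrable_mul_test (u : L2) (φ : 𝓢(Plane, ℝ)) : Integrable fun x => u x * φ x :=
  MemLp.integrable_mul (Lp.memLp u) (φ.memLp 2 volume)

lemma integrable_mul_mul_test (u v : L2) (φ : 𝓢(Plane, ℝ)) :
    Integrable fun x => u x * v x * φ x :=
  (MemLp.integrable_mul (Lp.memLp u) (Lp.memLp v)).mul_bdd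
    φ.continuous.aestronglyMeasurable
    (Eventually.of_forall fun x => SchwartzMap.norm_le_seminorm ℝ φ x)

/-! ### Separation by test functions -/

lemma sh_conj (φ : 𝓢(Plane, ℝ)) (ξ : Plane) : (starRingEnd ℂ) (sh φ (-ξ)) = sh φ ξ := by
  have : SchwartzMap.postcompCLM Complex.conjCLE.toContinuousLinearMap (cx φ) = cx φ := by
    ext x; exact Complex.conj_ofReal _
  rw [sh, ← fourier_conj_apply, this]

/-- The two real functions are the real and imaginary parts of the inverse transform. -/
lemma exists_sh (ψ : 𝓢(Plane, ℂ)) :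
    ∃ φ₁ φ₂ : 𝓢(Plane, ℝ), ∀ ξ, ψ ξ = sh φ₁ ξ + Complex.I * sh φ₂ ξ := by
  set f : 𝓢(Plane, ℂ) := 𝓕⁻ ψ with hf
  set φ₁ := SchwartzMap.postcompCLM Complex.reCLM f
  set φ₂ := SchwartzMap.postcompCLM Complex.imCLM f
  have h : f = cx φ₁ + Complex.I • cx φ₂ := by
    ext x
    change f x = ((f x).re : ℂ) + Complex.I * ((f x).im : ℂ)
    rw [mul_comm, Complex.re_add_im]
  have h2 : ψ = sh φ₁ + Complex.I • sh φ₂ := by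
    rw [sh, sh, ← FourierTransform.fourier_smul, ← FourierTransform.fourier_add, ← h, hf,
      FourierTransform.fourier_fourierInv_eq]
  exact ⟨φ₁, φ₂, fun ξ => by rw [h2]; rfl⟩

/-- Real test functions give only the real part of the pairing. Hermitian symmetry makes the pairing
real, so it vanishes altogether, and by `exists_sh` complex test functions on the Fourier side are
then available too. -/
lemma eq_zero_of_inner_test {Θ : 𝓢(Plane, ℝ) → HC} {w : Plane → ℝ} (hw : Continuous w)
    (hw0 : ∀ ξ, w ξ ≠ 0) (hwn : ∀ ξ, w (-ξ) = w ξ)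
    (hΘ : ∀ φ, Θ φ =ᵐ[volume] fun ξ => (w ξ : ℂ) * sh φ ξ) {h : HC} (hr : refl h = h)
    (hh : ∀ φ, inner ℝ (Θ φ) h = 0) : h = 0 := by
  have hint : ∀ φ, Integrable fun ξ => (starRingEnd ℂ) (Θ φ ξ) * h ξ := fun φ => by
    simpa only [RCLike.inner_apply, mul_comm] using L2.integrable_inner (𝕜 := ℂ) (Θ φ) h
  have hc : ∀ φ, ∫ ξ, (starRingEnd ℂ) (Θ φ ξ) * h ξ = 0 := fun φ => by
    set J := ∫ ξ, (starRingEnd ℂ) (Θ φ ξ) * h ξ with hJ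
    have hre : J.re = 0 := by
      rw [← hh φ, HC.inner_eq, hJ]
      exact (Complex.reCLM.integral_comp_comm (hint φ)).symm
    have him : (starRingEnd ℂ) J = J := by
      rw [hJ, ← integral_conj, ← integral_neg_eq_self]
      refine integral_congr_ae ?_
      have h1 := refl_coe h
      rw [hr] at h1
      filter_upwards [h1, hΘ φ, ae_neg (hΘ φ)] with ξ h1 h2 h3
      rw [map_mul, ← h1, h2, h3, hwn, map_mul, map_mul, map_mul, sh_conj]
      simp only [Complex.conj_ofReal]
    exact Complex.ext hre (Complex.conj_eq_iff_im.1 him)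
  have hwc : Continuous fun ξ => (w ξ : ℂ) := Complex.continuous_ofReal.comp hw
  have hae : ∀ᵐ ξ, (w ξ : ℂ) * h ξ = 0 := by
    refine ae_eq_zero_of_integral_contDiff_smul_eq_zero
      (((Lp.memLp h).locallyIntegrable (by norm_num)).continuous_mul hwc) fun g hg hgc => ?_
    have hg₁ : HasCompactSupport (Complex.ofRealCLM ∘ g) := hgc.comp_left rfl
    have hg₂ : ContDiff ℝ ((⊤ : ℕ∞) : WithTop ℕ∞) (Complex.ofRealCLM ∘ g) := by fun_prop
    obtain ⟨φ₁, φ₂, hφ⟩ := exists_sh (hg₁.toSchwartzMap hg₂)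
    have hφ' : ∀ ξ, ((g ξ : ℝ) : ℂ) = sh φ₁ ξ + Complex.I * sh φ₂ ξ := hφ
    have e : (fun ξ => g ξ • ((w ξ : ℂ) * h ξ)) =ᵐ[volume] fun ξ =>
        (starRingEnd ℂ) (Θ φ₁ ξ) * h ξ - Complex.I * ((starRingEnd ℂ) (Θ φ₂ ξ) * h ξ) := by
      filter_upwards [hΘ φ₁, hΘ φ₂] with ξ h1 h2
      rw [h1, h2, Complex.real_smul, ← Complex.conj_ofReal (g ξ), hφ']
      simp only [map_add, map_mul, Complex.conj_I, Complex.conj_ofReal]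
      ring
    rw [integral_congr_ae e, integral_sub (hint φ₁) ((hint φ₂).const_mul _), integral_const_mul,
      hc, hc]
    simp
  apply Lp.ext
  filter_upwards [hae, Lp.coeFn_zero ℂ 2 (volume : Measure Plane)] with ξ h1 h2
  rw [h2]
  simpa [hw0 ξ] using h1

/-- A curve which has a continuous derivative when tested with a separating family of functionals
has that derivative. -/
lemma hasDerivWithinAt_of_weak {E : Type*} [NormedAddCommGroup E] [NormedSpace ℝ E]
    [CompleteSpace E] {Y G : ℝ → E} {T : ℝ} (hG : ContinuousOn G (Icc 0 T))
    (S : Set (E →L[ℝ] ℝ)) (A : E →L[ℝ] E) (hS : ∀ x, A x = 0 → (∀ ℓ ∈ S, ℓ x = 0) → x = 0)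
    (hAY : ∀ t ∈ Icc 0 T, A (Y t) = 0) (hAG : ∀ t ∈ Icc 0 T, A (G t) = 0)
    (hd : ∀ ℓ ∈ S, ∀ t ∈ Icc 0 T, HasDerivWithinAt (fun τ => ℓ (Y τ)) (ℓ (G t)) (Icc 0 T) t) :
    ∀ t ∈ Icc 0 T, HasDerivWithinAt Y (G t) (Icc 0 T) t := by
  intro t₀ ht₀
  have hT : 0 ≤ T := ht₀.1.trans ht₀.2
  have h0 : (0 : ℝ) ∈ Icc 0 T := ⟨le_rfl, hT⟩
  set G' : ℝ → E := fun t => G (projIcc 0 T hT t) with hG'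
  have hGc : Continuous G' :=
    (continuousOn_iff_continuous_domRestrict.1 hG).comp (continuous_projIcc (h := hT))
  have e : ∀ t ∈ Icc 0 T, G' t = G t := fun t ht => by simp only [hG', projIcc_of_mem hT ht]
  -- Z is the primitive of G that starts at Y 0. Each functional is constant along Y - Z, and Y - Z
  -- stays in the kernel of A, where the functionals separate points.
  set Z : ℝ → E := fun t => Y 0 + ∫ τ in (0 : ℝ)..t, G' τ with hZ
  have hZd : ∀ t, HasDerivAt Z (G' t) t := fun t =>
    (hGc.integral_hasStrictDerivAt 0 t).hasDerivAt.const_add _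
  have hYZ : ∀ t ∈ Icc 0 T, Y t = Z t := fun t ht => by
    rw [← sub_eq_zero]
    refine hS _ ?_ fun ℓ hℓ => ?_
    · have : A (∫ τ in (0 : ℝ)..t, G' τ) = 0 := by
        rw [← A.intervalIntegral_comp_comm (hGc.intervalIntegrable _ _)]
        have : ∀ τ, A (G' τ) = 0 := fun τ => hAG _ (projIcc 0 T hT τ).2
        simp [this]
      rw [map_sub, hAY t ht, hZ, map_add, hAY 0 h0, this]; simp
    · have hdd : ∀ τ ∈ Icc 0 T,
          HasDerivWithinAt (fun τ => ℓ (Y τ) - ℓ (Z τ)) 0 (Icc 0 T) τ := fun τ hτ => by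
        have h1 := ℓ.hasFDerivAt.comp_hasDerivWithinAt τ (hZd τ).hasDerivWithinAt (s := Icc 0 T)
        rw [e τ hτ] at h1
        have h2 := (hd ℓ hℓ τ hτ).sub h1
        rw [sub_self] at h2
        exact h2
      have h2 := (convex_Icc (0 : ℝ) T).norm_image_sub_le_of_norm_hasDerivWithin_le (C := 0) hdd
        (fun τ _ => by simp) h0 ht
      rw [zero_mul, norm_le_zero_iff, sub_eq_zero] at h2
      rw [map_sub, h2]
      simp [hZ]
  rw [← e t₀ ht₀]
  exact (hZd t₀).hasDerivWithinAt.congr (fun t ht => hYZ t ht) (hYZ t₀ ht₀)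

/-! ### The system in physical space and on the Fourier side -/

/-- The Fourier transforms of all components. -/
def hatX (η : L2) (v : Fin 2 → L2) : X := (hat η, fun j => hat (v j))

/-- `normH` turns an infinite norm into zero, so convergence of the real-valued norms carries
information only together with finiteness at all times. -/
lemma continuousInH_iff {s T : ℝ} (hs0 : 0 ≤ s) (u : ℝ → L2) : ContinuousInH s T u ↔
    (∀ t ∈ Icc 0 T, hs s (hat (u t)) < ⊤) ∧
    ∀ t ∈ Icc 0 T, Tendsto (fun τ => hs s (hat (u τ) - hat (u t))) (𝓝[Icc 0 T] t) (𝓝 0) := by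
  have key : (∀ t ∈ Icc 0 T, hs s (hat (u t)) < ⊤) → ∀ t ∈ Icc 0 T,
      (Tendsto (fun τ => normH s (u τ - u t)) (𝓝[Icc 0 T] t) (𝓝 0) ↔
      Tendsto (fun τ => hs s (hat (u τ) - hat (u t))) (𝓝[Icc 0 T] t) (𝓝 0)) := fun h t ht => by
    simp_rw [normH_eq, hat_sub]
    constructor
    · intro h1
      have h2 := ENNReal.tendsto_ofReal h1
      rw [ENNReal.ofReal_zero] at h2
      refine h2.congr' (eventually_mem_nhdsWithin.mono fun τ hτ => ENNReal.ofReal_toReal ?_)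
      exact ((hs_sub_le s _ _).trans_lt (ENNReal.add_lt_top.2 ⟨h τ hτ, h t ht⟩)).ne
    · intro h1
      exact (ENNReal.tendsto_toReal ENNReal.zero_ne_top).comp h1
  simp only [ContinuousInH, memH_iff hs0]
  constructor
  · intro h
    exact ⟨fun t ht => (h t ht).1, fun t ht => (key (fun t ht => (h t ht).1) t ht).1 (h t ht).2⟩
  · rintro ⟨h1, h2⟩ t ht
    exact ⟨h1 t ht, (key h1 t ht).2 (h2 t ht)⟩

namespace Par

variable (p : Par)

/-- The test function by which the second equation is tested after inversion of `1 - ε d Δ`. -/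
def dtest (φ : 𝓢(Plane, ℝ)) : 𝓢(Plane, ℝ) := φ - (p.ε * p.d) • Δ φ

lemma sh_dtest (φ : 𝓢(Plane, ℝ)) (ξ : Plane) : sh (p.dtest φ) ξ = (p.de ξ : ℂ) * sh φ ξ := by
  have : p.dtest φ = φ + (-(p.ε * p.d)) • Δ φ := by rw [dtest, neg_smul, sub_eq_add_neg]
  rw [this, sh_add]
  change sh φ ξ + sh _ ξ = _
  rw [sh_smul, sh_laplacian, de]
  push_cast; ring

lemma testW_dtest_coe (φ : 𝓢(Plane, ℝ)) :
    testW (p.dtest φ) =ᵐ[volume] fun ξ => ((wt 4 ξ * p.de ξ : ℝ) : ℂ) * sh φ ξ := by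
  filter_upwards [testW_coe (p.dtest φ)] with ξ h
  rw [h, sh_dtest]; push_cast; ring

/-- The signs from moving an odd number of derivatives to the test function are those of the factor
-i in `sym`, since the inner product conjugates its first argument. -/
lemma integral_fst_eq (η : L2) (v : Fin 2 → L2) (φ : 𝓢(Plane, ℝ)) :
    ∫ x, ∑ j, (v j x * pd j φ x +
        p.ε * (η x * v j x * pd j φ x + p.a * v j x * pd j (Δ φ) x)) =
      inner ℝ (testW φ) (p.F (wt (-4)) (hatX η v)).1 := by
  have hpt : ∀ j x, v j x * pd j φ x +
        p.ε * (η x * v j x * pd j φ x + p.a * v j x * pd j (Δ φ) x) =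
      v j x * (pd j φ + (p.ε * p.a) • pd j (Δ φ)) x + p.ε * (η x * v j x * pd j φ x) :=
    fun j x => by
      change _ = v j x * (pd j φ x + (p.ε * p.a) * pd j (Δ φ) x) + _
      ring
  simp_rw [hpt]
  have hi : ∀ j, Integrable fun x => v j x * (pd j φ + (p.ε * p.a) • pd j (Δ φ)) x +
      p.ε * (η x * v j x * pd j φ x) := fun j =>
    (integrable_mul_test (v j) _).add ((integrable_mul_mul_test η (v j) _).const_mul _)
  rw [integral_finsetSum _ fun j _ => hi j]
  simp only [F, hatX, inner_sum, inner_add_right]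
  refine Finset.sum_congr rfl fun j _ => ?_
  rw [integral_add (integrable_mul_test (v j) _) ((integrable_mul_mul_test η (v j) _).const_mul _),
    integral_const_mul, integral_mul_eq, integral_mul_mul_eq]
  congr 1
  · refine inner_mulL_eq bdd_wt_neg (p.bdd_al adm_wt j) ?_
    filter_upwards [testW_coe (pd j φ + (p.ε * p.a) • pd j (Δ φ)), testW_coe φ] with ξ h1 h2
    have : sh (pd j φ + (p.ε * p.a) • pd j (Δ φ)) ξ =
        sh (pd j φ) ξ + sh ((p.ε * p.a) • pd j (Δ φ)) ξ := by rw [sh_add]; rfl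
    rw [h1, h2, this, sh_smul, sh_pd, sh_pd, sh_laplacian, rs, sym, al]
    simp only [map_add, map_mul, map_neg, Complex.conj_I, Complex.conj_ofReal]
    push_cast; ring
  · rw [← real_inner_smul_left]
    refine inner_convT_eq sqInt_wt_neg (p.sqInt_eps adm_wt j) ?_
    filter_upwards [testW_coe (pd j φ), testW_coe φ, Lp.coeFn_smul p.ε (testW (pd j φ))]
      with ξ h1 h2 h3
    rw [h3, Pi.smul_apply, h1, h2, sh_pd, rs, sym, Complex.real_smul]
    simp only [map_mul, Complex.conj_I, Complex.conj_ofReal]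
    push_cast; ring

lemma integral_dtest_eq (u : L2) (φ : 𝓢(Plane, ℝ)) :
    ∫ x, u x * (φ x - p.ε * p.d * (Δ φ) x) =
      inner ℝ (testW (p.dtest φ)) (mulL (rs (wt (-4))) (hat u)) :=
  integral_mul_eq u (p.dtest φ)

/-- The factor de in the transform of `dtest φ` cancels the denominators by which the equation for v
was divided. -/
lemma integral_snd_eq (η : L2) (v : Fin 2 → L2) (φ : 𝓢(Plane, ℝ)) (i : Fin 2) :
    ∫ x, (η x * pd i φ x +
        p.ε * ((1 / 2) * (∑ j, v j x ^ 2) * pd i φ x + p.c * η x * pd i (Δ φ) x)) =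
      inner ℝ (testW (p.dtest φ)) ((p.F (wt (-4)) (hatX η v)).2 i) := by
  have hpt : ∀ x, η x * pd i φ x +
        p.ε * ((1 / 2) * (∑ j, v j x ^ 2) * pd i φ x + p.c * η x * pd i (Δ φ) x) =
      η x * (pd i φ + (p.ε * p.c) • pd i (Δ φ)) x +
        ∑ j, p.ε / 2 * (v j x * v j x * pd i φ x) := fun x => by
    change _ = η x * (pd i φ x + (p.ε * p.c) * pd i (Δ φ) x) + _
    rw [Fin.sum_univ_two, Fin.sum_univ_two]
    ring
  have hi : ∀ j, Integrable fun x => p.ε / 2 * (v j x * v j x * pd i φ x) := fun j =>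
    (integrable_mul_mul_test (v j) (v j) _).const_mul _
  simp_rw [hpt]
  rw [integral_add (integrable_mul_test η _) (integrable_finsetSum _ fun j _ => hi j),
    integral_finsetSum _ fun j _ => hi j]
  simp only [F, hatX, inner_sum, inner_add_right, integral_const_mul, integral_mul_eq,
    integral_mul_mul_eq]
  have hde : ∀ ξ, (p.de ξ : ℂ) ≠ 0 := fun ξ => by
    have := p.one_le_de ξ
    exact_mod_cast (show p.de ξ ≠ 0 by linarith)
  congr 1
  · refine inner_mulL_eq bdd_wt_neg (p.bdd_be adm_wt i) ?_
    filter_upwards [testW_coe (pd i φ + (p.ε * p.c) • pd i (Δ φ)), p.testW_dtest_coe φ]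
      with ξ h1 h2
    have : sh (pd i φ + (p.ε * p.c) • pd i (Δ φ)) ξ =
        sh (pd i φ) ξ + sh ((p.ε * p.c) • pd i (Δ φ)) ξ := by rw [sh_add]; rfl
    have h3 : (p.de ξ : ℂ) * p.be ξ = 1 - p.ε * p.c * (2 * Real.pi * ‖ξ‖ : ℝ) ^ 2 := by
      have : p.de ξ * p.be ξ = p.ce ξ := by
        rw [be, mul_div_cancel₀ _ (by exact_mod_cast hde ξ)]
      rw [← Complex.ofReal_mul, this, ce]; push_cast; ring
    rw [h1, h2, this, sh_smul, sh_pd, sh_pd, sh_laplacian, rs, sym]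
    simp only [map_add, map_mul, map_neg, Complex.conj_I, Complex.conj_ofReal]
    push_cast at h3 ⊢
    linear_combination (wt 4 ξ : ℂ) * (starRingEnd ℂ) (sh φ ξ) * Complex.I * freq i ξ *
      wt (-4) ξ * h3
  · refine Finset.sum_congr rfl fun j _ => ?_
    rw [← real_inner_smul_left]
    refine inner_convT_eq sqInt_wt_neg (p.sqInt_de adm_wt i) ?_
    filter_upwards [testW_coe (pd i φ), p.testW_dtest_coe φ,
      Lp.coeFn_smul (p.ε / 2) (testW (pd i φ))] with ξ h1 h2 h3
    rw [h3, Pi.smul_apply, h1, h2, sh_pd, rs, sym, Complex.real_smul]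
    simp only [map_mul, Complex.conj_I, Complex.conj_ofReal]
    push_cast
    field_simp [hde ξ]

lemma continuous_even_weights :
    Continuous (fun ξ => wt 4 ξ * p.de ξ) ∧ (∀ ξ, wt 4 ξ * p.de ξ ≠ 0) ∧
      ∀ ξ, wt 4 (-ξ) * p.de (-ξ) = wt 4 ξ * p.de ξ :=
  ⟨(continuous_wt 4).mul p.continuous_de,
    fun ξ => (mul_pos (wt_pos 4 ξ) (zero_lt_one.trans_le (p.one_le_de ξ))).ne',
    fun ξ => by rw [wt_neg_arg, de_neg]⟩

end Par

lemma wt_neg_even (ξ : Plane) : (starRingEnd ℂ) (rs (wt (-4)) (-ξ)) = rs (wt (-4)) ξ := by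
  rw [rs, wt_neg_arg, Complex.conj_ofReal]; rfl

lemma refl_hatX (η : L2) (v : Fin 2 → L2) : liftX refl (hatX η v) = hatX η v :=
  X.ext (refl_hat η) fun j => refl_hat (v j)

variable {p : Par} {s T : ℝ}

lemma FSol.solvesSystem {η : ℝ → L2} {v : ℝ → Fin 2 → L2}
    (h : FSol p s T fun t => hatX (η t) (v t)) : SolvesSystem p.a p.c p.d p.ε T η v := by
  intro t ht φ
  have hd := h.deriv t ht
  refine ⟨?_, fun i => ?_⟩
  · rw [p.integral_fst_eq]
    simp_rw [integral_mul_eq]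
    exact ((innerSL ℝ (testW φ)).comp
      (ContinuousLinearMap.fst ℝ HC (Fin 2 → HC))).hasFDerivAt.comp_hasDerivWithinAt t hd
  · rw [p.integral_snd_eq]
    simp_rw [p.integral_dtest_eq]
    exact ((innerSL ℝ (testW (p.dtest φ))).comp ((ContinuousLinearMap.proj i).comp
      (ContinuousLinearMap.snd ℝ HC (Fin 2 → HC)))).hasFDerivAt.comp_hasDerivWithinAt t hd

lemma tendsto_of_tendsto_hs {r : ℝ} (hr : 0 ≤ r) {f : ℝ → HC} {g : HC} {l : Filter ℝ}
    (h : Tendsto (fun τ => hs r (f τ - g)) l (𝓝 0)) : Tendsto f l (𝓝 g) := by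
  rw [tendsto_iff_edist_tendsto_0]
  refine tendsto_of_tendsto_of_tendsto_of_le_of_le tendsto_const_nhds h (fun _ => zero_le)
    fun τ => ?_
  rw [edist_eq_enorm_sub]
  exact norm_le_hs hr _

/-- The weak equations prescribe a derivative that is continuous with values in L², because `F (wt
(-4))` is continuous there. Test functions separate Hermitian states, so `hasDerivWithinAt_of_weak`
upgrades them to a derivative in norm. -/
lemma IsSolution.fSol (hs0 : 0 ≤ s) {η₀ : L2} {v₀ : Fin 2 → L2} {η : ℝ → L2}
    {v : ℝ → Fin 2 → L2} (h : IsSolution p.a p.c p.d p.ε s (s + 1) T η₀ v₀ η v) :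
    FSol p s T fun t => hatX (η t) (v t) := by
  obtain ⟨h1, h2⟩ := (continuousInH_iff hs0 η).1 h.continuous_eta
  have h3 := fun j => (continuousInH_iff (by linarith) _).1 (h.continuous_v j)
  set U : ℝ → X := fun t => hatX (η t) (v t) with hU
  have hUc : ContinuousOn U (Icc 0 T) := fun t ht =>
    (tendsto_of_tendsto_hs hs0 (h2 t ht)).prodMk_nhds (tendsto_pi_nhds.2 fun j =>
      tendsto_of_tendsto_hs (f := fun τ => hat (v τ j)) (by linarith : 0 ≤ s + 1) ((h3 j).2 t ht))
  refine ⟨fun t _ => refl_hatX _ _, h1, fun t ht j => (h3 j).1 t ht, h2,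
    fun t ht j => (h3 j).2 t ht, ?_⟩
  set ℓ₁ : 𝓢(Plane, ℝ) → X →L[ℝ] ℝ := fun φ =>
    (innerSL ℝ (testW φ)).comp (ContinuousLinearMap.fst ℝ HC (Fin 2 → HC)) with hℓ₁
  set ℓ₂ : Fin 2 → 𝓢(Plane, ℝ) → X →L[ℝ] ℝ := fun i φ => (innerSL ℝ (testW (p.dtest φ))).comp
    ((ContinuousLinearMap.proj i).comp (ContinuousLinearMap.snd ℝ HC (Fin 2 → HC))) with hℓ₂
  refine hasDerivWithinAt_of_weak ((p.lipB_F (wt (-4))).continuous.comp_continuousOn hUc)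
    (range ℓ₁ ∪ ⋃ i, range (ℓ₂ i)) (liftX refl - ContinuousLinearMap.id ℝ X) ?_ ?_ ?_ ?_
  · intro x hx hl
    have hx' : liftX refl x = x := sub_eq_zero.1 hx
    refine X.ext ?_ fun i => ?_
    · exact eq_zero_of_inner_test (Θ := testW) (continuous_wt 4) (fun ξ => (wt_pos 4 ξ).ne')
        (wt_neg_arg 4) testW_coe (congrArg Prod.fst hx')
        fun φ => hl (ℓ₁ φ) (Or.inl ⟨φ, rfl⟩)
    · obtain ⟨w1, w2, w3⟩ := p.continuous_even_weights
      exact eq_zero_of_inner_test (Θ := fun φ => testW (p.dtest φ)) w1 w2 w3 p.testW_dtest_coe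
        (congrFun (congrArg Prod.snd hx') i)
        fun φ => hl (ℓ₂ i φ) (Or.inr (mem_iUnion.2 ⟨i, φ, rfl⟩))
  · intro t _
    refine sub_eq_zero.2 (X.ext ?_ fun i => ?_)
    · exact (refl_mulL bdd_wt_neg wt_neg_even _).trans (congrArg _ (refl_hat _))
    · exact (refl_mulL bdd_wt_neg wt_neg_even _).trans (congrArg _ (refl_hat _))
  · intro t _
    refine sub_eq_zero.2 ?_
    change liftX refl (p.F (wt (-4)) (U t)) = p.F (wt (-4)) (U t)
    rw [← p.F_refl adm_wt (wt_neg_arg _), hU, refl_hatX]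
  · rintro ℓ (⟨φ, rfl⟩ | hℓ) t ht
    · have := (h.solves t ht φ).1
      rw [p.integral_fst_eq] at this
      simp_rw [integral_mul_eq] at this
      exact this
    · obtain ⟨i, φ, rfl⟩ := mem_iUnion.1 hℓ
      have := (h.solves t ht φ).2 i
      rw [p.integral_snd_eq] at this
      simp_rw [p.integral_dtest_eq] at this
      exact this

/-! ### Well-posedness -/

lemma FSol.congr {U V : ℝ → X} (h : FSol p s T U) (e : ∀ t ∈ Icc 0 T, V t = U t) :
    FSol p s T V where
  herm t ht := by rw [e t ht]; exact h.herm t ht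
  fst_lt t ht := by rw [e t ht]; exact h.fst_lt t ht
  snd_lt t ht j := by rw [e t ht]; exact h.snd_lt t ht j
  fst_cont t ht := (h.fst_cont t ht).congr' (eventually_mem_nhdsWithin.mono fun τ hτ => by
    simp only [e t ht, e τ hτ])
  snd_cont t ht j := (h.snd_cont t ht j).congr' (eventually_mem_nhdsWithin.mono fun τ hτ => by
    simp only [e t ht, e τ hτ])
  deriv t ht := by
    rw [e t ht]
    exact (h.deriv t ht).congr (fun τ hτ => by rw [e τ hτ]) (by rw [e t ht])

lemma FSol.isSolution (hs0 : 0 ≤ s) {η₀ : L2} {v₀ : Fin 2 → L2} {η : ℝ → L2}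
    {v : ℝ → Fin 2 → L2} (h : FSol p s T fun t => hatX (η t) (v t)) (h1 : η 0 = η₀)
    (h2 : v 0 = v₀) : IsSolution p.a p.c p.d p.ε s (s + 1) T η₀ v₀ η v where
  continuous_eta := (continuousInH_iff hs0 η).2 ⟨h.fst_lt, h.fst_cont⟩
  continuous_v j := (continuousInH_iff (by linarith) fun t => v t j).2
    ⟨fun t ht => h.snd_lt t ht j, fun t ht => h.snd_cont t ht j⟩
  initial_eta := h1
  initial_v := h2
  solves := h.solvesSystem

lemma IsSolution.unique (hs1 : 1 < s) {η₀ : L2} {v₀ : Fin 2 → L2} {η η' : ℝ → L2}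
    {v v' : ℝ → Fin 2 → L2} (h : IsSolution p.a p.c p.d p.ε s (s + 1) T η₀ v₀ η v)
    (h' : IsSolution p.a p.c p.d p.ε s (s + 1) T η₀ v₀ η' v') :
    ∀ t ∈ Icc 0 T, η' t = η t ∧ v' t = v t := by
  intro t ht
  have hs0 : 0 ≤ s := by linarith
  have e := (h'.fSol hs0).unique hs1 (h.fSol hs0)
    (by simp only [h.initial_eta, h.initial_v, h'.initial_eta, h'.initial_v]) t ht
  exact ⟨hat_injective (congrArg Prod.fst e),
    funext fun j => hat_injective (congrFun (congrArg Prod.snd e) j)⟩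

lemma vnormH_sq (s : ℝ) (v : Fin 2 → L2) : vnormH s v ^ 2 = ∑ j, normH s (v j) ^ 2 :=
  Real.sq_sqrt (Finset.sum_nonneg fun _ _ => sq_nonneg _)

lemma hs_rpow_two {u : L2} (hs0 : 0 ≤ s) (h : MemH s u) :
    hs s (hat u) ^ (2 : ℝ) = ENNReal.ofReal (normH s u ^ 2) := by
  have h1 := ((memH_iff hs0 u).1 h).ne
  rw [normH_eq, ENNReal.ofReal_pow ENNReal.toReal_nonneg, ENNReal.ofReal_toReal h1]
  norm_cast

lemma normH_sq_le {u : L2} {R : ℝ} (hR : 0 ≤ R) (h : hs s (hat u) ≤ ENNReal.ofReal R) :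
    normH s u ^ 2 ≤ R ^ 2 := by
  rw [normH_eq]
  exact pow_le_pow_left₀ ENNReal.toReal_nonneg (ENNReal.toReal_le_of_le_ofReal hR h) 2

/-- Existence, uniqueness and uniform bounds for one value of the small parameter. -/
theorem Par.exists_unique_solution (p : Par) {s : ℝ} (hs1 : 1 < s) {η₀ : L2} {v₀ : Fin 2 → L2}
    (hη : MemH s η₀) (hv : ∀ j, MemH (s + 1) (v₀ j)) {T B : ℝ} (hT0 : 0 ≤ T)
    (hB : B = normH s η₀ ^ 2 + p.hi * vnormH (s + 1) v₀ ^ 2)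
    (hT : √p.ε * p.enC s (⌈s⌉₊ + 1) * (3 * √(B + 1)) * T < 1) :
    ∃ (η : ℝ → L2) (v : ℝ → Fin 2 → L2),
      IsSolution p.a p.c p.d p.ε s (s + 1) T η₀ v₀ η v ∧
      (∀ (η' : ℝ → L2) (v' : ℝ → Fin 2 → L2),
        IsSolution p.a p.c p.d p.ε s (s + 1) T η₀ v₀ η' v' →
        ∀ t ∈ Icc 0 T, η' t = η t ∧ v' t = v t) ∧
      ∀ t ∈ Icc 0 T, normH s (η t) ^ 2 + vnormH s (v t) ^ 2 + p.ε * vnormH (s + 1) (v t) ^ 2 ≤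
        2 * (B + 1) * (1 + 4 / p.lo) := by
  have hs0 : 0 ≤ s := by linarith
  have hs0' : 0 ≤ s + 1 := by linarith
  have hhi := p.hi_pos
  have hlo := p.lo_pos
  have hε := p.hε
  have hB0 : 0 ≤ B := by rw [hB]; positivity
  obtain ⟨U, hU, hU0, hb⟩ := p.exists_fsol hs1 (W := hatX η₀ v₀) (refl_hatX _ _) hB0
    (by
      simp only [hatX, hs_rpow_two hs0 hη, hs_rpow_two hs0' (hv _)]
      rw [← ENNReal.ofReal_sum_of_nonneg fun _ _ => sq_nonneg _, ← vnormH_sq,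
        ← ENNReal.ofReal_mul hhi.le, ← ENNReal.ofReal_add (by positivity) (by positivity), hB])
    hT0 hT
  have hex : ∀ t, ∃ w : L2 × (Fin 2 → L2), t ∈ Icc 0 T → hatX w.1 w.2 = U t := fun t => by
    by_cases ht : t ∈ Icc 0 T
    · have hr := hU.herm t ht
      obtain ⟨η, hη⟩ := exists_hat (congrArg Prod.fst hr)
      choose v hv using fun j => exists_hat (congrFun (congrArg Prod.snd hr) j)
      exact ⟨(η, v), fun _ => X.ext hη hv⟩
    · exact ⟨0, fun h => (ht h).elim⟩
  choose w hw using hex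
  have h00 : (0 : ℝ) ∈ Icc 0 T := ⟨le_rfl, hT0⟩
  have h0 : hatX (w 0).1 (w 0).2 = hatX η₀ v₀ := (hw 0 h00).trans hU0
  have hsol := (hU.congr (V := fun t => hatX (w t).1 (w t).2) hw).isSolution hs0
    (η := fun t => (w t).1) (v := fun t => (w t).2)
    (hat_injective (congrArg Prod.fst h0))
    (funext fun j => hat_injective (congrFun (congrArg Prod.snd h0) j))
  refine ⟨_, _, hsol, fun η' v' h' => hsol.unique hs1 h', fun t ht => ?_⟩
  obtain ⟨b1, b2, b3⟩ := hb t ht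
  rw [← hw t ht] at b1 b2 b3
  have c1 := normH_sq_le (by positivity) b1
  have c2 := fun j => normH_sq_le (by positivity) (b2 j)
  have c3 := fun j => normH_sq_le (by positivity) (b3 j)
  simp only [mul_pow, inv_pow] at c1 c2 c3
  rw [Real.sq_sqrt (by positivity)] at c1
  rw [Real.sq_sqrt (by positivity), Real.sq_sqrt (by positivity)] at c2 c3
  rw [vnormH_sq, vnormH_sq, Fin.sum_univ_two, Fin.sum_univ_two]
  -- The bound on the highest norm of v is of size 1/(lo ε); the prefactor ε removes its dependence
  -- on ε.
  have d3 : ∀ j, p.ε * normH (s + 1) ((w t).2 j) ^ 2 ≤ p.lo⁻¹ * (2 * (B + 1)) := fun j => by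
    calc _ ≤ p.ε * ((p.lo * p.ε)⁻¹ * (2 * (B + 1))) := mul_le_mul_of_nonneg_left (c3 j) hε.le
      _ = _ := by field_simp
  -- The 4 counts two components of v, each in two norms.
  have e : 2 * (B + 1) * (1 + 4 / p.lo) = 2 * (B + 1) + 4 * (p.lo⁻¹ * (2 * (B + 1))) := by
    field_simp
  rw [e]
  have := c2 0; have := c2 1; have := d3 0; have := d3 1
  linarith

/-- Well-posedness on time intervals of length of order `ε ^ (-1/2)`. -/
theorem wellposed {a c d s : ℝ} (ha : a < 0) (hc : c < 0) (hd : 0 < d) (hs1 : 1 < s) :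
    ∃ T C : ℝ → ℝ → ℝ, (∀ x y, 0 < T x y) ∧
      ∀ ε : ℝ, 0 < ε → ε ≤ 1 → ∀ (η₀ : L2) (v₀ : Fin 2 → L2),
        MemH s η₀ → (∀ j, MemH (s + 1) (v₀ j)) →
        ∀ Tε B : ℝ, Tε = T (normH s η₀) (vnormH (s + 1) v₀) * ε ^ (-(1 / 2) : ℝ) →
          B = C (normH s η₀) (vnormH (s + 1) v₀) →
          ∃ (η : ℝ → L2) (v : ℝ → Fin 2 → L2),
            IsSolution a c d ε s (s + 1) Tε η₀ v₀ η v ∧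
            (∀ (η' : ℝ → L2) (v' : ℝ → Fin 2 → L2),
              IsSolution a c d ε s (s + 1) Tε η₀ v₀ η' v' →
              ∀ t ∈ Icc 0 Tε, η' t = η t ∧ v' t = v t) ∧
            ∀ t ∈ Icc 0 Tε,
              normH s (η t) ^ 2 + vnormH s (v t) ^ 2 + ε * vnormH (s + 1) (v t) ^ 2 ≤ B := by
  -- The constants `enC`, `hi` and `lo` do not involve ε, so their values at ε = 1 serve for every ε
  -- by definition.
  set p₁ : Par := { a := a, c := c, d := d, ε := 1, ha := ha, hc := hc, hd := hd,
                    hε := one_pos, hε1 := le_rfl } with hp₁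
  set E : ℝ := p₁.enC s (⌈s⌉₊ + 1) with hE
  have hE0 : 0 ≤ E := p₁.enC_nonneg _ _
  have hhi := p₁.hi_pos
  set R : ℝ → ℝ → ℝ := fun x y => x ^ 2 + p₁.hi * y ^ 2 with hR
  have hK : ∀ x y, 0 < (E + 1) * (3 * √(R x y + 1)) := fun x y => by
    have : 0 ≤ R x y := by simp only [hR]; positivity
    positivity
  refine ⟨fun x y => ((E + 1) * (3 * √(R x y + 1)))⁻¹,
    fun x y => 2 * (R x y + 1) * (1 + 4 / p₁.lo), fun x y => inv_pos.2 (hK x y), ?_⟩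
  rintro ε hε hε1 η₀ v₀ hη hv Tε B rfl rfl
  have hKp := hK (normH s η₀) (vnormH (s + 1) v₀)
  refine Par.exists_unique_solution
    { a := a, c := c, d := d, ε := ε, ha := ha, hc := hc, hd := hd, hε := hε, hε1 := hε1 }
    hs1 hη hv (by positivity) rfl ?_
  change √ε * E * (3 * √(R (normH s η₀) (vnormH (s + 1) v₀) + 1)) * _ < 1
  have h1 : √ε * ε ^ (-(1 / 2) : ℝ) = 1 := by
    rw [Real.sqrt_eq_rpow, ← Real.rpow_add hε]; norm_num
  set q := 3 * √(R (normH s η₀) (vnormH (s + 1) v₀) + 1)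
  have hq : 0 < q := pos_of_mul_pos_right hKp (by positivity)
  -- The powers of ε cancel; E + 1 in place of E keeps the quotient strictly below one and the
  -- denominator positive.
  calc √ε * E * q * (((E + 1) * q)⁻¹ * ε ^ (-(1 / 2) : ℝ))
      = (E * q) / ((E + 1) * q) * (√ε * ε ^ (-(1 / 2) : ℝ)) := by ring
    _ < 1 := by rw [h1, mul_one, div_lt_one hKp]; nlinarith

end Boussinesq

end
theorem theorem4p3 (a c d s : ℝ) (ha : a < 0) (hc : c < 0) (hd : 0 < d) (hs : 3 / 2 ≤ s) :
    (a = c →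
      ∃ T C : ℝ → ℝ → ℝ, (∀ x y, 0 < T x y) ∧
        ∀ ε : ℝ, 0 < ε → ε ≤ 1 →
        ∀ (η₀ : Boussinesq.L2) (v₀ : Fin 2 → Boussinesq.L2),
          Boussinesq.MemH s η₀ → (∀ j, Boussinesq.MemH (s + 1) (v₀ j)) →
          ∀ Tε B : ℝ,
            Tε = T (Boussinesq.normH s η₀) (Boussinesq.vnormH (s + 1) v₀) * ε ^ (-(1 / 2) : ℝ) →
            B = C (Boussinesq.normH s η₀) (Boussinesq.vnormH (s + 1) v₀) →
            ∃ (η : ℝ → Boussinesq.L2) (v : ℝ → Fin 2 → Boussinesq.L2),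
              Boussinesq.IsSolution a c d ε s (s + 1) Tε η₀ v₀ η v ∧
              (∀ (η' : ℝ → Boussinesq.L2) (v' : ℝ → Fin 2 → Boussinesq.L2),
                Boussinesq.IsSolution a c d ε s (s + 1) Tε η₀ v₀ η' v' →
                ∀ t ∈ Icc 0 Tε, η' t = η t ∧ v' t = v t) ∧
              ∀ t ∈ Icc 0 Tε,
                Boussinesq.normH s (η t) ^ 2 + Boussinesq.vnormH s (v t) ^ 2
                  + ε * Boussinesq.vnormH (s + 1) (v t) ^ 2 ≤ B) ∧
    (a ≠ c →
      ∃ T C : ℝ → ℝ → ℝ, (∀ x y, 0 < T x y) ∧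
        ∀ ε : ℝ, 0 < ε → ε ≤ 1 →
        ∀ (η₀ : Boussinesq.L2) (v₀ : Fin 2 → Boussinesq.L2),
          Boussinesq.MemH (s + 1) η₀ → (∀ j, Boussinesq.MemH (s + 2) (v₀ j)) →
          ∀ Tε B : ℝ,
            Tε = T (Boussinesq.normH (s + 1) η₀) (Boussinesq.vnormH (s + 2) v₀)
              * ε ^ (-(1 / 2) : ℝ) →
            B = C (Boussinesq.normH (s + 1) η₀) (Boussinesq.vnormH (s + 2) v₀) →
            ∃ (η : ℝ → Boussinesq.L2) (v : ℝ → Fin 2 → Boussinesq.L2),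
              Boussinesq.IsSolution a c d ε (s + 1) (s + 2) Tε η₀ v₀ η v ∧
              (∀ (η' : ℝ → Boussinesq.L2) (v' : ℝ → Fin 2 → Boussinesq.L2),
                Boussinesq.IsSolution a c d ε (s + 1) (s + 2) Tε η₀ v₀ η' v' →
                ∀ t ∈ Icc 0 Tε, η' t = η t ∧ v' t = v t) ∧
              ∀ t ∈ Icc 0 Tε,
                Boussinesq.normH (s + 1) (η t) ^ 2 + Boussinesq.vnormH (s + 1) (v t) ^ 2
                  + ε * Boussinesq.vnormH (s + 2) (v t) ^ 2 ≤ B) := by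
  -- Both regularity indices, s and s + 1, exceed the threshold 1 of `wellposed`.
  refine ⟨fun _ => Boussinesq.wellposed ha hc hd (by linarith), fun _ => ?_⟩
  have h := Boussinesq.wellposed ha hc hd (s := s + 1) (by linarith)
  rwa [show s + 1 + 1 = s + 2 by ring] at h
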